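/- Let $e<q$ be coprime positive integers, let $\mu=\{\mu_n\}$ be independent indeterminates indexed by the integers $n>0$ of the form $n=jq-ek$ with $1\le j\le e$, $k\ge 0$, and put $$f(x,y)=y^e+p_1(x)y^{e-1}+\cdots+p_{e-1}(x)y-p_e(x),\qquad p_j(x)=\sum_{k:\,jq-ek>0}\mu_{jq-ek}x^k\ (1\le j\le e-1),\qquad p_e(x)=x^q+\sum_{k=0}^{q-1}\mu_{eq-ek}x^k .$$ Let $\mathscr C$ be the curve $f(x,y)=0$ with its unique point $\infty$ at infinity, and $g=(e-1)(q-1)/2$. Let $(a,b)$ be integers with $ae-bq=1$ and $|a|$ minimal. The arithmetic local parameter at $\infty$ is $t=x^{-a}y^{b}$; with respect to it the coordinates have (unique) expansions $x(t)=t^{-e}+\cdots\in t^{-e}\mathbb Z[\mu][[t]]$ and $y(t)=t^{-q}+\cdots\in t^{-q}\mathbb Z[\mu][[t]]$. Weights are $\mathrm{wt}(\mu_n)=-n$ and $\mathrm{wt}(t)=\mathrm{wt}(dt)=1$. Let $0=m_0e+n_0q<m_1e+n_1q<\cdots$ be the elements of $\{me+nq\mid m,n\ge 0\}$ in increasing order,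 and let $w_1<\cdots<w_g$ be the positive integers not in this set. For $0\le j\le g-1$, and also for $j=0$ if $g=0$, let $$\omega_{w_{g-j}}=-\frac{x^{m_j}y^{n_j}\,dx}{f_y(x,y)},$$ so that $\omega_{w_g}=-dx/f_y$. For points $(x,y)=(x(t_1),y(t_1))$ and $(z,w)=(x(t_2),y(t_2))$ define $[t_1,t_2]$ by $$[t_1,t_2]\,dt_1=-\omega_{w_g}(t_1)\,\frac{1}{x-z}\,\frac{f(Z,y)-f(Z,w)}{y-w}\Big|_{Z=z}.$$ Then for $i=1,\dots,g$ there are differential forms of the second kind $\eta_{-w_i}(t)\in t^{-w_i-1}\mathbb Z[\mu][[t]]\,dt$, homogeneous of weight $-w_i$ (each is of the form $h(x,y)\,dx/f_y(x,y)$ with $h\in\mathbb Z[\mu][x,y]$, hence regular outside $\infty$, and has residue $0$ at $\infty$), such that the 2-form $$\xi(t_1,t_2)=\frac{d}{dt_2}[t_1,t_2]\,dt_1dt_2+\sum_{i=1}^g\omega_{w_i}(t_1)\,\eta_{-w_i}(t_2)$$ satisfies $$\xi(t_1,t_2)\in\frac{dt_1dt_2}{(t_2-t_1)^2}+\mathbb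 Z[\mu][[t_1,t_2]]\,dt_1dt_2,\qquad \xi(t_1,t_2)=\xi(t_2,t_1),$$ and the coefficient of $dt_1dt_2$ in $\xi$ is homogeneous of weight $-2$ (equivalently, of degree $2$ when $\mu_n$ has degree $n$ and $t_1,t_2$ have degree $-1$). The forms $\eta_{-w_i}$ are not unique: for every $i$ there are two systems $(\eta_{-w_1},\dots,\eta_{-w_g})$ with all these properties that differ in $\eta_{-w_i}$. -/

import Mathlib

noncomputable section

namespace PlaneMiura

/-- The positive integers `j * q - e * k` with `1 ≤ j ≤ e`, `0 ≤ k`: the subscripts of the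
coefficients `μ_n` that occur in the equation of the general `(e, q)`-curve. -/
abbrev CoeffIndex (e q : ℕ) : Type :=
  {n : ℕ // 0 < n ∧ ∃ j k : ℕ, 1 ≤ j ∧ j ≤ e ∧ n + e * k = j * q}

/-- The ring `ℤ[μ]`, the coefficients `μ_n` being independent indeterminates. -/
abbrev ZMu (e q : ℕ) : Type := MvPolynomial (CoeffIndex e q) ℤ

/-- The weight of the indeterminate `μ_n` is `-n`. -/
def muWeight (e q : ℕ) : CoeffIndex e q → ℤ := fun n => -(n.1 : ℤ)

/-- The coefficient `μ_{jq - ek}` (and `0` if there is no such coefficient). -/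
def mu (e q j k : ℕ) : ZMu e q :=
  if h : (1 ≤ j ∧ j ≤ e) ∧ e * k < j * q then
    MvPolynomial.X ⟨j * q - e * k, by omega, j, k, h.1.1, h.1.2, by omega⟩
  else 0

/-- `p_j(x) = ∑_{k : jq - ek > 0} μ_{jq - ek} x ^ k` for `j < e`, and
`p_e(x) = x ^ q + ∑_{k < q} μ_{eq - ek} x ^ k`.
The variable `x` is `X 0`, the variable `y` is `X 1`. -/
def pPoly (e q j : ℕ) : MvPolynomial (Fin 2) (ZMu e q) :=
  (if j = e then MvPolynomial.X 0 ^ q else 0) +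
    ∑ k ∈ Finset.range (j * q), MvPolynomial.C (mu e q j k) * MvPolynomial.X 0 ^ k

/-- The equation of the curve,
`f(x, y) = y ^ e + p_1(x) y ^ (e - 1) + ⋯ + p_{e-1}(x) y - p_e(x)`. -/
def curvePoly (e q : ℕ) : MvPolynomial (Fin 2) (ZMu e q) :=
  MvPolynomial.X 1 ^ e
    + ∑ j ∈ Finset.Icc 1 (e - 1), pPoly e q j * MvPolynomial.X 1 ^ (e - j)
    - pPoly e q e

/-- `g = (e - 1)(q - 1) / 2`. -/
def genus (e q : ℕ) : ℕ := (e - 1) * (q - 1) / 2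

/-- `n` lies in the semigroup `{m e + n q | m, n ≥ 0}`. -/
def IsNongap (e q : ℕ) (s : ℕ) : Prop := ∃ m n : ℕ, m * e + n * q = s

/-- The Weierstrass gaps in increasing order, indexed from `0`: `gap e q i` is `w_{i+1}`. -/
def gap (e q i : ℕ) : ℕ := Nat.nth (fun s => ¬ IsNongap e q s) i

/-- The elements of the semigroup in increasing order: `nongap e q j` is `m_j e + n_j q`. -/
def nongap (e q j : ℕ) : ℕ := Nat.nth (IsNongap e q) j

/-- The pair `(m_j, n_j)`. For `j < g` it is determined by `m_j e + n_j q = nongap e q j`. -/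
def nongapExp (e q j : ℕ) : ℕ × ℕ :=
  Classical.epsilon fun r : ℕ × ℕ => r.1 * e + r.2 * q = nongap e q j

/-- The pair of integers `(a, b)` with `a e - b q = 1` and `|a|` minimal. -/
structure IsArithmeticPair (e q : ℕ) (a b : ℤ) : Prop where
  bezout : a * e - b * q = 1
  minimal : ∀ a' b' : ℤ, a' * e - b' * q = 1 → |a| ≤ |a'|

/-- The Laurent series `x, y ∈ ℤ[μ]((t))` are the expansions of the coordinate functions with
respect to the arithmetic local parameter: `f(x, y) = 0`, `x ^ (-a) * y ^ b = t`,
`x = t ^ (-e) + ⋯` and `y = t ^ (-q) + ⋯`. -/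
structure IsExpansion (e q : ℕ) (a b : ℤ) (x y : (LaurentSeries (ZMu e q))ˣ) : Prop where
  curve : MvPolynomial.aeval ![(x : LaurentSeries (ZMu e q)), (y : LaurentSeries (ZMu e q))]
    (curvePoly e q) = 0
  parameter : ((x ^ (-a) * y ^ b : (LaurentSeries (ZMu e q))ˣ) : LaurentSeries (ZMu e q)) =
    HahnSeries.single 1 1
  x_order : ∀ n : ℤ, n < -(e : ℤ) → (x : LaurentSeries (ZMu e q)).coeff n = 0
  x_lead : (x : LaurentSeries (ZMu e q)).coeff (-(e : ℤ)) = 1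
  y_order : ∀ n : ℤ, n < -(q : ℤ) → (y : LaurentSeries (ZMu e q)).coeff n = 0
  y_lead : (y : LaurentSeries (ZMu e q)).coeff (-(q : ℤ)) = 1

/-- A contraction of the power series ring has exactly one fixed point. -/
theorem existsUnique_fixed {R : Type*} [CommRing R] (h : Polynomial (PowerSeries R)) :
    ∃! s : PowerSeries R, s = 1 + PowerSeries.X * h.eval s := by
  have hdiff : ∀ s t : PowerSeries R, s - t ∣ h.eval s - h.eval t :=
    fun s t => Polynomial.sub_dvd_eval_sub s t h
  set F : PowerSeries R → PowerSeries R := fun s => 1 + PowerSeries.X * h.eval s with hF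
  have hFdiff : ∀ (n : ℕ) (s t : PowerSeries R), PowerSeries.X ^ n ∣ s - t →
      PowerSeries.X ^ (n + 1) ∣ F s - F t := by
    intro n s t hst
    have : F s - F t = PowerSeries.X * (h.eval s - h.eval t) := by simp only [hF]; ring
    rw [this, pow_succ']
    exact mul_dvd_mul_left _ (hst.trans (hdiff s t))
  have hit : ∀ n, PowerSeries.X ^ n ∣ F^[n + 1] 1 - F^[n] 1 := by
    intro n
    induction n with
    | zero => simp
    | succ n ih =>
      have h1 := hFdiff n _ _ ih
      rwa [← Function.iterate_succ_apply' F (n + 1), ← Function.iterate_succ_apply' F n] at h1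
  have hit2 : ∀ n m, PowerSeries.X ^ n ∣ F^[n + m] 1 - F^[n] 1 := by
    intro n m
    induction m with
    | zero => simp
    | succ m ih =>
      have := (pow_dvd_pow (PowerSeries.X : PowerSeries R) (Nat.le_add_right n m)).trans
        (hit (n + m))
      have h3 := dvd_add this ih
      rwa [sub_add_sub_cancel] at h3
  let s : PowerSeries R := PowerSeries.mk fun n => PowerSeries.coeff n (F^[n + 1] 1)
  have hs : ∀ n, PowerSeries.X ^ n ∣ s - F^[n] 1 := by
    intro n
    rw [PowerSeries.X_pow_dvd_iff]
    intro m hm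
    have h4 := hit2 (m + 1) (n - (m + 1))
    rw [show m + 1 + (n - (m + 1)) = n by omega, PowerSeries.X_pow_dvd_iff] at h4
    have h5 := h4 m (by omega)
    rw [map_sub] at h5 ⊢
    simp only [s, PowerSeries.coeff_mk]
    rw [← neg_sub, h5, neg_zero]
  have hs0 : s = F s := by
    rw [← sub_eq_zero]
    ext n
    have h7 : F^[n + 1 + 1] 1 = F (F^[n + 1] 1) := Function.iterate_succ_apply' _ _ _
    have h6 := dvd_sub ((pow_dvd_pow _ (Nat.le_succ _)).trans (hs (n + 1 + 1)))
      ((pow_dvd_pow _ (Nat.le_succ _)).trans (hFdiff (n + 1) _ _ (hs (n + 1))))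
    rw [h7, sub_sub_sub_cancel_right, PowerSeries.X_pow_dvd_iff] at h6
    exact h6 n (Nat.lt_succ_self n)
  refine ⟨s, hs0, ?_⟩
  · intro t ht
    obtain ⟨c, hc⟩ := hdiff t s
    have hFs : s = F s := hs0
    have h8 : (1 - PowerSeries.X * c) * (t - s) = 0 := by
      have h9 : t - s = PowerSeries.X * (h.eval t - h.eval s) := by
        conv_lhs => rw [ht, hFs]
        simp only [hF]
        ring
      linear_combination h9 + PowerSeries.X * hc
    have hu : IsUnit (1 - PowerSeries.X * c) := by
      rw [PowerSeries.isUnit_iff_constantCoeff]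
      simp
    exact sub_eq_zero.mp ((hu.mul_right_eq_zero).mp h8)

/-- The Laurent series in `1 + t R[[t]]`, as a group. -/
def oneUnits (R : Type*) [CommRing R] : Subgroup (LaurentSeries R)ˣ :=
  (Units.map (PowerSeries.constantCoeff (R := R)).toMonoidHom).ker.map
    (Units.map (HahnSeries.ofPowerSeries ℤ R).toMonoidHom)

theorem mem_oneUnits {R : Type*} [CommRing R] (u : (LaurentSeries R)ˣ) :
    u ∈ oneUnits R ↔ (∀ n : ℤ, n < 0 → (u : LaurentSeries R).coeff n = 0) ∧
      (u : LaurentSeries R).coeff 0 = 1 := by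
  constructor
  · rintro ⟨w, hw, rfl⟩
    have hw1 : PowerSeries.constantCoeff (w : PowerSeries R) = 1 := by
      simpa [MonoidHom.mem_ker, Units.ext_iff] using hw
    constructor
    · intro n hn
      obtain ⟨m, rfl⟩ : ∃ m : ℕ, n = Int.negSucc m := ⟨(-n - 1).toNat, by omega⟩
      change (HahnSeries.ofPowerSeries ℤ R (w : PowerSeries R)).coeff _ = 0
      rw [HahnSeries.ofPowerSeries_apply]
      apply HahnSeries.embDomain_of_notMem_range
      simp
    · change (HahnSeries.ofPowerSeries ℤ R (w : PowerSeries R)).coeff ((0 : ℕ) : ℤ) = 1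
      rw [HahnSeries.ofPowerSeries_apply_coeff]
      simpa using hw1
  · rintro ⟨h0, h1⟩
    let w : PowerSeries R := PowerSeries.mk fun n => (u : LaurentSeries R).coeff n
    have hw1 : PowerSeries.constantCoeff w = 1 := by
      rw [← PowerSeries.coeff_zero_eq_constantCoeff_apply]
      simpa [w] using h1
    have hw : IsUnit w := by
      rw [PowerSeries.isUnit_iff_constantCoeff, hw1]
      exact isUnit_one
    refine ⟨hw.unit, ?_, ?_⟩
    · simp [MonoidHom.mem_ker, Units.ext_iff, hw1]
    · ext n
      change (HahnSeries.ofPowerSeries ℤ R w).coeff n = _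
      rcases lt_or_ge n 0 with hn | hn
      · rw [h0 n hn, HahnSeries.ofPowerSeries_apply]
        apply HahnSeries.embDomain_of_notMem_range
        rintro ⟨m, hm⟩
        simp at hm
        omega
      · lift n to ℕ using hn
        rw [HahnSeries.ofPowerSeries_apply_coeff]
        simp [w]

/-- The parameter `t` as a unit of `R((t))`. -/
def tUnit (R : Type*) [CommRing R] : (LaurentSeries R)ˣ where
  val := HahnSeries.single 1 1
  inv := HahnSeries.single (-1) 1
  val_inv := by simp
  inv_val := by simp

theorem tUnit_zpow (R : Type*) [CommRing R] (n : ℤ) :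
    ((tUnit R ^ n : (LaurentSeries R)ˣ) : LaurentSeries R) = HahnSeries.single n 1 := by
  induction n using Int.induction_on with
  | zero => simp
  | succ n ih => rw [zpow_add_one, Units.val_mul, ih]; simp [tUnit]
  | pred n ih => 
    rw [zpow_sub_one, Units.val_mul, ih]
    change _ * HahnSeries.single (-1) 1 = _
    simp [sub_eq_add_neg]

theorem mul_tUnit_mem_iff {R : Type*} [CommRing R] (x : (LaurentSeries R)ˣ) (e : ℤ) :
    x * tUnit R ^ e ∈ oneUnits R ↔ (∀ n : ℤ, n < -e → (x : LaurentSeries R).coeff n = 0) ∧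
      (x : LaurentSeries R).coeff (-e) = 1 := by
  have key : ∀ n : ℤ, ((x * tUnit R ^ e : (LaurentSeries R)ˣ) : LaurentSeries R).coeff n =
      (x : LaurentSeries R).coeff (n - e) := by
    intro n
    rw [Units.val_mul, tUnit_zpow]
    have := HahnSeries.coeff_mul_single_add (r := (1 : R)) (x := (x : LaurentSeries R))
      (a := n - e) (b := e)
    rw [sub_add_cancel, mul_one] at this
    exact this
  rw [mem_oneUnits]
  simp only [key, zero_sub]
  refine and_congr_left fun _ => ⟨fun h n hn => ?_, fun h n hn => h _ (by omega)⟩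
  have := h (n + e) (by omega)
  rwa [add_sub_cancel_right] at this

theorem exists_oneUnit {R : Type*} [CommRing R] (e q : ℕ) (a b : ℤ) (he : 0 < e) (heq : e < q)
    (h : a * e - b * q = 1) (x y : (LaurentSeries R)ˣ)
    (hp : x ^ (-a) * y ^ b = tUnit R) (hx : x * tUnit R ^ (e : ℤ) ∈ oneUnits R)
    (hy : y * tUnit R ^ (q : ℤ) ∈ oneUnits R) :
    ∃ S ∈ oneUnits R, x = tUnit R ^ (-(e : ℤ)) * S ^ (-(b.natAbs : ℤ)) ∧
      y = tUnit R ^ (-(q : ℤ)) * S ^ (-(a.natAbs : ℤ)) := by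
  set T := tUnit R
  set u := x * T ^ (e : ℤ) with hu
  set v := y * T ^ (q : ℤ) with hv
  have huv : u ^ a = v ^ b := by
    have h1 : u ^ (-a) * v ^ b = 1 := by
      have : u ^ (-a) * v ^ b = (x ^ (-a) * y ^ b) * T ^ (-(a * e - b * q)) := by
        rw [hu, hv, mul_zpow, mul_zpow, ← zpow_mul, ← zpow_mul,
          show -(a * (e : ℤ) - b * q) = e * (-a) + q * b by ring, zpow_add]
        exact mul_mul_mul_comm _ _ _ _
      rw [this, hp, h, zpow_neg_one, mul_inv_cancel]
    rw [zpow_neg] at h1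
    exact (inv_mul_eq_one.mp h1)
  set τ := u ^ (-(q : ℤ)) * v ^ (e : ℤ) with hτ
  have hτm : τ ∈ oneUnits R := mul_mem (zpow_mem hx _) (zpow_mem hy _)
  have hτb : τ ^ b = u := by
    rw [hτ, mul_zpow, ← zpow_mul, ← zpow_mul, mul_comm (e : ℤ) b, zpow_mul v b, ← huv,
      ← zpow_mul, ← zpow_add, show -(q : ℤ) * b + a * e = 1 by linarith, zpow_one]
  have hτa : τ ^ a = v := by
    rw [hτ, mul_zpow, ← zpow_mul, ← zpow_mul, show -(q : ℤ) * a = a * (-q) by ring,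
      zpow_mul u a, huv, ← zpow_mul, ← zpow_add, show b * -(q : ℤ) + e * a = 1 by linarith,
      zpow_one]
  have hxx : x = T ^ (-(e : ℤ)) * u := by
    rw [hu, mul_comm x, ← mul_assoc, ← zpow_add, neg_add_cancel, zpow_zero, one_mul]
  have hyy : y = T ^ (-(q : ℤ)) * v := by
    rw [hv, mul_comm y, ← mul_assoc, ← zpow_add, neg_add_cancel, zpow_zero, one_mul]
  rcases le_or_gt 0 b with hb | hb
  · have ha : 0 ≤ a := by nlinarith
    refine ⟨τ⁻¹, inv_mem hτm, ?_, ?_⟩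
    · rw [Int.natAbs_of_nonneg hb, inv_zpow', neg_neg, hτb, ← hxx]
    · rw [Int.natAbs_of_nonneg ha, inv_zpow', neg_neg, hτa, ← hyy]
  · have ha : a ≤ 0 := by nlinarith
    refine ⟨τ, hτm, ?_, ?_⟩
    · rw [Int.ofNat_natAbs_of_nonpos hb.le, neg_neg, hτb, ← hxx]
    · rw [Int.ofNat_natAbs_of_nonpos ha, neg_neg, hτa, ← hyy]

theorem zpow_of_oneUnit {R : Type*} [CommRing R] (e q : ℕ) (a b : ℤ) (he : 0 < e) (heq : e < q)
    (h : a * e - b * q = 1) (S : (LaurentSeries R)ˣ) :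
    (tUnit R ^ (-(e : ℤ)) * S ^ (-(b.natAbs : ℤ))) ^ (-a) *
      (tUnit R ^ (-(q : ℤ)) * S ^ (-(a.natAbs : ℤ))) ^ b = tUnit R := by
  have h0 : -(b.natAbs : ℤ) * (-a) + -(a.natAbs : ℤ) * b = 0 := by
    rcases le_or_gt 0 b with hb | hb
    · have ha : 0 ≤ a := by nlinarith
      rw [Int.natAbs_of_nonneg hb, Int.natAbs_of_nonneg ha]
      ring
    · have ha : a ≤ 0 := by nlinarith
      rw [Int.ofNat_natAbs_of_nonpos hb.le, Int.ofNat_natAbs_of_nonpos ha]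
      ring
  rw [mul_zpow, mul_zpow, ← zpow_mul, ← zpow_mul, ← zpow_mul, ← zpow_mul, mul_mul_mul_comm,
    ← zpow_add, ← zpow_add, h0, zpow_zero, mul_one,
    show -(e : ℤ) * -a + -(q : ℤ) * b = 1 by linarith, zpow_one]

theorem exponent_le (e q A B N j k : ℕ) (he : 0 < e) (hA : e * A ≤ N) (hB : q * B ≤ N)
    (hj : j ≤ e) (hk : e * k < j * q) : B * k + A * (e - j) ≤ N := by
  obtain ⟨i, rfl⟩ := Nat.exists_eq_add_of_le hj
  rw [Nat.add_sub_cancel_left]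
  have h1 : (j + i) * (B * k) ≤ j * N := by
    calc (j + i) * (B * k) = B * ((j + i) * k) := by ring
      _ ≤ B * (j * q) := Nat.mul_le_mul_left _ hk.le
      _ = j * (q * B) := by ring
      _ ≤ j * N := Nat.mul_le_mul_left _ hB
  have h2 : (j + i) * (A * i) ≤ i * N := by
    calc (j + i) * (A * i) = i * ((j + i) * A) := by ring
      _ ≤ i * N := Nat.mul_le_mul_left _ hA
  have h3 : (j + i) * (B * k + A * i) ≤ (j + i) * N := by
    calc (j + i) * (B * k + A * i) = (j + i) * (B * k) + (j + i) * (A * i) := by ring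
      _ ≤ j * N + i * N := Nat.add_le_add h1 h2
      _ = (j + i) * N := by ring
  exact Nat.le_of_mul_le_mul_left h3 he

/-- The `j`-th part of the equation of the curve in the variables `t` and `s / t²`, without its
leading term, divided by `t`. -/
def tailPoly (e q A B N j : ℕ) : Polynomial (PowerSeries (ZMu e q)) :=
  ∑ k ∈ Finset.range (j * q),
    Polynomial.C (PowerSeries.C (mu e q j k) * PowerSeries.X ^ (j * q - e * k - 1)) *
      Polynomial.X ^ (N - (B * k + A * (e - j)))

theorem monomial_transform {R : Type*} [CommRing R] (e q A B N j k : ℕ)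
    (hj : j ≤ e) (hk : e * k ≤ j * q)
    (hN : B * k + A * (e - j) ≤ N) (S : (LaurentSeries R)ˣ) :
    tUnit R ^ (e * q) * S ^ N * ((tUnit R ^ (-(e : ℤ)) * S ^ (-(B : ℤ))) ^ k *
      (tUnit R ^ (-(q : ℤ)) * S ^ (-(A : ℤ))) ^ (e - j)) =
      tUnit R ^ (j * q - e * k) * S ^ (N - (B * k + A * (e - j))) := by
  have h1 : (-(e : ℤ)) * k + -(q : ℤ) * (e - j : ℕ) + (e * q : ℕ) = (j * q - e * k : ℕ) := by
    push_cast [Nat.cast_sub hj, Nat.cast_sub hk]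
    ring
  have h2 : (-(B : ℤ)) * k + -(A : ℤ) * (e - j : ℕ) + (N : ℕ) =
      (N - (B * k + A * (e - j)) : ℕ) := by
    rw [Nat.cast_sub hN]
    push_cast
    ring
  rw [← zpow_natCast (tUnit R) (j * q - e * k), ← h1,
    ← zpow_natCast S (N - (B * k + A * (e - j))), ← h2]
  simp only [← zpow_natCast, mul_zpow, ← zpow_mul, zpow_add]
  simp only [mul_comm, mul_left_comm, mul_assoc]

theorem tail_transform (e q A B N j : ℕ) (he : 0 < e) (hA : e * A ≤ N) (hB : q * B ≤ N)
    (hj : j ≤ e) (S : (LaurentSeries (ZMu e q))ˣ) (s : PowerSeries (ZMu e q))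
    (hs : (S : LaurentSeries (ZMu e q)) = HahnSeries.ofPowerSeries ℤ _ s)
    (x y : (LaurentSeries (ZMu e q))ˣ)
    (hx : x = tUnit (ZMu e q) ^ (-(e : ℤ)) * S ^ (-(B : ℤ)))
    (hy : y = tUnit (ZMu e q) ^ (-(q : ℤ)) * S ^ (-(A : ℤ))) :
    ((tUnit (ZMu e q) ^ (e * q) * S ^ N : (LaurentSeries (ZMu e q))ˣ) :
      LaurentSeries (ZMu e q)) *
      ((∑ k ∈ Finset.range (j * q), algebraMap (ZMu e q) (LaurentSeries (ZMu e q)) (mu e q j k) *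
        (x : LaurentSeries (ZMu e q)) ^ k) * (y : LaurentSeries (ZMu e q)) ^ (e - j)) =
      HahnSeries.ofPowerSeries ℤ _ (PowerSeries.X * (tailPoly e q A B N j).eval s) := by
  rw [tailPoly, Polynomial.eval_finsetSum, Finset.mul_sum, map_sum, Finset.sum_mul,
    Finset.mul_sum]
  refine Finset.sum_congr rfl fun k _ => ?_
  by_cases hk : e * k < j * q
  · have h1 := congrArg (Units.val) (monomial_transform e q A B N j k hj hk.le
      (exponent_le e q A B N j k he hA hB hj hk) S)
    rw [← hx, ← hy] at h1
    simp only [Units.val_mul, Units.val_pow_eq_pow_val, hs] at h1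
    have h2 : ((tUnit (ZMu e q) : (LaurentSeries (ZMu e q))ˣ) : LaurentSeries (ZMu e q)) =
      HahnSeries.ofPowerSeries ℤ _ PowerSeries.X := by
      rw [HahnSeries.ofPowerSeries_X]; rfl
    rw [h2] at h1
    have h3 : PowerSeries.X * (Polynomial.C (PowerSeries.C (mu e q j k) *
        PowerSeries.X ^ (j * q - e * k - 1)) *
        Polynomial.X ^ (N - (B * k + A * (e - j)))).eval s =
        PowerSeries.C (mu e q j k) * (PowerSeries.X ^ (j * q - e * k) *
          s ^ (N - (B * k + A * (e - j)))) := by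
      obtain ⟨r, hr⟩ : ∃ r, j * q - e * k = r + 1 := ⟨j * q - e * k - 1, by omega⟩
      rw [hr]
      simp only [Polynomial.eval_mul, Polynomial.eval_C, Polynomial.eval_pow, Polynomial.eval_X,
        Nat.add_sub_cancel]
      ring
    rw [h3, map_mul, map_mul, map_pow, map_pow, ← h1, HahnSeries.ofPowerSeries_C]
    simp only [Units.val_mul, Units.val_pow_eq_pow_val, hs]
    have h4 : algebraMap (ZMu e q) (LaurentSeries (ZMu e q)) (mu e q j k) =
      HahnSeries.C (mu e q j k) := by
      rw [HahnSeries.algebraMap_apply', PowerSeries.algebraMap_apply, Algebra.algebraMap_self_apply,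
        HahnSeries.ofPowerSeries_C]
    rw [h4, h2]
    ring
  · have h0 : mu e q j k = 0 := by
      rw [mu, dif_neg]
      exact fun h => hk h.2
    simp [h0]

/-- The equation of the curve in terms of `s`, where `x = t ^ (-e) * s ^ (-|b|)` and
`y = t ^ (-q) * s ^ (-|a|)`. -/
theorem curve_transform (e q A B N : ℕ) (he : 0 < e) (hA : e * A ≤ N) (hB : q * B ≤ N)
    (S : (LaurentSeries (ZMu e q))ˣ) (s : PowerSeries (ZMu e q))
    (hs : (S : LaurentSeries (ZMu e q)) = HahnSeries.ofPowerSeries ℤ _ s)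
    (x y : (LaurentSeries (ZMu e q))ˣ)
    (hx : x = tUnit (ZMu e q) ^ (-(e : ℤ)) * S ^ (-(B : ℤ)))
    (hy : y = tUnit (ZMu e q) ^ (-(q : ℤ)) * S ^ (-(A : ℤ))) :
    MvPolynomial.aeval ![(x : LaurentSeries (ZMu e q)), (y : LaurentSeries (ZMu e q))]
      (curvePoly e q) = 0 ↔
    s ^ (N - A * e) - s ^ (N - B * q) + PowerSeries.X *
      (∑ j ∈ Finset.Icc 1 (e - 1), tailPoly e q A B N j - tailPoly e q A B N e).eval s = 0 := by
  have hsv : ((S : (LaurentSeries (ZMu e q))ˣ) : LaurentSeries (ZMu e q)) =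
    HahnSeries.ofPowerSeries ℤ _ s := hs
  have key : ((tUnit (ZMu e q) ^ (e * q) * S ^ N : (LaurentSeries (ZMu e q))ˣ) :
      LaurentSeries (ZMu e q)) *
      MvPolynomial.aeval ![(x : LaurentSeries (ZMu e q)), (y : LaurentSeries (ZMu e q))]
        (curvePoly e q) =
      HahnSeries.ofPowerSeries ℤ _ (s ^ (N - A * e) - s ^ (N - B * q) + PowerSeries.X *
      (∑ j ∈ Finset.Icc 1 (e - 1), tailPoly e q A B N j - tailPoly e q A B N e).eval s) := by
    have hY := congrArg Units.val (monomial_transform e q A B N 0 0 (Nat.zero_le _)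
      (by simp) (by simpa [mul_comm] using hA) S)
    have hX := congrArg Units.val (monomial_transform e q A B N e q le_rfl
      le_rfl (by simpa [mul_comm] using hB) S)
    rw [← hx, ← hy] at hY hX
    simp only [pow_zero, one_mul, Nat.sub_zero, zero_mul, mul_zero, zero_add, Nat.sub_self,
      mul_one, add_zero, Units.val_mul, Units.val_pow_eq_pow_val, hsv] at hX hY
    have hT := fun j hj => tail_transform e q A B N j he hA hB hj S s hs x y hx hy
    have hTe := hT e le_rfl
    rw [Nat.sub_self, pow_zero, mul_one] at hTe
    have hsum : ∀ j ∈ Finset.Icc 1 (e - 1),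
        ((tUnit (ZMu e q) ^ (e * q) * S ^ N : (LaurentSeries (ZMu e q))ˣ) :
          LaurentSeries (ZMu e q)) *
        MvPolynomial.aeval ![(x : LaurentSeries (ZMu e q)), (y : LaurentSeries (ZMu e q))]
          (pPoly e q j * MvPolynomial.X 1 ^ (e - j)) =
        HahnSeries.ofPowerSeries ℤ _ (PowerSeries.X * (tailPoly e q A B N j).eval s) := by
      intro j hj
      rw [Finset.mem_Icc] at hj
      rw [← hT j (by omega), pPoly, if_neg (by omega)]
      simp
    have hpe : MvPolynomial.aeval ![(x : LaurentSeries (ZMu e q)),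
        (y : LaurentSeries (ZMu e q))] (pPoly e q e) = (x : LaurentSeries (ZMu e q)) ^ q +
        ∑ k ∈ Finset.range (e * q), algebraMap (ZMu e q) (LaurentSeries (ZMu e q)) (mu e q e k) *
        (x : LaurentSeries (ZMu e q)) ^ k := by
      rw [pPoly, if_pos rfl]
      simp
    have hYe : MvPolynomial.aeval ![(x : LaurentSeries (ZMu e q)),
        (y : LaurentSeries (ZMu e q))] (MvPolynomial.X 1 ^ e : MvPolynomial (Fin 2) (ZMu e q)) =
        (y : LaurentSeries (ZMu e q)) ^ e := by simp
    rw [curvePoly, map_sub, map_add, map_sum, mul_sub, mul_add, Finset.mul_sum,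
      Finset.sum_congr rfl hsum, hpe, mul_add, hTe, hYe, Units.val_mul,
      Units.val_pow_eq_pow_val, Units.val_pow_eq_pow_val, hsv, hX, hY, Polynomial.eval_sub,
      Polynomial.eval_finsetSum, mul_sub, Finset.mul_sum]
    simp only [map_sub, map_add, map_sum, map_pow]
    ring
  rw [← (tUnit (ZMu e q) ^ (e * q) * S ^ N).isUnit.mul_right_eq_zero, key,
    map_eq_zero_iff _ HahnSeries.ofPowerSeries_injective]

theorem exists_contraction (e q : ℕ) (a b : ℤ) (he : 0 < e) (heq : e < q)
    (h : a * e - b * q = 1) : ∃ H : Polynomial (PowerSeries (ZMu e q)),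
    ∀ (S : (LaurentSeries (ZMu e q))ˣ) (s : PowerSeries (ZMu e q)),
      (S : LaurentSeries (ZMu e q)) = HahnSeries.ofPowerSeries ℤ _ s →
      ∀ x y : (LaurentSeries (ZMu e q))ˣ,
      x = tUnit (ZMu e q) ^ (-(e : ℤ)) * S ^ (-(b.natAbs : ℤ)) →
      y = tUnit (ZMu e q) ^ (-(q : ℤ)) * S ^ (-(a.natAbs : ℤ)) →
      (MvPolynomial.aeval ![(x : LaurentSeries (ZMu e q)), (y : LaurentSeries (ZMu e q))]
        (curvePoly e q) = 0 ↔ s = 1 + PowerSeries.X * H.eval s) := by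
  rcases le_or_gt 0 b with hb | hb
  · have ha : 0 ≤ a := by nlinarith
    have hab : a.natAbs * e = b.natAbs * q + 1 := by
      zify
      rw [abs_of_nonneg ha, abs_of_nonneg hb]
      linarith
    refine ⟨∑ j ∈ Finset.Icc 1 (e - 1), tailPoly e q a.natAbs b.natAbs (a.natAbs * e) j
      - tailPoly e q a.natAbs b.natAbs (a.natAbs * e) e, fun S s hs x y hx hy => ?_⟩
    rw [curve_transform e q a.natAbs b.natAbs (a.natAbs * e) he (by rw [mul_comm])
      (by rw [hab, mul_comm]; omega) S s hs x y hx hy, Nat.sub_self, hab,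
      Nat.add_sub_cancel_left, pow_zero, pow_one]
    constructor
    · intro h1
      linear_combination -h1
    · intro h1
      linear_combination -h1
  · have ha : a ≤ 0 := by nlinarith
    have hab : a.natAbs * e + 1 = b.natAbs * q := by
      zify
      rw [abs_of_nonpos ha, abs_of_neg hb]
      linarith
    refine ⟨-(∑ j ∈ Finset.Icc 1 (e - 1), tailPoly e q a.natAbs b.natAbs (b.natAbs * q) j
      - tailPoly e q a.natAbs b.natAbs (b.natAbs * q) e), fun S s hs x y hx hy => ?_⟩
    rw [curve_transform e q a.natAbs b.natAbs (b.natAbs * q) he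
      (by rw [← hab, mul_comm]; omega) (by rw [mul_comm]) S s hs x y hx hy, Nat.sub_self,
      ← hab, Nat.add_sub_cancel_left, pow_zero, pow_one, Polynomial.eval_neg]
    constructor
    · intro h1
      linear_combination h1
    · intro h1
      linear_combination h1

/-- The expansions of `x` and `y` with respect to the arithmetic local parameter exist and are
unique. -/
theorem existsUnique_expansion (e q : ℕ) (a b : ℤ) (he : 0 < e) (heq : e < q)
    (h : a * e - b * q = 1) :
    ∃! r : (LaurentSeries (ZMu e q))ˣ × (LaurentSeries (ZMu e q))ˣ,
      IsExpansion e q a b r.1 r.2 := by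
  obtain ⟨H, hH⟩ := exists_contraction e q a b he heq h
  obtain ⟨s, hs, hu⟩ := existsUnique_fixed H
  have hs1 : PowerSeries.constantCoeff s = 1 := by
    rw [hs]
    simp
  have hsu : IsUnit s := by
    rw [PowerSeries.isUnit_iff_constantCoeff, hs1]
    exact isUnit_one
  let S : (LaurentSeries (ZMu e q))ˣ :=
    Units.map (HahnSeries.ofPowerSeries ℤ (ZMu e q)).toMonoidHom hsu.unit
  have hSs : (S : LaurentSeries (ZMu e q)) = HahnSeries.ofPowerSeries ℤ _ s := rfl
  have hS : S ∈ oneUnits (ZMu e q) := by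
    refine ⟨hsu.unit, ?_, rfl⟩
    simp [MonoidHom.mem_ker, Units.ext_iff, hs1]
  refine ⟨(tUnit (ZMu e q) ^ (-(e : ℤ)) * S ^ (-(b.natAbs : ℤ)),
    tUnit (ZMu e q) ^ (-(q : ℤ)) * S ^ (-(a.natAbs : ℤ))), ?_, ?_⟩
  · have hx := (mul_tUnit_mem_iff (tUnit (ZMu e q) ^ (-(e : ℤ)) * S ^ (-(b.natAbs : ℤ))) e).mp (by
      rw [mul_comm, ← mul_assoc, ← zpow_add, add_neg_cancel, zpow_zero, one_mul]
      exact zpow_mem hS _)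
    have hy := (mul_tUnit_mem_iff (tUnit (ZMu e q) ^ (-(q : ℤ)) * S ^ (-(a.natAbs : ℤ))) q).mp (by
      rw [mul_comm, ← mul_assoc, ← zpow_add, add_neg_cancel, zpow_zero, one_mul]
      exact zpow_mem hS _)
    exact ⟨(hH S s hSs _ _ rfl rfl).mpr hs, congrArg Units.val
      (zpow_of_oneUnit e q a b he heq h S), hx.1, hx.2, hy.1, hy.2⟩
  · rintro ⟨x, y⟩ hxy
    obtain ⟨S', ⟨w, hw, rfl⟩, hx, hy⟩ := exists_oneUnit e q a b he heq h x y
      (Units.ext hxy.parameter) ((mul_tUnit_mem_iff x e).mpr ⟨hxy.x_order, hxy.x_lead⟩)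
      ((mul_tUnit_mem_iff y q).mpr ⟨hxy.y_order, hxy.y_lead⟩)
    have h1 := hu w ((hH _ _ rfl x y hx hy).mp hxy.curve)
    have h2 : Units.map (HahnSeries.ofPowerSeries ℤ (ZMu e q)).toMonoidHom w = S := by
      ext1
      rw [hSs, ← h1]
      rfl
    rw [h2] at hx hy
    exact Prod.ext hx hy

/-- The pair of expansions `(x(t), y(t))`. -/
def expansion (e q : ℕ) (a b : ℤ) : (LaurentSeries (ZMu e q))ˣ × (LaurentSeries (ZMu e q))ˣ :=
  Classical.epsilon fun r => IsExpansion e q a b r.1 r.2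

theorem isExpansion_expansion (e q : ℕ) (a b : ℤ) (he : 0 < e) (heq : e < q)
    (h : a * e - b * q = 1) :
    IsExpansion e q a b (expansion e q a b).1 (expansion e q a b).2 :=
  Classical.epsilon_spec (existsUnique_expansion e q a b he heq h).exists

/-- The expansion `x(t)`. -/
def xt (e q : ℕ) (a b : ℤ) : LaurentSeries (ZMu e q) := (expansion e q a b).1

/-- The expansion `y(t)`. -/
def yt (e q : ℕ) (a b : ℤ) : LaurentSeries (ZMu e q) := (expansion e q a b).2

/-- The ring `ℤ[μ][[t₁, t₂]]`; `t₁` is `X 0` and `t₂` is `X 1`. -/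
abbrev PS2 (e q : ℕ) : Type := MvPowerSeries (Fin 2) (ZMu e q)

instance (e q : ℕ) : IsDomain (PS2 e q) := NoZeroDivisors.to_isDomain _

/-- The field of fractions of `ℤ[μ][[t₁, t₂]]`. -/
abbrev Frac2 (e q : ℕ) : Type := FractionRing (PS2 e q)

/-- Substitution of `t₁` (for `i = 0`) or `t₂` (for `i = 1`) for `t` in a power series. -/
def psAt (e q : ℕ) (i : Fin 2) : PowerSeries (ZMu e q) →+* PS2 e q :=
  (MvPowerSeries.rename (R := ZMu e q) (fun _ : Unit => i)).toRingHom

theorem psAt_X (e q : ℕ) (i : Fin 2) : psAt e q i PowerSeries.X = MvPowerSeries.X i := by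
  simp [psAt, PowerSeries.X]

theorem isUnit_psAt (e q : ℕ) (i : Fin 2)
    (z : Submonoid.powers (PowerSeries.X : PowerSeries (ZMu e q))) :
    IsUnit (((algebraMap (PS2 e q) (Frac2 e q)).comp (psAt e q i)) z) := by
  obtain ⟨_, n, rfl⟩ := z
  rw [isUnit_iff_ne_zero, RingHom.comp_apply, map_pow, psAt_X, map_pow]
  refine pow_ne_zero _ ?_
  rw [Ne, FaithfulSMul.algebraMap_eq_zero_iff]
  intro h
  have := congrArg (MvPowerSeries.coeff (Finsupp.single i 1)) h
  simp [MvPowerSeries.coeff_X] at this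

/-- Substitution of `t₁` (for `i = 0`) or `t₂` (for `i = 1`) for `t` in a Laurent series. -/
def laurentAt (e q : ℕ) (i : Fin 2) : LaurentSeries (ZMu e q) →+* Frac2 e q :=
  IsLocalization.lift (M := Submonoid.powers (PowerSeries.X : PowerSeries (ZMu e q)))
    (isUnit_psAt e q i)

/-- The exchange of `t₁` and `t₂` in a power series. -/
def swapPS (e q : ℕ) : PS2 e q ≃+* PS2 e q :=
  (MvPowerSeries.renameEquiv (R := ZMu e q) (Equiv.swap (0 : Fin 2) 1)).toRingEquiv

/-- The exchange of `t₁` and `t₂` in a fraction. -/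
def swapFrac (e q : ℕ) : Frac2 e q ≃+* Frac2 e q :=
  IsFractionRing.ringEquivOfRingEquiv (swapPS e q)

/-- The extension of a derivation `D` of a domain to its field of fractions, by the quotient
rule `(n / d)' = (n' d - n d') / d²`. -/
def fracDeriv {k A : Type*} [CommRing k] [CommRing A] [IsDomain A] [Algebra k A]
    (D : Derivation k A A) (z : FractionRing A) : FractionRing A :=
  algebraMap A (FractionRing A)
      (D (IsLocalization.sec (nonZeroDivisors A) z).1 * (IsLocalization.sec (nonZeroDivisors A) z).2
        - (IsLocalization.sec (nonZeroDivisors A) z).1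
          * D (IsLocalization.sec (nonZeroDivisors A) z).2)
    / algebraMap A (FractionRing A) (IsLocalization.sec (nonZeroDivisors A) z).2 ^ 2

theorem fracDeriv_div {k A : Type*} [CommRing k] [CommRing A] [IsDomain A] [Algebra k A]
    (D : Derivation k A A) (n d : A) (hd : d ≠ 0) :
    fracDeriv D (algebraMap A (FractionRing A) n / algebraMap A (FractionRing A) d) =
      algebraMap A (FractionRing A) (D n * d - n * D d) /
        algebraMap A (FractionRing A) d ^ 2 := by
  have hinj := IsFractionRing.injective A (FractionRing A)
  have hd' : algebraMap A (FractionRing A) d ≠ 0 := by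
    simpa using hd
  set z := algebraMap A (FractionRing A) n / algebraMap A (FractionRing A) d with hz
  have hs := IsLocalization.sec_spec (nonZeroDivisors A) z
  unfold fracDeriv
  set N := (IsLocalization.sec (nonZeroDivisors A) z).1
  set M := ((IsLocalization.sec (nonZeroDivisors A) z).2 : A)
  have hM : M ≠ 0 := nonZeroDivisors.coe_ne_zero _
  have hM' : algebraMap A (FractionRing A) M ≠ 0 := by simpa using hM
  have h1 : n * M = N * d := by
    apply hinj
    rw [map_mul, map_mul, ← hs, hz]
    field_simp
  have h2 : D n * M + n * D M = D N * d + N * D d := by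
    have := congrArg D h1
    simp only [Derivation.leibniz, smul_eq_mul] at this
    linear_combination this
  rw [div_eq_div_iff (pow_ne_zero _ hM') (pow_ne_zero _ hd'), ← map_pow, ← map_pow, ← map_mul,
    ← map_mul]
  congr 1
  linear_combination (D d * M + D M * d) * h1 + (-(M * d)) * h2

/-- The partial derivative `d/dt₂`. -/
def dt2 (e q : ℕ) : Frac2 e q → Frac2 e q :=
  fracDeriv (MvPowerSeries.pderiv (ZMu e q) (1 : Fin 2))

/-- The value `h(x(t_i), y(t_i))` of a polynomial at the point with parameter `t_i`. -/
def evalAt (e q : ℕ) (a b : ℤ) (i : Fin 2) (h : MvPolynomial (Fin 2) (ZMu e q)) : Frac2 e q :=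
  laurentAt e q i (MvPolynomial.aeval ![xt e q a b, yt e q a b] h)

/-- The coefficient of `dt_i` in the form `h(x, y) dx / f_y(x, y)` at the point with
parameter `t_i`. -/
def formAt (e q : ℕ) (a b : ℤ) (i : Fin 2) (h : MvPolynomial (Fin 2) (ZMu e q)) : Frac2 e q :=
  evalAt e q a b i h * laurentAt e q i (LaurentSeries.derivative ℤ (xt e q a b)) /
    evalAt e q a b i (MvPolynomial.pderiv 1 (curvePoly e q))

/-- `ω_{w_{g-j}}(t_i) / dt_i`, where `ω_{w_{g-j}} = - x ^ m_j * y ^ n_j * dx / f_y(x, y)`. -/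
def omega (e q : ℕ) (a b : ℤ) (j : ℕ) (i : Fin 2) : Frac2 e q :=
  -formAt e q a b i
    (MvPolynomial.X 0 ^ (nongapExp e q j).1 * MvPolynomial.X 1 ^ (nongapExp e q j).2)

/-- The value `x(t_i)`. -/
def xAt (e q : ℕ) (a b : ℤ) (i : Fin 2) : Frac2 e q := laurentAt e q i (xt e q a b)

/-- The value `y(t_i)`. -/
def yAt (e q : ℕ) (a b : ℤ) (i : Fin 2) : Frac2 e q := laurentAt e q i (yt e q a b)

/-- The bracket `[t₁, t₂]`, defined by
`[t₁, t₂] dt₁ = - ω_{w_g}(t₁) * (1 / (x - z)) * ((f(z, y) - f(z, w)) / (y - w))`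
where `(x, y)` and `(z, w)` are the points with parameters `t₁` and `t₂`. -/
def bracket (e q : ℕ) (a b : ℤ) : Frac2 e q :=
  -omega e q a b 0 0 * (1 / (xAt e q a b 0 - xAt e q a b 1)) *
    ((MvPolynomial.aeval ![xAt e q a b 1, yAt e q a b 0] (curvePoly e q)
        - MvPolynomial.aeval ![xAt e q a b 1, yAt e q a b 1] (curvePoly e q)) /
      (yAt e q a b 0 - yAt e q a b 1))

/-- `η dt` is (the expansion at `∞` of) a differential form of the second kind on the curve
which is regular outside `∞`: it has the form `h(x, y) dx / f_y(x, y)` with a polynomial `h`,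
and its residue at `∞` is zero. -/
structure IsSecondKind (e q : ℕ) (a b : ℤ) (η : LaurentSeries (ZMu e q)) : Prop where
  regular : ∃ h : MvPolynomial (Fin 2) (ZMu e q),
    ∀ i : Fin 2, laurentAt e q i η = formAt e q a b i h
  residue : η.coeff (-1) = 0

/-- The coefficient of `dt₁ dt₂` in
`ξ(t₁, t₂) = d/dt₂ [t₁, t₂] dt₁ dt₂ + ∑ ω_{w_i}(t₁) η_{-w_i}(t₂)`.
The index `i : Fin g` stands for the gap `w_{i+1} = w_{g-j}` with `j = g - 1 - i`. -/
def xi (e q : ℕ) (a b : ℤ) (η : Fin (genus e q) → LaurentSeries (ZMu e q)) : Frac2 e q :=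
  dt2 e q (bracket e q a b) +
    ∑ i : Fin (genus e q), omega e q a b (genus e q - 1 - (i : ℕ)) 0 * laurentAt e q 1 (η i)

/-- The forms `η_{-w_1}, …, η_{-w_g}` have all the properties that are asked of them. -/
structure IsKleinFamily (e q : ℕ) (a b : ℤ)
    (η : Fin (genus e q) → LaurentSeries (ZMu e q)) : Prop where
  secondKind : ∀ i : Fin (genus e q), IsSecondKind e q a b (η i)
  /-- `η_{-w} ∈ t ^ (-w-1) ℤ[μ][[t]] dt`. -/
  pole : ∀ i : Fin (genus e q), ∀ n : ℤ, n < -(gap e q i : ℤ) - 1 → (η i).coeff n = 0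
  /-- `η_{-w}` is homogeneous of weight `-w`, where `t` and `dt` have weight `1`. -/
  weight : ∀ i : Fin (genus e q), ∀ n : ℤ,
    ((η i).coeff n).IsWeightedHomogeneous (muWeight e q) (-(gap e q i : ℤ) - n - 1)
  /-- `ξ ∈ dt₁ dt₂ / (t₂ - t₁)² + ℤ[μ][[t₁, t₂]] dt₁ dt₂`, where the remainder, like
  `1 / (t₂ - t₁)²`, is homogeneous of weight `-2`. -/
  expansion : ∃ H : PS2 e q,
    xi e q a b η =
      1 / (algebraMap (PS2 e q) (Frac2 e q) (MvPowerSeries.X 1 - MvPowerSeries.X 0)) ^ 2 +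
        algebraMap (PS2 e q) (Frac2 e q) H ∧
    ∀ n : Fin 2 →₀ ℕ,
      (MvPowerSeries.coeff n H).IsWeightedHomogeneous (muWeight e q) (-2 - n 0 - n 1)
  /-- `ξ(t₁, t₂) = ξ(t₂, t₁)`. -/
  symmetric : swapFrac e q (xi e q a b η) = xi e q a b η

end PlaneMiura

end

noncomputable section

namespace PlaneMiura

/-! ### The derivation of the ring of Laurent series -/

/-! Write `(x, y)` and `(z, w)` for the points with parameters `t₁` and `t₂`, and let `φ` be the
coefficient of `dt` in `dx / f_y`. Since `t = x ^ (-a) * y ^ b`, the relation `1 / t = -a x'/x + b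
y'/y` together with `f_x x' + f_y y' = 0` gives `φ = -x y / (t E)`, where `E = a y f_y + b x f_x`.
The leading coefficient of `E` is `a e - b q = 1`, so `φ` has coefficients in `ℤ[μ]` and no integer
is ever inverted (`IsExpansion.exists_isLocalData`).

Symmetry. The derivative of the bracket is `φ(t₁) φ(t₂) (G₀ G₁ / (x - z)² + correction)`, where
`G₀`, `G₁` are the divided differences of `f(z, ·)` and `f(x, ·)` at `y, w` (`deriv_bracket`).
Exchanging the points exchanges `G₀` and `G₁`, so only the correction can be asymmetric. It is a
homogeneous polynomial of degree `2 (eq - e - q) = 4g - 2` in the four coordinates. All `μ_n` have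
positive degree, so in each of its monomials one of the two points contributes degree at most `2g -
1`, hence less, since `2g - 1` is a gap. The monomials of degree below `2g - 1` are the numerators
of the `ω_{w_i}`. If this occurs at the first point, a term of some `η` removes the monomial; if at
the second, a term of some `η` adds its mirror image (`exists_symmetric`). Only monomials with
coefficients in `ℤ[μ]` are used, so the `η` are integral and homogeneous; their pole order follows
from their weight, because `ℤ[μ]` has no nonzero elements of positive weight.

Poles. As `t` is a product of powers of `x` and `y`, `t₁ - t₂` lies in the ideal generated by `x -
z` and `y - w`. So the bracket equals `1 / (t₁ - t₂) + r`, where `r` has poles only along `t₁ t₂ =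
0` (`exists_regular_part`). A count of orders shows that `r + 1 / t₁` has no pole along `t₁ = 0`
(`exists_pow_mul_eq`), and `1 / t₁` is killed by `d/dt₂`. Therefore `ξ - 1 / (t₂ - t₁)²` has poles
only along `t₂ = 0`; being symmetric, it has none. Its coefficient at `t₂ ^ (-1)` is `∑ ω_{w_i}(t₁)
res η_{-w_i}`, as a derivative has no residue. This vanishes, and the `ω_{w_i}` have distinct
orders, so every residue is zero (`exists_powerSeries_of_symmetric`).

Non-uniqueness. Adding `μ_1 ^ (2 w_i) ω_{w_i}` to `η_{-w_i}` changes `ξ` by a symmetric regular form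
of the right weight. -/

theorem derivative_coeff {R : Type*} [CommRing R] (f : LaurentSeries R) (n : ℤ) :
    (LaurentSeries.derivative ℤ f).coeff n = (n + 1 : ℤ) * f.coeff (n + 1) := by
  simp

/-- The Leibniz rule for an additive endomorphism of a commutative ring. -/
def IsLeibniz {A : Type*} [CommRing A] (D : A →+ A) : Prop :=
  ∀ f g, D (f * g) = f * D g + g * D f

namespace IsLeibniz

variable {A : Type*} [CommRing A] {D : A →+ A}

theorem map_one (hD : IsLeibniz D) : D 1 = 0 := by
  have := hD 1 1
  rw [one_mul, one_mul] at this
  exact left_eq_add.mp this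

theorem map_pow (hD : IsLeibniz D) (u : A) (n : ℕ) : D (u ^ n) = n * u ^ (n - 1) * D u := by
  induction n with
  | zero => simp [hD.map_one]
  | succ n ih =>
    rw [pow_succ, hD, ih, Nat.add_sub_cancel]
    rcases n with _ | n
    · simp
    · rw [Nat.add_sub_cancel]; push_cast; ring

end IsLeibniz

/-- The derivative of Laurent series as an additive endomorphism. -/
def laurentDeriv (R : Type*) [CommRing R] : LaurentSeries R →+ LaurentSeries R :=
  (LaurentSeries.derivative ℤ (V := R)).toAddMonoidHom

/-- The operator `t * d/dt` multiplies the coefficient of `t ^ n` by `n`, and `n` is additive over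
the pairs of indices that contribute to a coefficient of a product. As `t` is a unit, the rule for
`t * d/dt` yields the rule for `d/dt`. -/
theorem isLeibniz_laurentDeriv (R : Type*) [CommRing R] : IsLeibniz (laurentDeriv R) := by
    intro f g
    change LaurentSeries.derivative ℤ (f * g) =
      f * LaurentSeries.derivative ℤ g + g * LaurentSeries.derivative ℤ f
    have hs : ∀ (h : LaurentSeries R),
        (HahnSeries.single (1 : ℤ) (1 : R) * LaurentSeries.derivative ℤ h).support ⊆
          h.support := by
      intro h n hn
      rw [HahnSeries.mem_support] at hn ⊢
      have := HahnSeries.coeff_single_mul_add (r := (1 : R))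
        (x := LaurentSeries.derivative ℤ h) (a := n - 1) (b := 1)
      rw [sub_add_cancel, one_mul, derivative_coeff, sub_add_cancel] at this
      intro h0
      apply hn
      rw [this, h0, mul_zero]
    have hc : ∀ (h : LaurentSeries R) (n : ℤ),
        (HahnSeries.single (1 : ℤ) (1 : R) * LaurentSeries.derivative ℤ h).coeff n =
          n * h.coeff n := by
      intro h n
      have := HahnSeries.coeff_single_mul_add (r := (1 : R))
        (x := LaurentSeries.derivative ℤ h) (a := n - 1) (b := 1)
      rw [sub_add_cancel, one_mul, derivative_coeff, sub_add_cancel] at this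
      exact this
    have hu : IsUnit (HahnSeries.single (1 : ℤ) (1 : R)) := (tUnit R).isUnit
    apply hu.mul_left_cancel
    rw [mul_add, mul_left_comm, mul_left_comm _ g]
    ext n
    rw [hc, HahnSeries.coeff_add, mul_comm g,
      HahnSeries.coeff_mul_left' f.isPWO_support (hs f),
      HahnSeries.coeff_mul_right' g.isPWO_support (hs g), HahnSeries.coeff_mul, Finset.mul_sum,
      ← Finset.sum_add_distrib]
    refine Finset.sum_congr rfl fun ij hij => ?_
    rw [Finset.mem_antidiagonal] at hij
    rw [hc, hc, ← hij.2.2]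
    push_cast
    ring

theorem laurentDeriv_apply {R : Type*} [CommRing R] (f : LaurentSeries R) :
    laurentDeriv R f = LaurentSeries.derivative ℤ f := rfl

theorem laurentDeriv_coeff {R : Type*} [CommRing R] (f : LaurentSeries R) (n : ℤ) :
    (laurentDeriv R f).coeff n = (n + 1 : ℤ) * f.coeff (n + 1) := derivative_coeff f n

theorem laurent_algebraMap_eq_C {R : Type*} [CommRing R] (c : R) :
    algebraMap R (LaurentSeries R) c = HahnSeries.C c := by
  rw [HahnSeries.algebraMap_apply', PowerSeries.algebraMap_apply, Algebra.algebraMap_self_apply,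
    HahnSeries.ofPowerSeries_C]

theorem laurentDeriv_algebraMap {R : Type*} [CommRing R] (c : R) :
    laurentDeriv R (algebraMap R (LaurentSeries R) c) = 0 := by
  rw [laurent_algebraMap_eq_C]
  ext n
  rw [laurentDeriv_coeff, HahnSeries.C_apply, HahnSeries.coeff_single]
  split_ifs with h
  · rw [h]; simp
  · simp

theorem laurentDeriv_single {R : Type*} [CommRing R] (n : ℤ) :
    laurentDeriv R (HahnSeries.single n 1) = HahnSeries.single (n - 1) (n : R) := by
  ext m
  rw [laurentDeriv_coeff, HahnSeries.coeff_single, HahnSeries.coeff_single]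
  by_cases h : m = n - 1
  · subst h; simp
  · rw [if_neg h, if_neg (by omega), mul_zero]

/-- The logarithmic derivative of the units of a commutative ring. -/
def logDer {A : Type*} [CommRing A] (D : A →+ A) (hD : IsLeibniz D) : Aˣ →* Multiplicative A where
  toFun u := Multiplicative.ofAdd (D u * ((u⁻¹ : Aˣ) : A))
  map_one' := by simp [hD.map_one]
  map_mul' u v := by
    rw [← ofAdd_add]
    congr 1
    rw [mul_inv, Units.val_mul, Units.val_mul, hD]
    linear_combination (D u * ((u⁻¹ : Aˣ) : A)) * v.mul_inv + (D v * ((v⁻¹ : Aˣ) : A)) * u.mul_inv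

/-- Needed for `t = x ^ (-a) * y ^ b`, where one of the exponents can be negative: the logarithmic
derivative is a homomorphism on units, so no case distinction on signs arises. -/
theorem logDer_zpow_mul_zpow {A : Type*} [CommRing A] {D : A →+ A} (hD : IsLeibniz D) (u v : Aˣ)
    (m n : ℤ) : D ((u ^ m * v ^ n : Aˣ) : A) * (((u ^ m * v ^ n)⁻¹ : Aˣ) : A) =
      m * (D u * ((u⁻¹ : Aˣ) : A)) + n * (D v * ((v⁻¹ : Aˣ) : A)) := by
  have h : (logDer D hD (u ^ m * v ^ n)).toAdd =
      m • (logDer D hD u).toAdd + n • (logDer D hD v).toAdd := by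
    rw [map_mul, map_zpow, map_zpow]; rfl
  rw [zsmul_eq_mul, zsmul_eq_mul] at h
  exact h

/-! ### Sums over the coefficients of the equation of the curve -/

section CurveSum

variable {e q : ℕ} {A B : Type*} [CommRing A] [Algebra (ZMu e q) A]
  [CommRing B] [Algebra (ZMu e q) B]

/-- The coefficient of `x ^ k * y ^ (e - j)` in `f - y ^ e + x ^ q`. -/
def curveCoeff (e q j k : ℕ) : ZMu e q := if j = e then -mu e q j k else mu e q j k

/-- The value at `f` of the linear functional with `x ^ k * y ^ l ↦ P k * Q l`. -/
def curveSum (e q : ℕ) {A : Type*} [CommRing A] [Algebra (ZMu e q) A] (P Q : ℕ → A) : A :=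
  P 0 * Q e - P q * Q 0 + ∑ j ∈ Finset.Icc 1 e, ∑ k ∈ Finset.range (j * q),
    algebraMap (ZMu e q) A (curveCoeff e q j k) * (P k * Q (e - j))

theorem curveSum_sub_left (P P' Q : ℕ → A) :
    curveSum e q (fun k => P k - P' k) Q = curveSum e q P Q - curveSum e q P' Q := by
  simp only [curveSum, sub_mul, mul_sub, Finset.sum_sub_distrib]
  ring

theorem curveSum_sub_right (P Q Q' : ℕ → A) :
    curveSum e q P (fun k => Q k - Q' k) = curveSum e q P Q - curveSum e q P Q' := by
  simp only [curveSum, mul_sub, Finset.sum_sub_distrib]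
  ring

theorem curveSum_mul_left (c : A) (P Q : ℕ → A) :
    curveSum e q (fun k => c * P k) Q = c * curveSum e q P Q := by
  simp only [curveSum, mul_add, mul_sub, Finset.mul_sum, mul_left_comm, mul_assoc]

theorem curveSum_mul_right (c : A) (P Q : ℕ → A) :
    curveSum e q P (fun k => c * Q k) = c * curveSum e q P Q := by
  simp only [curveSum, mul_add, mul_sub, Finset.mul_sum, mul_left_comm]

theorem map_curveSum (F : A →+* B)
    (hF : ∀ c, F (algebraMap (ZMu e q) A c) = algebraMap (ZMu e q) B c) (P Q : ℕ → A) :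
    F (curveSum e q P Q) = curveSum e q (fun k => F (P k)) (fun k => F (Q k)) := by
  simp only [curveSum, map_add, map_sub, map_mul, map_sum, hF]

theorem IsLeibniz.map_curveSum {D : A →+ A} (h : IsLeibniz D)
    (hD : ∀ c, D (algebraMap (ZMu e q) A c) = 0) (P Q : ℕ → A) :
    D (curveSum e q P Q) = curveSum e q (fun k => D (P k)) Q + curveSum e q P (fun k => D (Q k)) := by
  simp only [curveSum, map_add, map_sub, h _ _, map_sum, hD, mul_zero,
    add_zero, mul_add, Finset.sum_add_distrib]
  simp only [mul_comm (Q _) (D _)]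
  ring

/-- With `f` in this form, its values, partial derivatives and divided differences are all instances
of `curveSum`, and the relations among them reduce to bilinearity in the two sequences. -/
theorem curvePoly_eq (he : 0 < e) :
    curvePoly e q = curveSum e q (fun k => (MvPolynomial.X 0 : MvPolynomial (Fin 2) (ZMu e q)) ^ k)
      (fun l => MvPolynomial.X 1 ^ l) := by
  have hI : Finset.Icc 1 e = insert e (Finset.Icc 1 (e - 1)) := by
    ext i; simp only [Finset.mem_Icc, Finset.mem_insert]; omega
  have hs : ∀ j ∈ Finset.Icc 1 (e - 1), pPoly e q j * MvPolynomial.X 1 ^ (e - j) =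
      ∑ k ∈ Finset.range (j * q), algebraMap (ZMu e q) (MvPolynomial (Fin 2) (ZMu e q))
        (curveCoeff e q j k) * (MvPolynomial.X 0 ^ k * MvPolynomial.X 1 ^ (e - j)) := by
    intro j hj
    have hj' : j ≠ e := by rw [Finset.mem_Icc] at hj; omega
    simp only [pPoly, curveCoeff, if_neg hj', zero_add, Finset.sum_mul, mul_assoc,
      MvPolynomial.algebraMap_eq]
  rw [curveSum, hI, Finset.sum_insert (by simp; omega), ← Finset.sum_congr rfl hs, curvePoly]
  conv_lhs => enter [2]; rw [pPoly, if_pos rfl]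
  simp only [curveCoeff, if_pos, MvPolynomial.algebraMap_eq, map_neg,
    Nat.sub_self, pow_zero, mul_one, one_mul]
  ring_nf
  simp only [Finset.sum_neg_distrib]
  ring

theorem aeval_curvePoly (he : 0 < e) (x y : A) :
    MvPolynomial.aeval ![x, y] (curvePoly e q) =
      curveSum e q (fun k => x ^ k) (fun l => y ^ l) := by
  rw [curvePoly_eq he]
  refine (map_curveSum (MvPolynomial.aeval (R := ZMu e q) ![x, y]).toRingHom (fun c => ?_) _ _).trans ?_
  · exact AlgHom.commutes _ c
  · simp

theorem aeval_pderiv_curvePoly (he : 0 < e) (x y : A) :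
    MvPolynomial.aeval ![x, y] (MvPolynomial.pderiv 1 (curvePoly e q)) =
      curveSum e q (fun k => x ^ k) (fun l => l * y ^ (l - 1)) := by
  set D : MvPolynomial (Fin 2) (ZMu e q) →+ MvPolynomial (Fin 2) (ZMu e q) :=
    (MvPolynomial.pderiv (R := ZMu e q) (1 : Fin 2)).toLinearMap.toAddMonoidHom with hD
  have h3 : ∀ p, D p = MvPolynomial.pderiv 1 p := fun _ => rfl
  have hL : IsLeibniz D := fun f g => (MvPolynomial.pderiv (R := ZMu e q) (1 : Fin 2)).leibniz f g
  have h1 := hL.map_curveSum (e := e) (q := q)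
    (fun c => (MvPolynomial.pderiv (R := ZMu e q) (1 : Fin 2)).map_algebraMap c)
    (fun k => (MvPolynomial.X 0 : MvPolynomial (Fin 2) (ZMu e q)) ^ k)
    (fun l => MvPolynomial.X 1 ^ l)
  rw [← curvePoly_eq he] at h1
  have h0 : ∀ P : ℕ → MvPolynomial (Fin 2) (ZMu e q), curveSum e q (fun _ => 0) P = 0 := by
    intro P
    simpa using curveSum_mul_left (e := e) (q := q) 0 (fun _ => 0) P
  have h2 : MvPolynomial.pderiv 1 (curvePoly e q) = curveSum e q
      (fun k => (MvPolynomial.X 0 : MvPolynomial (Fin 2) (ZMu e q)) ^ k)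
      (fun l => (l : MvPolynomial (Fin 2) (ZMu e q)) * MvPolynomial.X 1 ^ (l - 1)) := by
    refine h1.trans ?_
    simp [h3, MvPolynomial.pderiv_X, h0]
  rw [h2]
  refine (map_curveSum (MvPolynomial.aeval (R := ZMu e q) ![x, y]).toRingHom (fun c => ?_) _ _).trans ?_
  · exact AlgHom.commutes _ c
  · simp

end CurveSum

variable {e q : ℕ}

/-! ### Weights -/

/-- The element `c` of `ℤ[μ]` is homogeneous of weight `w`. -/
def HasWt (e q : ℕ) (w : ℤ) (c : ZMu e q) : Prop := c.IsWeightedHomogeneous (muWeight e q) w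

namespace HasWt

variable {w w' : ℤ} {c c' : ZMu e q}

theorem zero (w : ℤ) : HasWt e q w 0 := MvPolynomial.isWeightedHomogeneous_zero _ _ _

theorem one : HasWt e q 0 1 := MvPolynomial.isWeightedHomogeneous_one _ _

theorem intCast (n : ℤ) : HasWt e q 0 (n : ZMu e q) := by
  have := MvPolynomial.isWeightedHomogeneous_C (R := ℤ) (muWeight e q) n
  simpa [HasWt] using this

theorem add (h : HasWt e q w c) (h' : HasWt e q w c') : HasWt e q w (c + c') :=
  MvPolynomial.IsWeightedHomogeneous.add h h'

theorem neg (h : HasWt e q w c) : HasWt e q w (-c) := MvPolynomial.IsWeightedHomogeneous.neg h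

theorem mul (h : HasWt e q w c) (h' : HasWt e q w' c') : HasWt e q (w + w') (c * c') :=
  MvPolynomial.IsWeightedHomogeneous.mul h h'

theorem sum {ι : Type*} {s : Finset ι} {f : ι → ZMu e q} (h : ∀ i ∈ s, HasWt e q w (f i)) :
    HasWt e q w (∑ i ∈ s, f i) :=
  Finset.sum_induction f _ (fun _ _ => add) (zero w) h

theorem congr (h : HasWt e q w c) (hw : w = w') : HasWt e q w' c := hw ▸ h

/-- All weights are nonpositive. -/
theorem eq_zero_of_pos (h : HasWt e q w c) (hw : 0 < w) : c = 0 := by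
  by_contra h0
  obtain ⟨d, hd⟩ := MvPolynomial.ne_zero_iff.mp h0
  have h1 := h hd
  rw [Finsupp.weight_apply] at h1
  have h2 : d.sum (fun i c => c • muWeight e q i) ≤ 0 := by
    refine Finset.sum_nonpos fun i _ => ?_
    simp only [muWeight, smul_neg, Left.neg_nonpos_iff]
    positivity
  omega

end HasWt

theorem hasWt_mu (j k : ℕ) : HasWt e q (e * k - j * q) (mu e q j k) := by
  unfold mu
  split_ifs with h
  · refine HasWt.congr (MvPolynomial.isWeightedHomogeneous_X ℤ (muWeight e q) _) ?_
    simp only [muWeight]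
    push_cast [Nat.cast_sub h.2.le]
    ring
  · exact HasWt.zero _

theorem hasWt_curveCoeff (j k : ℕ) : HasWt e q (e * k - j * q) (curveCoeff e q j k) := by
  unfold curveCoeff
  split_ifs
  · exact (hasWt_mu j k).neg
  · exact hasWt_mu j k

theorem curveCoeff_eq_zero {j k : ℕ} (h : j * q ≤ e * k) : curveCoeff e q j k = 0 := by
  have : mu e q j k = 0 := by rw [mu, dif_neg]; omega
  simp [curveCoeff, this]

/-- Multiplication by a homogeneous element shifts the grading. This is what permits division of
weights in `PSHasWt.of_mul`. -/
theorem component_mul {w d : ℤ} {c p : ZMu e q} (h : HasWt e q d c) :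
    MvPolynomial.weightedHomogeneousComponent (muWeight e q) (d + w) (c * p) =
      c * MvPolynomial.weightedHomogeneousComponent (muWeight e q) w p := by
  let _ := MvPolynomial.weightedGradedAlgebra (R := ℤ) (w := muWeight e q)
  have := DirectSum.coe_decompose_mul_add_of_left_mem
    (MvPolynomial.weightedHomogeneousSubmodule ℤ (muWeight e q)) (j := w) (b := p)
    (show c ∈ MvPolynomial.weightedHomogeneousSubmodule ℤ (muWeight e q) d from h)
  change ((MvPolynomial.weightedDecomposition ℤ (muWeight e q)).decompose' (c * p) (d + w) :
    ZMu e q) = c * ((MvPolynomial.weightedDecomposition ℤ (muWeight e q)).decompose' p w :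
    ZMu e q) at this
  simpa only [MvPolynomial.weightedDecomposition.decompose'_apply] using this

/-- The power series `p` is homogeneous of weight `w`, where the variables have weight `1`. -/
def PSHasWt {σ : Type*} (w : ℤ) (p : MvPowerSeries σ (ZMu e q)) : Prop :=
  ∀ n : σ →₀ ℕ, HasWt e q (w - n.degree) (MvPowerSeries.coeff n p)

namespace PSHasWt

variable {σ : Type*} {w w' : ℤ} {p p' : MvPowerSeries σ (ZMu e q)}

theorem congr (h : PSHasWt w p) (hw : w = w') : PSHasWt w' p := hw ▸ h

theorem zero (w : ℤ) : PSHasWt w (0 : MvPowerSeries σ (ZMu e q)) := fun _ => by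
  simpa using HasWt.zero _

theorem add (h : PSHasWt w p) (h' : PSHasWt w p') : PSHasWt w (p + p') := fun n => by
  rw [map_add]; exact (h n).add (h' n)

theorem neg (h : PSHasWt w p) : PSHasWt w (-p) := fun n => by
  rw [map_neg]; exact (h n).neg

theorem sub (h : PSHasWt w p) (h' : PSHasWt w p') : PSHasWt w (p - p') := by
  rw [sub_eq_add_neg]; exact h.add h'.neg

theorem mul (h : PSHasWt w p) (h' : PSHasWt w' p') : PSHasWt (w + w') (p * p') := fun n => by
  classical
  rw [MvPowerSeries.coeff_mul]
  refine HasWt.sum fun i hi => ((h i.1).mul (h' i.2)).congr ?_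
  rw [Finset.HasAntidiagonal.mem_antidiagonal] at hi
  rw [← hi, map_add]
  push_cast
  ring

theorem C {c : ZMu e q} (h : HasWt e q w c) :
    PSHasWt w (MvPowerSeries.C c : MvPowerSeries σ (ZMu e q)) := fun n => by
  classical
  rw [MvPowerSeries.coeff_C]
  split_ifs with hn
  · subst hn; exact h.congr (by simp)
  · exact HasWt.zero _

theorem one : PSHasWt 0 (1 : MvPowerSeries σ (ZMu e q)) := by
  have := C (σ := σ) (HasWt.one (e := e) (q := q))
  rwa [map_one] at this

theorem X (i : σ) : PSHasWt 1 (MvPowerSeries.X i : MvPowerSeries σ (ZMu e q)) := fun n => by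
  classical
  rw [MvPowerSeries.coeff_X]
  split_ifs with hn
  · subst hn; exact HasWt.one.congr (by simp)
  · exact HasWt.zero _

theorem pow (h : PSHasWt w p) (n : ℕ) : PSHasWt (n * w) (p ^ n) := by
  induction n with
  | zero => simpa using one
  | succ n ih =>
    rw [pow_succ]
    exact (ih.mul h).congr (by push_cast; ring)

/-- A quotient of homogeneous power series is homogeneous. -/
theorem of_mul {d : MvPowerSeries σ (ZMu e q)} (hd : PSHasWt w d) (h0 : d ≠ 0)
    (h : PSHasWt (w + w') (d * p)) : PSHasWt w' p := by
  classical
  let comp : ℤ → MvPowerSeries σ (ZMu e q) → MvPowerSeries σ (ZMu e q) := fun v r n =>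
    MvPolynomial.weightedHomogeneousComponent (muWeight e q) (v - n.degree)
      (MvPowerSeries.coeff n r)
  have hcomp : ∀ v r n, MvPowerSeries.coeff n (comp v r) =
      MvPolynomial.weightedHomogeneousComponent (muWeight e q) (v - n.degree)
        (MvPowerSeries.coeff n r) := fun _ _ _ => rfl
  have hmul : ∀ v, comp (w + v) (d * p) = d * comp v p := by
    intro v
    ext1 n
    rw [hcomp, MvPowerSeries.coeff_mul, MvPowerSeries.coeff_mul, map_sum]
    refine Finset.sum_congr rfl fun i hi => ?_
    rw [Finset.HasAntidiagonal.mem_antidiagonal] at hi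
    rw [hcomp, ← component_mul (hd i.1), ← hi, map_add]
    congr 2
    push_cast
    ring
  have hz : ∀ v, v ≠ w' → comp v p = 0 := by
    intro v hv
    have h1 : d * comp v p = 0 := by
      rw [← hmul]
      ext1 n
      rw [hcomp, map_zero]
      exact MvPolynomial.IsWeightedHomogeneous.weightedHomogeneousComponent_ne _ (h n)
        (by omega)
    exact (mul_eq_zero.mp h1).resolve_left h0
  intro n m hm
  by_contra hne
  -- A monomial `m` of the wrong weight would survive in the component of `p` that belongs to its
  -- own weight, and that component is zero.
  have h2 := congrArg (MvPowerSeries.coeff n)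
    (hz (Finsupp.weight (muWeight e q) m + n.degree) (by omega))
  rw [hcomp, map_zero, add_sub_cancel_right] at h2
  have h3 := congrArg (MvPolynomial.coeff m) h2
  rw [MvPolynomial.coeff_weightedHomogeneousComponent, if_pos rfl] at h3
  exact hm h3

theorem rename {τ : Type*} {f : σ → τ} [Filter.TendstoCofinite f] (h : PSHasWt w p) :
    PSHasWt w (MvPowerSeries.rename f p) := fun n => by
  rw [MvPowerSeries.coeff_rename]
  refine HasWt.sum fun i hi => (h i).congr ?_
  have hi' : Finsupp.mapDomain f i = n := by simpa using hi
  rw [← hi', Finsupp.degree_mapDomain]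

end PSHasWt

/-! ### Homogeneous Laurent series in one variable -/

theorem ofPowerSeries_coeff_of_neg {R : Type*} [CommRing R] (p : PowerSeries R) {n : ℤ}
    (hn : n < 0) : (HahnSeries.ofPowerSeries ℤ R p).coeff n = 0 := by
  rw [HahnSeries.ofPowerSeries_apply]
  apply HahnSeries.embDomain_of_notMem_range
  rintro ⟨m, hm⟩
  simp at hm
  omega

theorem eq_single_mul_ofPowerSeries {R : Type*} [CommRing R] {h : LaurentSeries R} (w : ℤ)
    (hh : ∀ n < w, h.coeff n = 0) : h = HahnSeries.single w 1 *
      HahnSeries.ofPowerSeries ℤ _ (PowerSeries.mk fun n => h.coeff (w + n)) := by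
  ext1
  funext n
  obtain ⟨m, rfl⟩ : ∃ m, n = m + w := ⟨n - w, by ring⟩
  rw [HahnSeries.coeff_single_mul_add, one_mul]
  rcases lt_or_ge m 0 with hm | hm
  · rw [hh _ (by omega), ofPowerSeries_coeff_of_neg _ hm]
  · lift m to ℕ using hm
    rw [HahnSeries.ofPowerSeries_apply_coeff, PowerSeries.coeff_mk, add_comm]

/-- The Laurent series `h` is homogeneous of weight `w`, where `t` has weight `1`. -/
def LSHasWt (w : ℤ) (h : LaurentSeries (ZMu e q)) : Prop := ∀ n : ℤ, HasWt e q (w - n) (h.coeff n)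

namespace LSHasWt

variable {w w' : ℤ} {h h' : LaurentSeries (ZMu e q)}

theorem congr (hh : LSHasWt w h) (hw : w = w') : LSHasWt w' h := hw ▸ hh

theorem zero (w : ℤ) : LSHasWt w (0 : LaurentSeries (ZMu e q)) := fun _ => HasWt.zero _

theorem add (hh : LSHasWt w h) (hh' : LSHasWt w h') : LSHasWt w (h + h') := fun n => by
  rw [HahnSeries.coeff_add]; exact (hh n).add (hh' n)

theorem neg (hh : LSHasWt w h) : LSHasWt w (-h) := fun n => by
  rw [HahnSeries.coeff_neg]; exact (hh n).neg

theorem mul (hh : LSHasWt w h) (hh' : LSHasWt w' h') : LSHasWt (w + w') (h * h') := fun n => by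
  rw [HahnSeries.coeff_mul]
  refine HasWt.sum fun i hi => ((hh i.1).mul (hh' i.2)).congr ?_
  rw [Finset.mem_antidiagonal] at hi
  rw [← hi.2.2]
  ring

theorem of_algebraMap {c : ZMu e q} (hc : HasWt e q w c) :
    LSHasWt w (algebraMap (ZMu e q) (LaurentSeries (ZMu e q)) c) := fun n => by
  rw [laurent_algebraMap_eq_C, HahnSeries.C_apply, HahnSeries.coeff_single]
  split_ifs with hn
  · subst hn; exact hc.congr (by simp)
  · exact HasWt.zero _

theorem single (n : ℤ) : LSHasWt n (HahnSeries.single n (1 : ZMu e q)) := fun m => by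
  rw [HahnSeries.coeff_single]
  split_ifs with hn
  · subst hn; exact HasWt.one.congr (by simp)
  · exact HasWt.zero _

theorem one : LSHasWt 0 (1 : LaurentSeries (ZMu e q)) := single 0

theorem pow (hh : LSHasWt w h) (n : ℕ) : LSHasWt (n * w) (h ^ n) := by
  induction n with
  | zero => simpa using one
  | succ n ih =>
    rw [pow_succ]
    exact (ih.mul hh).congr (by push_cast; ring)

theorem ofPowerSeries {p : PowerSeries (ZMu e q)} (hp : PSHasWt w p) :
    LSHasWt w (HahnSeries.ofPowerSeries ℤ _ p) := fun n => by
  rcases lt_or_ge n 0 with hn | hn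
  · rw [ofPowerSeries_coeff_of_neg _ hn]
    exact HasWt.zero _
  · lift n to ℕ using hn
    rw [HahnSeries.ofPowerSeries_apply_coeff]
    exact (hp (Finsupp.single () n)).congr (by simp)

/-- A homogeneous Laurent series of weight `w` has order at least `w`. -/
theorem coeff_eq_zero (hh : LSHasWt w h) {n : ℤ} (hn : n < w) : h.coeff n = 0 :=
  (hh n).eq_zero_of_pos (by omega)

theorem exists_powerSeries (hh : LSHasWt w h) : ∃ p : PowerSeries (ZMu e q), PSHasWt 0 p ∧
    h = HahnSeries.single w 1 * HahnSeries.ofPowerSeries ℤ _ p := by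
  refine ⟨_, fun n => ?_, eq_single_mul_ofPowerSeries w fun n => hh.coeff_eq_zero⟩
  obtain ⟨m, rfl⟩ : ∃ m, n = Finsupp.single () m := ⟨n (), by ext; simp⟩
  have : MvPowerSeries.coeff (Finsupp.single () m) (PowerSeries.mk fun n => h.coeff (w + n)) =
    h.coeff (w + m) := PowerSeries.coeff_mk m _
  rw [this]
  exact (hh _).congr (by simp)

theorem sum {ι : Type*} {s : Finset ι} {f : ι → LaurentSeries (ZMu e q)}
    (hf : ∀ i ∈ s, LSHasWt w (f i)) : LSHasWt w (∑ i ∈ s, f i) :=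
  Finset.sum_induction f _ (fun _ _ => add) (zero w) hf

end LSHasWt

/-! ### Homogeneity of the expansions -/

/-- The iterates of the contraction starting from `0` are homogeneous and agree with `s` to ever
higher order, and homogeneity is a condition on each coefficient separately. -/
theorem psHasWt_of_fixed (H : Polynomial (PowerSeries (ZMu e q)))
    (hH : ∀ p : PowerSeries (ZMu e q), PSHasWt 0 p → PSHasWt (-1) (H.eval p))
    (s : PowerSeries (ZMu e q)) (hs : s = 1 + PowerSeries.X * H.eval s) : PSHasWt 0 s := by
  have key : ∀ n : ℕ, ∃ p : PowerSeries (ZMu e q), PSHasWt 0 p ∧ PowerSeries.X ^ n ∣ s - p := by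
    intro n
    induction n with
    | zero => exact ⟨0, PSHasWt.zero _, by simp⟩
    | succ n ih =>
      obtain ⟨p, hp, hd⟩ := ih
      refine ⟨1 + PowerSeries.X * H.eval p,
        PSHasWt.one.add (((PSHasWt.X ()).mul (hH p hp)).congr (by norm_num)), ?_⟩
      have h1 : s - (1 + PowerSeries.X * H.eval p) =
          PowerSeries.X * (H.eval s - H.eval p) := by
        conv_lhs => rw [hs]
        ring
      rw [h1, pow_succ']
      exact mul_dvd_mul_left _ (hd.trans (Polynomial.sub_dvd_eval_sub s p H))
  intro n
  obtain ⟨m, rfl⟩ : ∃ m, n = Finsupp.single () m := ⟨n (), by ext; simp⟩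
  obtain ⟨p, hp, hd⟩ := key (m + 1)
  rw [PowerSeries.X_pow_dvd_iff] at hd
  have h2 := hd m (Nat.lt_succ_self m)
  rw [map_sub, sub_eq_zero] at h2
  have h3 := hp (Finsupp.single () m)
  change HasWt e q _ (PowerSeries.coeff m s)
  rw [h2]
  exact h3

/-- The weight of `μ_{jq-ek}` is `-(jq - ek)` and the accompanying power of `t` has exponent `jq -
ek - 1`, so every term has weight `-1`. -/
theorem psHasWt_tailPoly (A B N j : ℕ) (p : PowerSeries (ZMu e q)) (hp : PSHasWt 0 p) :
    PSHasWt (-1) ((tailPoly e q A B N j).eval p) := by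
  rw [tailPoly, Polynomial.eval_finsetSum]
  refine Finset.sum_induction _ _ (fun _ _ => PSHasWt.add) (PSHasWt.zero _) fun k _ => ?_
  by_cases hk : e * k < j * q
  · simp only [Polynomial.eval_mul, Polynomial.eval_C, Polynomial.eval_pow, Polynomial.eval_X]
    refine (((PSHasWt.C (hasWt_mu j k)).mul ((PSHasWt.X ()).pow _)).mul (hp.pow _)).congr ?_
    obtain ⟨r, hr⟩ : ∃ r, j * q = e * k + r + 1 := ⟨j * q - e * k - 1, by omega⟩
    rw [show j * q - e * k - 1 = r by omega]
    zify at hr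
    rw [hr]
    ring
  · have h0 : mu e q j k = 0 := by
      rw [mu, dif_neg]
      exact fun h => hk h.2
    rw [h0]
    simpa using PSHasWt.zero _

/-- A homogeneous series has no coefficients below its weight, so leading coefficients multiply.
Here "leading" means the coefficient at the index equal to the weight, which may be zero. -/
theorem LSHasWt.coeff_mul {w w' : ℤ} {h h' : LaurentSeries (ZMu e q)} (hh : LSHasWt w h)
    (hh' : LSHasWt w' h') : (h * h').coeff (w + w') = h.coeff w * h'.coeff w' := by
  rw [HahnSeries.coeff_mul]
  apply Finset.sum_eq_single (w, w')
  · intro i hi hne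
    rw [Finset.mem_antidiagonal] at hi
    by_cases h1 : i.1 < w
    · rw [hh.coeff_eq_zero h1, zero_mul]
    · by_cases h2 : i.2 < w'
      · rw [hh'.coeff_eq_zero h2, mul_zero]
      · exact absurd (Prod.ext (show i.1 = w by omega) (show i.2 = w' by omega)) hne
  · intro hi
    rw [Finset.mem_antidiagonal] at hi
    by_contra h0
    exact hi ⟨left_ne_zero_of_mul h0, right_ne_zero_of_mul h0, rfl⟩

theorem LSHasWt.coeff_pow {w : ℤ} {h : LaurentSeries (ZMu e q)} (hh : LSHasWt w h) (n : ℕ) :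
    (h ^ n).coeff (n * w) = h.coeff w ^ n := by
  induction n with
  | zero => simp
  | succ n ih =>
    rw [pow_succ, pow_succ, ← ih, ← (hh.pow n).coeff_mul hh]
    congr 1
    push_cast
    ring

theorem LSHasWt.intCast_mul {w : ℤ} {h : LaurentSeries (ZMu e q)} (hh : LSHasWt w h) (n : ℤ) :
    LSHasWt w ((n : LaurentSeries (ZMu e q)) * h) := by
  have := (LSHasWt.of_algebraMap (HasWt.intCast (e := e) (q := q) n)).mul hh
  rw [map_intCast, zero_add] at this
  exact this

theorem coeff_intCast_mul {R : Type*} [CommRing R] (n m : ℤ) (h : LaurentSeries R) :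
    ((n : LaurentSeries R) * h).coeff m = n * h.coeff m := by
  have h1 : (n : LaurentSeries R) = HahnSeries.C (n : R) := by simp
  rw [h1, HahnSeries.C_mul_eq_smul, HahnSeries.coeff_smul, smul_eq_mul]

theorem LSHasWt.curveSum {P Q : ℕ → LaurentSeries (ZMu e q)} (u v : ℤ)
    (hP : ∀ k : ℕ, LSHasWt (u - e * k) (P k)) (hQ : ∀ l : ℕ, LSHasWt (v - q * l) (Q l)) :
    LSHasWt (u + v - e * q) (curveSum e q P Q) := by
  unfold PlaneMiura.curveSum
  rw [sub_eq_add_neg (P 0 * Q e)]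
  refine ((((hP 0).mul (hQ e)).congr (by push_cast; ring)).add
    (((hP q).mul (hQ 0)).congr (by push_cast; ring)).neg).add
    (LSHasWt.sum fun j hj => LSHasWt.sum fun k _ => ?_)
  rw [Finset.mem_Icc] at hj
  refine ((LSHasWt.of_algebraMap (hasWt_curveCoeff j k)).mul ((hP k).mul (hQ (e - j)))).congr ?_
  push_cast [Nat.cast_sub hj.2]
  ring

/-- Only `y ^ e` and `x ^ q` reach the pole order `eq`. Any other monomial `x ^ k * y ^ (e - j)`
with nonzero coefficient has `e k < j q`, hence a pole of smaller order. -/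
theorem coeff_curveSum {P Q : ℕ → LaurentSeries (ZMu e q)}
    (hP : ∀ k : ℕ, LSHasWt (-(e * k)) (P k)) (hQ : ∀ l : ℕ, LSHasWt (-(q * l)) (Q l)) :
    (curveSum e q P Q).coeff (-(e * q)) = (P 0).coeff 0 * (Q e).coeff (-(e * q)) -
      (P q).coeff (-(e * q)) * (Q 0).coeff 0 := by
  have hP0 : LSHasWt 0 (P 0) := (hP 0).congr (by simp)
  have hQ0 : LSHasWt 0 (Q 0) := (hQ 0).congr (by simp)
  have hQe : LSHasWt (-(e * q)) (Q e) := (hQ e).congr (by ring)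
  have h1 := hP0.coeff_mul hQe
  have h2 := (hP q).coeff_mul hQ0
  rw [zero_add] at h1
  rw [add_zero] at h2
  have h3 : (∑ j ∈ Finset.Icc 1 e, ∑ k ∈ Finset.range (j * q),
      algebraMap (ZMu e q) (LaurentSeries (ZMu e q)) (curveCoeff e q j k) *
        (P k * Q (e - j))).coeff (-(e * q)) = 0 := by
    rw [HahnSeries.coeff_sum]
    refine Finset.sum_eq_zero fun j hj => ?_
    rw [HahnSeries.coeff_sum]
    refine Finset.sum_eq_zero fun k _ => ?_
    rw [Finset.mem_Icc] at hj
    rcases le_or_gt (j * q) (e * k) with hk | hk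
    · rw [curveCoeff_eq_zero hk, map_zero, zero_mul, HahnSeries.coeff_zero]
    · rw [laurent_algebraMap_eq_C, HahnSeries.C_mul_eq_smul, HahnSeries.coeff_smul,
        ((hP k).mul (hQ (e - j))).coeff_eq_zero, smul_zero]
      push_cast [Nat.cast_sub hj.2]
      zify at hk
      linarith
  unfold PlaneMiura.curveSum
  rw [HahnSeries.coeff_add, h3, HahnSeries.coeff_sub, h1, h2, add_zero]

/-- The properties of the expansions `x`, `y` and of the coefficient `φ` of `dt` in the
differential form `dx / f_y`. -/
structure IsLocalData (e q : ℕ) (a b : ℤ) (x y φ : LaurentSeries (ZMu e q)) : Prop where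
  curve : curveSum e q (fun k => x ^ k) (fun l => y ^ l) = 0
  wt_x : LSHasWt (-e) x
  wt_y : LSHasWt (-q) y
  wt_phi : LSHasWt (e * q - e - q - 1) φ
  lead_x : x.coeff (-e) = 1
  lead_y : y.coeff (-q) = 1
  lead_phi : φ.coeff (e * q - e - q - 1) = -1
  deriv_x : laurentDeriv _ x = curveSum e q (fun k => x ^ k) (fun l => l * y ^ (l - 1)) * φ
  deriv_y : laurentDeriv _ y = -(curveSum e q (fun k => k * x ^ (k - 1)) (fun l => y ^ l) * φ)
  param : ∃ u v : (LaurentSeries (ZMu e q))ˣ, u = x ∧ v = y ∧ u ^ (-a) * v ^ b = tUnit (ZMu e q)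

/-- Both expansions are a power of `t` times a power of one unit series `s`, and `s` is the fixed
point of a homogeneous contraction. -/
theorem IsExpansion.lsHasWt {a b : ℤ} (he : 0 < e) (heq : e < q) (h : a * e - b * q = 1)
    {x y : (LaurentSeries (ZMu e q))ˣ} (hxy : IsExpansion e q a b x y) :
    LSHasWt (-e) (x : LaurentSeries (ZMu e q)) ∧ LSHasWt (-q) (y : LaurentSeries (ZMu e q)) := by
  obtain ⟨S, ⟨s, -, rfl⟩, hx, hy⟩ := exists_oneUnit e q a b he heq h x y
    (Units.ext hxy.parameter) ((mul_tUnit_mem_iff x e).mpr ⟨hxy.x_order, hxy.x_lead⟩)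
    ((mul_tUnit_mem_iff y q).mpr ⟨hxy.y_order, hxy.y_lead⟩)
  have hs : PSHasWt 0 (s : PowerSeries (ZMu e q)) := by
    -- The equation of the curve is cleared of negative powers of `s` by the larger of `|a| e` and
    -- `|b| q`. These differ by `1`, so one of its two main terms becomes `s` and the other `1`; the
    -- sign of `b` decides which.
    rcases le_or_gt 0 b with hb | hb
    · have ha : 0 ≤ a := by nlinarith
      have hab : a.natAbs * e = b.natAbs * q + 1 := by
        zify
        rw [abs_of_nonneg ha, abs_of_nonneg hb]
        linarith
      have h1 := (curve_transform e q a.natAbs b.natAbs (a.natAbs * e) he (by rw [mul_comm])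
        (by rw [hab, mul_comm]; omega) _ s rfl x y hx hy).mp hxy.curve
      rw [Nat.sub_self, hab, Nat.add_sub_cancel_left, pow_zero, pow_one, ← hab] at h1
      refine psHasWt_of_fixed (∑ j ∈ Finset.Icc 1 (e - 1),
        tailPoly e q a.natAbs b.natAbs (a.natAbs * e) j
        - tailPoly e q a.natAbs b.natAbs (a.natAbs * e) e) (fun p hp => ?_) s
        (by linear_combination -h1)
      rw [Polynomial.eval_sub, Polynomial.eval_finsetSum]
      exact (Finset.sum_induction _ _ (fun _ _ => PSHasWt.add) (PSHasWt.zero _)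
        fun j _ => psHasWt_tailPoly _ _ _ _ p hp).sub (psHasWt_tailPoly _ _ _ _ p hp)
    · have ha : a ≤ 0 := by nlinarith
      have hab : a.natAbs * e + 1 = b.natAbs * q := by
        zify
        rw [abs_of_nonpos ha, abs_of_neg hb]
        linarith
      have h1 := (curve_transform e q a.natAbs b.natAbs (b.natAbs * q) he
        (by rw [← hab, mul_comm]; omega) (by rw [mul_comm]) _ s rfl x y hx hy).mp hxy.curve
      rw [Nat.sub_self, ← hab, Nat.add_sub_cancel_left, pow_zero, pow_one, hab] at h1
      refine psHasWt_of_fixed (-(∑ j ∈ Finset.Icc 1 (e - 1),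
        tailPoly e q a.natAbs b.natAbs (b.natAbs * q) j
        - tailPoly e q a.natAbs b.natAbs (b.natAbs * q) e)) (fun p hp => ?_) s (by
          rw [Polynomial.eval_neg]; linear_combination h1)
      rw [Polynomial.eval_neg, Polynomial.eval_sub, Polynomial.eval_finsetSum]
      exact ((Finset.sum_induction _ _ (fun _ _ => PSHasWt.add) (PSHasWt.zero _)
        fun j _ => psHasWt_tailPoly _ _ _ _ p hp).sub (psHasWt_tailPoly _ _ _ _ p hp)).neg
  have hs' : PSHasWt 0 ((s⁻¹ : (PowerSeries (ZMu e q))ˣ) : PowerSeries (ZMu e q)) := by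
    refine hs.of_mul s.ne_zero ?_
    rw [s.mul_inv]
    exact PSHasWt.one
  have hpow : ∀ n m : ℕ, LSHasWt (-n) (((tUnit (ZMu e q) ^ (-(n : ℤ)) *
      (Units.map (HahnSeries.ofPowerSeries ℤ (ZMu e q)).toMonoidHom s) ^ (-(m : ℤ)) :
        (LaurentSeries (ZMu e q))ˣ)) : LaurentSeries (ZMu e q)) := by
    intro n m
    rw [zpow_neg _ (m : ℤ), zpow_natCast, ← inv_pow, ← map_inv, Units.val_mul, tUnit_zpow,
      Units.val_pow_eq_pow_val]
    exact ((LSHasWt.single _).mul ((LSHasWt.ofPowerSeries hs').pow m)).congr (by simp)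
  rw [hx, hy]
  exact ⟨hpow _ _, hpow _ _⟩

/-- The logarithmic derivative of the parameter and the differentiated equation of the curve are two
linear equations for `x'` and `y'`. Solving them produces a common factor `φ` with `x' = f_y φ` and
`y' = -f_x φ`, provided that the determinant is invertible. -/
theorem IsExpansion.exists_isLocalData {a b : ℤ} (he : 0 < e) (heq : e < q)
    (h : a * e - b * q = 1) {x y : (LaurentSeries (ZMu e q))ˣ} (hxy : IsExpansion e q a b x y) :
    ∃ φ, IsLocalData e q a b x y φ := by
  obtain ⟨hwx, hwy⟩ := hxy.lsHasWt he heq h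
  have hcurve := hxy.curve
  rw [aeval_curvePoly he] at hcurve
  set X : LaurentSeries (ZMu e q) := x.val with hX
  set Y : LaurentSeries (ZMu e q) := y.val with hY
  set D := laurentDeriv (ZMu e q) with hD
  have hL : IsLeibniz D := isLeibniz_laurentDeriv _
  set fy := curveSum e q (fun k => X ^ k) (fun l => l * Y ^ (l - 1)) with hfy
  set fx := curveSum e q (fun k => k * X ^ (k - 1)) (fun l => Y ^ l) with hfx
  have hwX : ∀ k : ℕ, LSHasWt (-(e * k)) (X ^ k) := fun k => (hwx.pow k).congr (by ring)
  have hwY : ∀ k : ℕ, LSHasWt (-(q * k)) (Y ^ k) := fun k => (hwy.pow k).congr (by ring)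
  have hyfy : Y * fy = curveSum e q (fun k => X ^ k) (fun l => (l : ℤ) * Y ^ l) := by
    rw [hfy, ← curveSum_mul_right]
    congr 1
    funext l
    rcases l with _ | l
    · simp
    · rw [Nat.add_sub_cancel, pow_succ]; push_cast; ring
  have hxfx : X * fx = curveSum e q (fun k => (k : ℤ) * X ^ k) (fun l => Y ^ l) := by
    rw [hfx, ← curveSum_mul_left]
    congr 1
    funext l
    rcases l with _ | l
    · simp
    · rw [Nat.add_sub_cancel, pow_succ]; push_cast; ring
  -- The determinant of the system, up to factors that are units. The leading coefficients of `y
  -- f_y` and `x f_x` are `e` and `-q`, so that of `E` is `a e - b q = 1` and `E` is invertible over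
  -- `ℤ[μ]`.
  set E := a * (Y * fy) + b * (X * fx) with hE
  have hw1 : LSHasWt (-(e * q)) (Y * fy) := by
    rw [hyfy]
    exact (LSHasWt.curveSum 0 0 (fun k => (hwX k).congr (by ring))
      (fun l => ((hwY l).intCast_mul l).congr (by ring))).congr (by ring)
  have hw2 : LSHasWt (-(e * q)) (X * fx) := by
    rw [hxfx]
    exact (LSHasWt.curveSum 0 0 (fun l => ((hwX l).intCast_mul l).congr (by ring))
      (fun k => (hwY k).congr (by ring))).congr (by ring)
  have hwE : LSHasWt (-(e * q)) E := (hw1.intCast_mul a).add (hw2.intCast_mul b)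
  have hcX := hwx.coeff_pow q
  have hcY := hwy.coeff_pow e
  rw [hxy.x_lead, one_pow, show (q : ℤ) * -(e : ℤ) = -(e * q) by ring] at hcX
  rw [hxy.y_lead, one_pow, show (e : ℤ) * -(q : ℤ) = -(e * q) by ring] at hcY
  have hlE : E.coeff (-(e * q)) = 1 := by
    rw [hE, HahnSeries.coeff_add, coeff_intCast_mul, coeff_intCast_mul, hyfy, hxfx,
      coeff_curveSum hwX (fun l => (hwY l).intCast_mul l),
      coeff_curveSum (fun l => (hwX l).intCast_mul l) hwY, coeff_intCast_mul, coeff_intCast_mul,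
      coeff_intCast_mul, coeff_intCast_mul, hcX, hcY]
    have := congrArg (Int.cast (R := ZMu e q)) h
    push_cast at this
    simp only [pow_zero, Nat.cast_zero, Int.cast_zero, HahnSeries.coeff_one, if_pos]
    push_cast
    linear_combination this
  obtain ⟨p, hp, hEp⟩ := hwE.exists_powerSeries
  have hp1 : PowerSeries.constantCoeff p = 1 := by
    have := HahnSeries.coeff_single_mul_add (r := (1 : ZMu e q))
      (x := HahnSeries.ofPowerSeries ℤ _ p) (a := ((0 : ℕ) : ℤ)) (b := -(e * q : ℤ))
    rw [← hEp, Nat.cast_zero, zero_add, hlE, one_mul] at this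
    rw [← PowerSeries.coeff_zero_eq_constantCoeff_apply,
      ← HahnSeries.ofPowerSeries_apply_coeff (Γ := ℤ), Nat.cast_zero, ← this]
  have hpu : IsUnit p := by
    rw [PowerSeries.isUnit_iff_constantCoeff, hp1]
    exact isUnit_one
  obtain ⟨r, hr⟩ := hpu.exists_right_inv
  have hwr : PSHasWt 0 r := hp.of_mul hpu.ne_zero (by rw [hr]; exact PSHasWt.one)
  set T : LaurentSeries (ZMu e q) := HahnSeries.single 1 1 with hT
  have hTT : T * HahnSeries.single (-1) 1 = 1 := by rw [hT]; simp
  set E' := HahnSeries.single (e * q : ℤ) 1 * HahnSeries.ofPowerSeries ℤ _ r with hE'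
  have hEE : E * E' = 1 := by
    rw [hEp, hE', mul_mul_mul_comm, ← map_mul, hr]
    simp
  have hwE' : LSHasWt (e * q) E' :=
    ((LSHasWt.single _).mul (LSHasWt.ofPowerSeries hwr)).congr (by ring)
  have hlE' : E'.coeff (e * q) = 1 := by
    have := hwE.coeff_mul hwE'
    rw [hEE, hlE, neg_add_cancel, one_mul] at this
    rw [← this]
    simp
  have hdc : fx * D X + fy * D Y = 0 := by
    have h1 := hL.map_curveSum (e := e) (q := q) laurentDeriv_algebraMap
      (fun k => X ^ k) (fun l => Y ^ l)
    rw [hcurve, map_zero] at h1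
    have h2 : ∀ k : ℕ, D (X ^ k) = D X * (k * X ^ (k - 1)) := fun k => by
      rw [hL.map_pow]; ring
    have h3 : ∀ k : ℕ, D (Y ^ k) = D Y * (k * Y ^ (k - 1)) := fun k => by
      rw [hL.map_pow]; ring
    simp only [h2, h3, curveSum_mul_left, curveSum_mul_right] at h1
    linear_combination -h1
  have hlog : X * Y = T * (-a * Y * D X + b * X * D Y) := by
    have h1 := logDer_zpow_mul_zpow hL x y (-a) b
    have hxi := x.mul_inv
    have hyi := y.mul_inv
    rw [show x ^ (-a) * y ^ b = tUnit _ from Units.ext hxy.parameter] at h1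
    have h2 : D ((tUnit (ZMu e q) : (LaurentSeries (ZMu e q))ˣ) : LaurentSeries (ZMu e q)) = 1 := by
      have := laurentDeriv_single (R := ZMu e q) 1
      rw [← zpow_one (tUnit (ZMu e q)), tUnit_zpow]
      simpa using this
    have h3 : T * (((tUnit (ZMu e q))⁻¹ : (LaurentSeries (ZMu e q))ˣ) :
      LaurentSeries (ZMu e q)) = 1 := (tUnit (ZMu e q)).mul_inv
    rw [h2, one_mul] at h1
    rw [h1] at h3
    push_cast at h3
    linear_combination (-X * Y) * h3 - T * a * Y * D X * hxi + T * b * X * D Y * hyi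
  -- This is `φ = -x y / (t E)`. Its weight `eq - e - q - 1` and its leading coefficient `-1` are
  -- read off from the factors.
  refine ⟨-(HahnSeries.single (-1) 1 * X * Y * E'), hcurve, hwx, hwy, ?_, hxy.x_lead, hxy.y_lead,
    ?_, ?_, ?_, x, y, rfl, rfl, Units.ext hxy.parameter⟩
  · exact ((((LSHasWt.single (-1)).mul hwx).mul hwy).mul hwE').neg.congr (by ring)
  · have h1 := (((LSHasWt.single (-1)).mul hwx).mul hwy).coeff_mul hwE'
    rw [((LSHasWt.single (-1)).mul hwx).coeff_mul hwy, (LSHasWt.single (-1)).coeff_mul hwx,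
      hxy.x_lead, hxy.y_lead, hlE', HahnSeries.coeff_single_same] at h1
    rw [HahnSeries.coeff_neg, show (e * q - e - q - 1 : ℤ) = -1 + -e + -q + e * q by ring, h1]
    ring
  · have h1 : X * Y * fy = -(T * E * D X) := by
      rw [hE]
      linear_combination fy * hlog + T * b * X * hdc
    linear_combination (HahnSeries.single (-1) 1 * E') * h1 - D X * E * E' * hTT - D X * hEE
  · have h1 : X * Y * fx = T * E * D Y := by
      rw [hE]
      linear_combination fx * hlog - T * a * Y * hdc
    linear_combination -(HahnSeries.single (-1) 1 * E') * h1 - D Y * E * E' * hTT - D Y * hEE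

/-! ### Power series in two variables -/

theorem finsupp_fin_two_eq (n : Fin 2 →₀ ℕ) : n = Finsupp.single 0 (n 0) + Finsupp.single 1 (n 1) := by
  ext i
  fin_cases i <;> simp

theorem coeff_psAt (i : Fin 2) (p : PowerSeries (ZMu e q)) (n : Fin 2 →₀ ℕ) :
    MvPowerSeries.coeff n (psAt e q i p) =
      if n = Finsupp.single i (n i) then PowerSeries.coeff (n i) p else 0 := by
  change MvPowerSeries.coeff n (MvPowerSeries.rename (fun _ : Unit => i) p) = _
  have hf : (fun _ : Unit => i) = ((⟨fun _ => i, fun _ _ _ => Subsingleton.elim _ _⟩ :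
    Unit ↪ Fin 2) : Unit → Fin 2) := rfl
  split_ifs with h
  · have h1 : n = Finsupp.embDomain (⟨fun _ => i, fun _ _ _ => Subsingleton.elim _ _⟩ :
        Unit ↪ Fin 2) (Finsupp.single () (n i)) := by
      rw [Finsupp.embDomain_single]
      exact h
    conv_lhs => rw [h1]
    exact MvPowerSeries.coeff_embDomain_rename _ _ _
  · apply MvPowerSeries.coeff_rename_eq_zero
    rintro ⟨m, hm⟩
    apply h
    rw [← hm, show m = Finsupp.single () (m ()) by ext; simp, Finsupp.mapDomain_single]
    simp

theorem psAt_algebraMap (i : Fin 2) (c : ZMu e q) :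
    psAt e q i (algebraMap (ZMu e q) (PowerSeries (ZMu e q)) c) = algebraMap (ZMu e q) (PS2 e q) c :=
  AlgHom.commutes (MvPowerSeries.rename (R := ZMu e q) (fun _ : Unit => i)) c

/-- Substitution of `t` for both `t₁` and `t₂`. -/
def diagPS (e q : ℕ) : PS2 e q →+* PowerSeries (ZMu e q) :=
  (MvPowerSeries.rename (R := ZMu e q) (fun _ : Fin 2 => ())).toRingHom

theorem diagPS_psAt (i : Fin 2) (p : PowerSeries (ZMu e q)) : diagPS e q (psAt e q i p) = p := by
  change MvPowerSeries.rename (fun _ : Fin 2 => ()) (MvPowerSeries.rename (fun _ : Unit => i) p) = p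
  rw [MvPowerSeries.rename_rename]
  exact MvPowerSeries.rename_id_apply p

theorem diagPS_X (i : Fin 2) : diagPS e q (MvPowerSeries.X i) = PowerSeries.X := by
  rw [← psAt_X, diagPS_psAt]

theorem coeff_diagPS (F : PS2 e q) (N : ℕ) : PowerSeries.coeff N (diagPS e q F) =
    ∑ k ∈ Finset.range (N + 1),
      MvPowerSeries.coeff (Finsupp.single 0 k + Finsupp.single 1 (N - k)) F := by
  refine (MvPowerSeries.coeff_rename (fun _ : Fin 2 => ()) F (Finsupp.single () N)).trans ?_
  have hm : ∀ n : Fin 2 →₀ ℕ, Finsupp.mapDomain (fun _ : Fin 2 => ()) n =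
      Finsupp.single () (n 0 + n 1) := by
    intro n
    conv_lhs => rw [finsupp_fin_two_eq n]
    rw [Finsupp.mapDomain_add, Finsupp.mapDomain_single, Finsupp.mapDomain_single,
      ← Finsupp.single_add]
  refine Finset.sum_nbij' (fun n => n 0)
    (fun k => Finsupp.single 0 k + Finsupp.single 1 (N - k)) ?_ ?_ ?_ ?_ ?_
  · intro n hn
    simp only [Set.Finite.mem_toFinset, Set.mem_preimage, hm, Set.mem_singleton_iff] at hn
    have := congrArg (fun f => f ()) hn
    simp only [Finsupp.single_eq_same] at this
    rw [Finset.mem_range]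
    omega
  · intro k hk
    rw [Finset.mem_range] at hk
    simp only [Set.Finite.mem_toFinset, Set.mem_preimage, hm, Set.mem_singleton_iff]
    congr 1
    simp
    omega
  · intro n hn
    simp only [Set.Finite.mem_toFinset, Set.mem_preimage, hm, Set.mem_singleton_iff] at hn
    have := congrArg (fun f => f ()) hn
    simp only [Finsupp.single_eq_same] at this
    rw [show N - n 0 = n 1 by omega, ← finsupp_fin_two_eq]
  · intro k hk
    simp
  · intro n hn
    simp only [Set.Finite.mem_toFinset, Set.mem_preimage, hm, Set.mem_singleton_iff] at hn
    have := congrArg (fun f => f ()) hn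
    simp only [Finsupp.single_eq_same] at this
    rw [show N - n 0 = n 1 by omega, ← finsupp_fin_two_eq]

theorem coeff_X_mul (i : Fin 2) (n : Fin 2 →₀ ℕ) (F : PS2 e q) :
    MvPowerSeries.coeff (Finsupp.single i 1 + n) (MvPowerSeries.X i * F) =
      MvPowerSeries.coeff n F := by
  have := MvPowerSeries.coeff_add_monomial_mul (Finsupp.single i 1) n F (1 : ZMu e q)
  rw [one_mul] at this
  exact this

theorem coeff_X_mul_eq_zero (i : Fin 2) (n : Fin 2 →₀ ℕ) (hn : n i = 0) (F : PS2 e q) :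
    MvPowerSeries.coeff n (MvPowerSeries.X i * F) = 0 :=
  MvPowerSeries.X_dvd_iff.mp (dvd_mul_right _ F) n hn

/-- The power series that vanish on the diagonal are the multiples of `t₁ - t₂`. -/
theorem dvd_of_diagPS_eq_zero (F : PS2 e q) (hF : diagPS e q F = 0) :
    MvPowerSeries.X 0 - MvPowerSeries.X 1 ∣ F := by
  let c : ℕ → ℕ → ZMu e q := fun i j =>
    MvPowerSeries.coeff (Finsupp.single 0 i + Finsupp.single 1 j) F
  -- Comparison of coefficients in `F = (t₁ - t₂) Q` gives `Q_{i,j-1} = Q_{i-1,j} - c_{i,j}`, a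
  -- recursion along `i + j = const` that this sum solves. The vanishing of `F` on the diagonal is
  -- needed only at the end of each antidiagonal, where `j = 0`.
  let Q : PS2 e q := fun n => -∑ k ∈ Finset.range (n 0 + 1), c k (n 0 + n 1 + 1 - k)
  have hQ : ∀ i j : ℕ, MvPowerSeries.coeff (Finsupp.single 0 i + Finsupp.single 1 j) Q =
      -∑ k ∈ Finset.range (i + 1), c k (i + j + 1 - k) := by
    intro i j
    change -∑ k ∈ Finset.range _, _ = _
    simp
  have h0 : ∀ N, ∑ k ∈ Finset.range (N + 1), c k (N - k) = 0 := by
    intro N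
    rw [← coeff_diagPS, hF, map_zero]
  refine ⟨Q, ?_⟩
  ext1 n
  rw [finsupp_fin_two_eq n, sub_mul, map_sub]
  change c (n 0) (n 1) = _
  generalize n 0 = i
  generalize n 1 = j
  have hX0 : ∀ i j : ℕ, MvPowerSeries.coeff (Finsupp.single 0 (i + 1) + Finsupp.single 1 j)
      (MvPowerSeries.X 0 * Q) = -∑ k ∈ Finset.range (i + 1), c k (i + 1 + j - k) := by
    intro i j
    rw [Finsupp.single_add, add_comm (Finsupp.single 0 i), add_assoc, coeff_X_mul, hQ]
    simp only [show i + j + 1 = i + 1 + j by omega]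
  have hX1 : ∀ i j : ℕ, MvPowerSeries.coeff (Finsupp.single 0 i + Finsupp.single 1 (j + 1))
      (MvPowerSeries.X 1 * Q) = -∑ k ∈ Finset.range (i + 1), c k (i + (j + 1) - k) := by
    intro i j
    rw [add_comm j 1, Finsupp.single_add, add_left_comm, coeff_X_mul, hQ]
    simp only [show i + j + 1 = i + (1 + j) by omega]
  rcases i with _ | i <;> rcases j with _ | j
  · rw [coeff_X_mul_eq_zero _ _ (by simp), coeff_X_mul_eq_zero _ _ (by simp), sub_zero]
    simpa using h0 0
  · rw [coeff_X_mul_eq_zero _ _ (by simp), hX1]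
    simp
  · rw [hX0, coeff_X_mul_eq_zero _ _ (by simp)]
    have := h0 (i + 1)
    rw [Finset.sum_range_succ, Nat.sub_self] at this
    rw [sub_zero, add_zero]
    linear_combination this
  · rw [hX0, hX1, Finset.sum_range_succ _ (i + 1), show i + 1 + (j + 1) - (i + 1) = j + 1 by omega]
    ring

/-- Setting `t_i = 0` is a homomorphism to power series in the other variable, a domain, and its
kernel is generated by `t_i`. -/
theorem prime_X (i : Fin 2) : Prime (MvPowerSeries.X i : PS2 e q) := by
  obtain ⟨j, hij⟩ : ∃ j : Fin 2, j ≠ i := ⟨1 - i, by fin_cases i <;> simp⟩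
  let em : Unit ↪ Fin 2 := ⟨fun _ => j, fun _ _ _ => Subsingleton.elim _ _⟩
  have hd : ∀ F : PS2 e q, MvPowerSeries.X i ∣ F ↔ MvPowerSeries.killCompl em F = 0 := by
    intro F
    rw [MvPowerSeries.X_dvd_iff]
    constructor
    · intro h
      refine MvPowerSeries.ext fun n => ?_
      rw [MvPowerSeries.coeff_killCompl, map_zero]
      apply h
      rw [Finsupp.embDomain_eq_mapDomain, Finsupp.mapDomain_of_notMem_range]
      rintro ⟨_, h⟩
      exact hij h
    · intro h n hn
      have h1 := congrArg (MvPowerSeries.coeff (Finsupp.single () (n j))) h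
      rw [MvPowerSeries.coeff_killCompl, map_zero, Finsupp.embDomain_single] at h1
      rw [← h1]
      congr 2
      ext k
      by_cases hk : k = i
      · subst hk
        rw [hn, Finsupp.single_apply, if_neg]
        exact hij
      · obtain rfl : k = j := by fin_cases i <;> fin_cases j <;> fin_cases k <;> simp_all
        change _ = Finsupp.single (em ()) _ (em ())
        simp [em]
  refine ⟨?_, ?_, ?_⟩
  · intro h
    have := congrArg (MvPowerSeries.coeff (Finsupp.single i 1)) h
    simp [MvPowerSeries.coeff_X] at this
  · rw [MvPowerSeries.isUnit_iff_constantCoeff]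
    simp
  · intro F G h
    rw [hd, map_mul, mul_eq_zero] at h
    rwa [hd, hd]

theorem diff_ne_zero : (MvPowerSeries.X 0 - MvPowerSeries.X 1 : PS2 e q) ≠ 0 := by
  intro h
  have := congrArg (MvPowerSeries.coeff (Finsupp.single 0 1)) h
  rw [map_sub, MvPowerSeries.coeff_X, MvPowerSeries.coeff_X, if_pos rfl, if_neg, map_zero] at this
  · simp at this
  · rw [Finsupp.single_left_inj one_ne_zero]
    decide

theorem pderiv_psAt_self (i : Fin 2) (p : PowerSeries (ZMu e q)) :
    MvPowerSeries.pderiv (ZMu e q) i (psAt e q i p) =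
      psAt e q i (PowerSeries.derivative (ZMu e q) p) := by
  ext1 n
  rw [MvPowerSeries.coeff_pderiv, coeff_psAt, coeff_psAt]
  have h1 : (n + Finsupp.single i 1 : Fin 2 →₀ ℕ) i = n i + 1 := by simp
  rw [h1, Finsupp.single_add]
  by_cases h : n = Finsupp.single i (n i)
  · rw [if_pos h, if_pos (by rw [← h]), PowerSeries.coeff_derivative]
  · rw [if_neg h, if_neg, zero_mul]
    intro h2
    exact h (add_right_cancel h2)

theorem pderiv_psAt_of_ne {i j : Fin 2} (hij : i ≠ j) (p : PowerSeries (ZMu e q)) :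
    MvPowerSeries.pderiv (ZMu e q) i (psAt e q j p) = 0 := by
  ext1 n
  rw [MvPowerSeries.coeff_pderiv, coeff_psAt, if_neg, zero_mul, map_zero]
  intro h
  have := congrArg (fun f => f i) h
  simp [hij.symm] at this

/-! ### Laurent series in two variables -/

/-- The ring `ℤ[μ][[t₁, t₂]][1 / (t₁ t₂)]`. -/
abbrev Laurent2 (e q : ℕ) : Type :=
  Localization.Away (MvPowerSeries.X 0 * MvPowerSeries.X 1 : PS2 e q)

/-- The variable `t_i` in the ring of Laurent series in two variables. -/
def tVar (e q : ℕ) (i : Fin 2) : Laurent2 e q := algebraMap (PS2 e q) _ (MvPowerSeries.X i)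

theorem isUnit_tVar (i : Fin 2) : IsUnit (tVar e q i) := by
  have h : IsUnit (algebraMap (PS2 e q) (Laurent2 e q)
      (MvPowerSeries.X 0 * MvPowerSeries.X 1)) :=
    IsLocalization.Away.algebraMap_isUnit _
  rw [map_mul, IsUnit.mul_iff] at h
  fin_cases i
  · exact h.1
  · exact h.2

/-- Substitution of `t_i` for `t` in a Laurent series. -/
def lau (e q : ℕ) (i : Fin 2) : LaurentSeries (ZMu e q) →+* Laurent2 e q :=
  IsLocalization.lift (M := Submonoid.powers (PowerSeries.X : PowerSeries (ZMu e q)))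
    (g := (algebraMap (PS2 e q) (Laurent2 e q)).comp (psAt e q i)) <| by
      rintro ⟨_, n, rfl⟩
      rw [RingHom.comp_apply, map_pow, psAt_X, map_pow]
      exact (isUnit_tVar i).pow n

/-- Laurent series in two variables as elements of the field of fractions. -/
def toFrac (e q : ℕ) : Laurent2 e q →+* Frac2 e q :=
  IsLocalization.lift (M := Submonoid.powers (MvPowerSeries.X 0 * MvPowerSeries.X 1 : PS2 e q))
    (g := algebraMap (PS2 e q) (Frac2 e q)) <| by
      rintro ⟨_, n, rfl⟩
      rw [isUnit_iff_ne_zero, Ne, FaithfulSMul.algebraMap_eq_zero_iff]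
      exact pow_ne_zero _ (mul_ne_zero (prime_X 0).ne_zero (prime_X 1).ne_zero)

/-- Substitution of `t` for `t₁` and `t₂` in a Laurent series in two variables. -/
def diag (e q : ℕ) : Laurent2 e q →+* LaurentSeries (ZMu e q) :=
  IsLocalization.lift (M := Submonoid.powers (MvPowerSeries.X 0 * MvPowerSeries.X 1 : PS2 e q))
    (g := (HahnSeries.ofPowerSeries ℤ (ZMu e q)).comp (diagPS e q)) <| by
      rintro ⟨_, n, rfl⟩
      rw [RingHom.comp_apply, map_pow, map_pow, map_mul, diagPS_X, diagPS_X, map_mul,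
        HahnSeries.ofPowerSeries_X]
      exact ((tUnit (ZMu e q)).isUnit.mul (tUnit (ZMu e q)).isUnit).pow n

theorem single_natCast_eq (R : Type*) [CommRing R] (N : ℕ) :
    HahnSeries.single (N : ℤ) (1 : R) = HahnSeries.ofPowerSeries ℤ _ (PowerSeries.X ^ N) := by
  rw [map_pow, HahnSeries.ofPowerSeries_X, HahnSeries.single_pow]
  simp

theorem lau_ofPowerSeries (i : Fin 2) (p : PowerSeries (ZMu e q)) :
    lau e q i (HahnSeries.ofPowerSeries ℤ _ p) = algebraMap (PS2 e q) _ (psAt e q i p) :=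
  IsLocalization.lift_eq _ p

theorem laurentAt_ofPowerSeries (i : Fin 2) (p : PowerSeries (ZMu e q)) :
    laurentAt e q i (HahnSeries.ofPowerSeries ℤ _ p) =
      algebraMap (PS2 e q) _ (psAt e q i p) :=
  IsLocalization.lift_eq _ p

theorem toFrac_algebraMap (F : PS2 e q) :
    toFrac e q (algebraMap (PS2 e q) _ F) = algebraMap (PS2 e q) _ F :=
  IsLocalization.lift_eq _ F

theorem diag_algebraMap (F : PS2 e q) :
    diag e q (algebraMap (PS2 e q) _ F) = HahnSeries.ofPowerSeries ℤ _ (diagPS e q F) :=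
  IsLocalization.lift_eq _ F

theorem toFrac_lau (i : Fin 2) (h : LaurentSeries (ZMu e q)) :
    toFrac e q (lau e q i h) = laurentAt e q i h := by
  have : (toFrac e q).comp (lau e q i) = laurentAt e q i := by
    apply IsLocalization.ringHom_ext
      (M := Submonoid.powers (PowerSeries.X : PowerSeries (ZMu e q)))
    ext1 p
    change toFrac e q (lau e q i (HahnSeries.ofPowerSeries ℤ _ p)) =
      laurentAt e q i (HahnSeries.ofPowerSeries ℤ _ p)
    rw [lau_ofPowerSeries, toFrac_algebraMap, laurentAt_ofPowerSeries]
  exact congrArg (fun f => f h) this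

theorem diag_lau (i : Fin 2) (h : LaurentSeries (ZMu e q)) : diag e q (lau e q i h) = h := by
  have : (diag e q).comp (lau e q i) = RingHom.id _ := by
    apply IsLocalization.ringHom_ext
      (M := Submonoid.powers (PowerSeries.X : PowerSeries (ZMu e q)))
    ext1 p
    change diag e q (lau e q i (HahnSeries.ofPowerSeries ℤ _ p)) = HahnSeries.ofPowerSeries ℤ _ p
    rw [lau_ofPowerSeries, diag_algebraMap, diagPS_psAt]
  exact congrArg (fun f => f h) this

theorem exists_mul_eq (z : Laurent2 e q) : ∃ (N : ℕ) (F : PS2 e q),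
    z * (tVar e q 0 * tVar e q 1) ^ N = algebraMap (PS2 e q) _ F := by
  obtain ⟨⟨F, _, N, rfl⟩, h⟩ := IsLocalization.surj
    (Submonoid.powers (MvPowerSeries.X 0 * MvPowerSeries.X 1 : PS2 e q)) z
  exact ⟨N, F, by simpa [tVar] using h⟩

theorem toFrac_injective : Function.Injective (toFrac e q) := by
  rw [injective_iff_map_eq_zero]
  intro z hz
  obtain ⟨N, F, h⟩ := exists_mul_eq z
  have h1 := congrArg (toFrac e q) h
  rw [map_mul, hz, zero_mul, toFrac_algebraMap, eq_comm,
    FaithfulSMul.algebraMap_eq_zero_iff] at h1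
  rw [h1, map_zero] at h
  exact (((isUnit_tVar 0).mul (isUnit_tVar 1)).pow N).mul_left_eq_zero.mp h

instance : IsDomain (Laurent2 e q) := toFrac_injective.isDomain (toFrac e q)

theorem algebraMap_laurent2_injective :
    Function.Injective (algebraMap (PS2 e q) (Laurent2 e q)) := by
  intro F G h
  have := congrArg (toFrac e q) h
  rw [toFrac_algebraMap, toFrac_algebraMap] at this
  exact IsFractionRing.injective _ _ this

theorem lau_injective (i : Fin 2) : Function.Injective (lau e q i) :=
  Function.LeftInverse.injective (diag_lau i)

theorem laurentAt_injective (i : Fin 2) : Function.Injective (laurentAt e q i) := by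
  intro g h hgh
  rw [← toFrac_lau, ← toFrac_lau] at hgh
  exact lau_injective i (toFrac_injective hgh)

theorem lau_algebraMap (i : Fin 2) (c : ZMu e q) :
    lau e q i (algebraMap (ZMu e q) _ c) = algebraMap (ZMu e q) (Laurent2 e q) c := by
  rw [laurent_algebraMap_eq_C, ← HahnSeries.ofPowerSeries_C, lau_ofPowerSeries]
  rw [show PowerSeries.C c = algebraMap (ZMu e q) (PowerSeries (ZMu e q)) c from rfl,
    psAt_algebraMap, ← IsScalarTower.algebraMap_apply]

theorem toFrac_algebraMap_zMu (c : ZMu e q) :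
    toFrac e q (algebraMap (ZMu e q) _ c) = algebraMap (ZMu e q) (Frac2 e q) c := by
  rw [IsScalarTower.algebraMap_apply (ZMu e q) (PS2 e q) (Laurent2 e q), toFrac_algebraMap,
    ← IsScalarTower.algebraMap_apply]

theorem laurentAt_algebraMap (i : Fin 2) (c : ZMu e q) :
    laurentAt e q i (algebraMap (ZMu e q) _ c) = algebraMap (ZMu e q) (Frac2 e q) c := by
  rw [← toFrac_lau, lau_algebraMap, toFrac_algebraMap_zMu]

theorem diag_algebraMap_zMu (c : ZMu e q) :
    diag e q (algebraMap (ZMu e q) _ c) = algebraMap (ZMu e q) _ c := by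
  rw [← lau_algebraMap 0, diag_lau]

theorem lau_single (i : Fin 2) (n : ℕ) :
    lau e q i (HahnSeries.single (n : ℤ) 1) = tVar e q i ^ n := by
  rw [single_natCast_eq, lau_ofPowerSeries, map_pow, psAt_X, map_pow]
  rfl

/-- Laurent series in two variables that vanish on the diagonal are multiples of `t₁ - t₂`. -/
theorem dvd_of_diag_eq_zero (z : Laurent2 e q) (hz : diag e q z = 0) :
    tVar e q 0 - tVar e q 1 ∣ z := by
  obtain ⟨N, F, h⟩ := exists_mul_eq z
  have h1 := congrArg (diag e q) h
  rw [map_mul, hz, zero_mul, diag_algebraMap, eq_comm,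
    map_eq_zero_iff _ HahnSeries.ofPowerSeries_injective] at h1
  obtain ⟨G, rfl⟩ := dvd_of_diagPS_eq_zero F h1
  rw [map_mul, map_sub] at h
  have hu := ((isUnit_tVar (e := e) (q := q) 0).mul (isUnit_tVar 1)).pow N
  rw [← hu.dvd_mul_right, h]
  exact dvd_mul_right _ _

theorem exists_powerSeries_mul (h : LaurentSeries (ZMu e q)) :
    ∃ (N : ℕ) (p : PowerSeries (ZMu e q)),
      h * HahnSeries.single (N : ℤ) 1 = HahnSeries.ofPowerSeries ℤ _ p := by
  obtain ⟨⟨p, _, N, rfl⟩, hp⟩ := IsLocalization.surj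
    (Submonoid.powers (PowerSeries.X : PowerSeries (ZMu e q))) h
  refine ⟨N, p, ?_⟩
  rw [single_natCast_eq]
  exact hp

theorem laurentDeriv_ofPowerSeries (p : PowerSeries (ZMu e q)) :
    laurentDeriv _ (HahnSeries.ofPowerSeries ℤ (ZMu e q) p) =
      HahnSeries.ofPowerSeries ℤ _ (PowerSeries.derivative (ZMu e q) p) := by
  ext1
  funext n
  rw [laurentDeriv_coeff]
  rcases lt_or_ge n 0 with hn | hn
  · rw [ofPowerSeries_coeff_of_neg _ hn]
    rcases (show n + 1 < 0 ∨ n + 1 = 0 by omega) with h | h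
    · rw [ofPowerSeries_coeff_of_neg _ h, mul_zero]
    · rw [h]; simp
  · lift n to ℕ using hn
    rw [HahnSeries.ofPowerSeries_apply_coeff, PowerSeries.coeff_derivative,
      show (n : ℤ) + 1 = (n + 1 : ℕ) by simp, HahnSeries.ofPowerSeries_apply_coeff]
    push_cast
    ring

theorem diff_tVar_ne_zero : tVar e q 0 - tVar e q 1 ≠ 0 := by
  rw [tVar, tVar, ← map_sub]
  exact (map_ne_zero_iff _ algebraMap_laurent2_injective).mpr diff_ne_zero

/-- The difference quotient of a Laurent series. -/
theorem exists_differenceQuotient (h : LaurentSeries (ZMu e q)) : ∃ d : Laurent2 e q,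
    (tVar e q 0 - tVar e q 1) * d = lau e q 0 h - lau e q 1 h ∧ diag e q d = laurentDeriv _ h := by
  obtain ⟨d, hd⟩ := dvd_of_diag_eq_zero (lau e q 0 h - lau e q 1 h)
    (by rw [map_sub, diag_lau, diag_lau, sub_self])
  refine ⟨d, hd.symm, ?_⟩
  obtain ⟨N, p, hp⟩ := exists_powerSeries_mul h
  obtain ⟨P, hP⟩ := dvd_of_diagPS_eq_zero (psAt e q 0 p - psAt e q 1 p)
    (by rw [map_sub, diagPS_psAt, diagPS_psAt, sub_self])
  obtain ⟨S, hS⟩ := dvd_of_diagPS_eq_zero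
    (psAt e q 0 (PowerSeries.X ^ N) - psAt e q 1 (PowerSeries.X ^ N))
    (by rw [map_sub, diagPS_psAt, diagPS_psAt, sub_self])
  -- Differentiation with respect to `t₁` gives `r'(t₁) = R + (t₁ - t₂) ∂R`; on the diagonal the
  -- last term disappears.
  have hder : ∀ (r : PowerSeries (ZMu e q)) (R : PS2 e q), psAt e q 0 r - psAt e q 1 r =
      (MvPowerSeries.X 0 - MvPowerSeries.X 1) * R →
      diag e q (algebraMap _ _ R) = laurentDeriv _ (HahnSeries.ofPowerSeries ℤ _ r) := by
    intro r R hR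
    have h1 := congrArg (MvPowerSeries.pderiv (ZMu e q) 0) hR
    rw [map_sub, pderiv_psAt_self, pderiv_psAt_of_ne (by decide), Derivation.leibniz, map_sub,
      MvPowerSeries.pderiv_X_self, MvPowerSeries.pderiv_X_of_ne (by decide)] at h1
    have h2 := congrArg (diagPS e q) h1
    simp only [map_add, map_sub, smul_eq_mul, map_mul, diagPS_psAt, diagPS_X, map_one,
      map_zero] at h2
    rw [diag_algebraMap, laurentDeriv_ofPowerSeries]
    congr 1
    linear_combination -h2
  have hTN := single_natCast_eq (ZMu e q) N
  have hP' := congrArg (algebraMap (PS2 e q) (Laurent2 e q)) hP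
  have hS' := congrArg (algebraMap (PS2 e q) (Laurent2 e q)) hS
  rw [map_sub, map_mul, ← lau_ofPowerSeries, ← lau_ofPowerSeries, ← hp, map_mul, map_mul] at hP'
  rw [map_sub, map_mul, ← lau_ofPowerSeries, ← lau_ofPowerSeries, ← hTN] at hS'
  rw [map_sub] at hP' hS'
  change _ = (tVar e q 0 - tVar e q 1) * _ at hP'
  change _ = (tVar e q 0 - tVar e q 1) * _ at hS'
  -- The difference quotient of the product `p = h * t ^ N`. On the diagonal it turns into the
  -- product rule, from which the value of `d` is recovered since `t ^ N` is a unit.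
  have hkey : d * lau e q 0 (HahnSeries.single (N : ℤ) 1) + lau e q 1 h * algebraMap _ _ S =
      algebraMap _ _ P := by
    apply mul_left_cancel₀ diff_tVar_ne_zero
    rw [← hP']
    linear_combination (-lau e q 0 (HahnSeries.single (N : ℤ) 1)) * hd - lau e q 1 h * hS'
  have h3 := congrArg (diag e q) hkey
  rw [map_add, map_mul, map_mul, diag_lau, diag_lau, hder _ _ hP, hder _ _ hS, ← hp, ← hTN,
    isLeibniz_laurentDeriv] at h3
  apply (isUnit_iff_exists_inv.mpr ⟨HahnSeries.single (-(N : ℤ)) 1, by simp⟩ :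
    IsUnit (HahnSeries.single (N : ℤ) (1 : ZMu e q))).mul_left_cancel
  linear_combination h3

/-- If the difference vanished, so would the difference quotient, and with it the derivative, which
is its value on the diagonal. -/
theorem lau_zero_ne_lau_one {h : LaurentSeries (ZMu e q)} (hh : laurentDeriv _ h ≠ 0) :
    lau e q 0 h - lau e q 1 h ≠ 0 := by
  intro h0
  obtain ⟨d, hd, hd'⟩ := exists_differenceQuotient h
  rw [h0, mul_eq_zero, or_iff_right diff_tVar_ne_zero] at hd
  rw [← hd', hd, map_zero] at hh
  exact hh rfl

/-! ### The derivation of the field of fractions -/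

/-- The partial derivative `d/dt₂` as an additive endomorphism. -/
def dt2Hom (e q : ℕ) : Frac2 e q →+ Frac2 e q where
  toFun := dt2 e q
  map_zero' := by
    have := fracDeriv_div (MvPowerSeries.pderiv (ZMu e q) (1 : Fin 2)) 0 1 one_ne_zero
    simpa [dt2] using this
  map_add' z w := by
    obtain ⟨n, d, hd, rfl⟩ := IsFractionRing.div_surjective (A := PS2 e q) z
    obtain ⟨n', d', hd', rfl⟩ := IsFractionRing.div_surjective (A := PS2 e q) w
    rw [mem_nonZeroDivisors_iff_ne_zero] at hd hd'
    have h0 : algebraMap (PS2 e q) (Frac2 e q) d ≠ 0 := by simpa using hd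
    have h0' : algebraMap (PS2 e q) (Frac2 e q) d' ≠ 0 := by simpa using hd'
    rw [div_add_div _ _ h0 h0', ← map_mul, ← map_mul, ← map_mul, ← map_add, dt2,
      fracDeriv_div _ _ _ hd, fracDeriv_div _ _ _ hd', fracDeriv_div _ _ _ (mul_ne_zero hd hd')]
    simp only [map_add, map_sub, map_mul, Derivation.leibniz, smul_eq_mul]
    field_simp
    ring

theorem isLeibniz_dt2Hom : IsLeibniz (dt2Hom e q) := by
  intro z w
  obtain ⟨n, d, hd, rfl⟩ := IsFractionRing.div_surjective (A := PS2 e q) z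
  obtain ⟨n', d', hd', rfl⟩ := IsFractionRing.div_surjective (A := PS2 e q) w
  rw [mem_nonZeroDivisors_iff_ne_zero] at hd hd'
  have h0 : algebraMap (PS2 e q) (Frac2 e q) d ≠ 0 := by simpa using hd
  have h0' : algebraMap (PS2 e q) (Frac2 e q) d' ≠ 0 := by simpa using hd'
  change dt2 e q _ = _ * dt2 e q _ + _ * dt2 e q _
  rw [div_mul_div_comm, ← map_mul, ← map_mul, dt2,
    fracDeriv_div _ _ _ hd, fracDeriv_div _ _ _ hd', fracDeriv_div _ _ _ (mul_ne_zero hd hd')]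
  simp only [map_add, map_sub, map_mul, Derivation.leibniz, smul_eq_mul]
  field_simp
  ring

theorem dt2Hom_algebraMap (F : PS2 e q) : dt2Hom e q (algebraMap _ _ F) =
    algebraMap _ _ (MvPowerSeries.pderiv (ZMu e q) 1 F) := by
  have := fracDeriv_div (MvPowerSeries.pderiv (ZMu e q) (1 : Fin 2)) F 1 one_ne_zero
  simpa [dt2Hom, dt2] using this

theorem dt2Hom_algebraMap_zMu (c : ZMu e q) : dt2Hom e q (algebraMap (ZMu e q) _ c) = 0 := by
  rw [IsScalarTower.algebraMap_apply (ZMu e q) (PS2 e q) (Frac2 e q), dt2Hom_algebraMap,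
    Derivation.map_algebraMap, map_zero]

theorem laurentAt_single_ne_zero (i : Fin 2) (N : ℕ) :
    laurentAt e q i (HahnSeries.single (N : ℤ) 1) ≠ 0 := by
  rw [map_ne_zero_iff _ (laurentAt_injective i)]
  simp

theorem dt2Hom_laurentAt_zero (h : LaurentSeries (ZMu e q)) :
    dt2Hom e q (laurentAt e q 0 h) = 0 := by
  have hps : ∀ p, dt2Hom e q (laurentAt e q 0 (HahnSeries.ofPowerSeries ℤ _ p)) = 0 := by
    intro p
    rw [laurentAt_ofPowerSeries, dt2Hom_algebraMap, pderiv_psAt_of_ne (by decide), map_zero]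
  obtain ⟨N, p, hp⟩ := exists_powerSeries_mul h
  have hTN := single_natCast_eq (ZMu e q) N
  have h1 := hps p
  -- Both `h * t ^ N` and `t ^ N` are power series, for which the claim is known; the product rule
  -- leaves it for `h`.
  rw [← hp, map_mul, isLeibniz_dt2Hom, hTN, hps, mul_zero, zero_add, ← hTN] at h1
  exact (mul_eq_zero.mp h1).resolve_left (laurentAt_single_ne_zero 0 N)

theorem dt2Hom_laurentAt_one (h : LaurentSeries (ZMu e q)) :
    dt2Hom e q (laurentAt e q 1 h) = laurentAt e q 1 (laurentDeriv _ h) := by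
  have hps : ∀ p, dt2Hom e q (laurentAt e q 1 (HahnSeries.ofPowerSeries ℤ _ p)) =
      laurentAt e q 1 (laurentDeriv _ (HahnSeries.ofPowerSeries ℤ _ p)) := by
    intro p
    rw [laurentAt_ofPowerSeries, dt2Hom_algebraMap, pderiv_psAt_self, laurentDeriv_ofPowerSeries,
      laurentAt_ofPowerSeries]
  obtain ⟨N, p, hp⟩ := exists_powerSeries_mul h
  have hTN := single_natCast_eq (ZMu e q) N
  have h1 := hps p
  rw [← hp, map_mul, isLeibniz_dt2Hom, isLeibniz_laurentDeriv, hTN, hps, ← hTN] at h1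
  simp only [map_add, map_mul] at h1
  apply mul_left_cancel₀ (laurentAt_single_ne_zero (e := e) (q := q) 1 N)
  linear_combination h1

/-! ### The exchange of the variables -/

theorem swapFrac_algebraMap (F : PS2 e q) :
    swapFrac e q (algebraMap _ _ F) = algebraMap _ _ (swapPS e q F) :=
  IsFractionRing.ringEquivOfRingEquiv_algebraMap _ _

theorem swapPS_psAt (i : Fin 2) (p : PowerSeries (ZMu e q)) :
    swapPS e q (psAt e q i p) = psAt e q (Equiv.swap 0 1 i) p := by
  change MvPowerSeries.rename (Equiv.swap (0 : Fin 2) 1)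
    (MvPowerSeries.rename (fun _ : Unit => i) p) = _
  rw [MvPowerSeries.rename_rename]
  rfl

theorem swapFrac_laurentAt (i : Fin 2) (h : LaurentSeries (ZMu e q)) :
    swapFrac e q (laurentAt e q i h) = laurentAt e q (Equiv.swap 0 1 i) h := by
  have : ((swapFrac e q : Frac2 e q →+* Frac2 e q)).comp (laurentAt e q i) =
      laurentAt e q (Equiv.swap 0 1 i) := by
    apply IsLocalization.ringHom_ext
      (M := Submonoid.powers (PowerSeries.X : PowerSeries (ZMu e q)))
    ext1 p
    change swapFrac e q (laurentAt e q i (HahnSeries.ofPowerSeries ℤ _ p)) =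
      laurentAt e q _ (HahnSeries.ofPowerSeries ℤ _ p)
    rw [laurentAt_ofPowerSeries, laurentAt_ofPowerSeries, swapFrac_algebraMap, swapPS_psAt]
  exact congrArg (fun f => f h) this

theorem swapFrac_algebraMap_zMu (c : ZMu e q) :
    swapFrac e q (algebraMap (ZMu e q) _ c) = algebraMap (ZMu e q) _ c := by
  rw [← laurentAt_algebraMap 0, swapFrac_laurentAt, laurentAt_algebraMap, laurentAt_algebraMap]

/-! ### The numerical semigroup generated by `e` and `q` -/

theorem exists_eq_add {e q : ℕ} (he : 0 < e) (hcop : Nat.Coprime e q) (n : ℤ) :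
    ∃ (j : ℕ) (i : ℤ), j < e ∧ n = i * e + j * q := by
  have hb := Nat.gcd_eq_gcd_ab e q
  rw [hcop.gcd_eq_one, Nat.cast_one] at hb
  set u := Nat.gcdA e q
  set v := Nat.gcdB e q
  have he' : (0 : ℤ) < e := by exact_mod_cast he
  refine ⟨((n * v) % e).toNat, n * u + (n * v) / e * q, ?_, ?_⟩
  · have := Int.emod_lt_of_pos (n * v) he'
    omega
  · rw [Int.toNat_of_nonneg (Int.emod_nonneg _ he'.ne')]
    have := Int.emod_add_mul_ediv (n * v) e
    linear_combination n * hb - (q : ℤ) * this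

/-- Otherwise `eq` would be a combination of `e` and `q` with both coefficients positive. By
coprimality `q` divides the coefficient of `e`, so that term alone is already at least `eq`. -/
theorem not_isNongap_both {e q : ℕ} (hq : 0 < q) (hcop : Nat.Coprime e q) {m n : ℕ}
    (h : (m : ℤ) + n = e * q - e - q) (hm : IsNongap e q m) : ¬ IsNongap e q n := by
  rintro ⟨i, j, rfl⟩
  obtain ⟨k, l, rfl⟩ := hm
  have h1 : (k + i + 1) * e + (l + j + 1) * q = e * q := by
    zify
    push_cast at h
    linear_combination h
  have h2 : q ∣ (k + i + 1) := by
    have : q ∣ (k + i + 1) * e := (Nat.dvd_add_left (Dvd.intro_left _ rfl)).mp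
      (h1 ▸ Dvd.intro_left _ rfl : q ∣ (k + i + 1) * e + (l + j + 1) * q)
    exact hcop.symm.dvd_of_dvd_mul_right this
  have h3 := Nat.le_of_dvd (Nat.succ_pos _) h2
  nlinarith

/-- The semigroup is symmetric about `eq - e - q = 2g - 1`. Write `m = i e + j q` with `0 ≤ j < e`;
if `m` is a gap then `i < 0`. -/
theorem isNongap_iff {e q : ℕ} (he : 0 < e) (hq : 0 < q) (hcop : Nat.Coprime e q) {m n : ℕ}
    (h : (m : ℤ) + n = e * q - e - q) : ¬ IsNongap e q m ↔ IsNongap e q n := by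
  refine ⟨fun hm => ?_, fun hn => not_isNongap_both hq hcop (by rw [← h, add_comm]) hn⟩
  obtain ⟨j, i, hj, hi⟩ := exists_eq_add he hcop m
  have hi0 : i < 0 := by
    by_contra h0
    rw [not_lt] at h0
    lift i to ℕ using h0
    exact hm ⟨i, j, by exact_mod_cast hi.symm⟩
  -- Indeed `eq - e - q - (i e + j q) = (-i - 1) e + (e - 1 - j) q`.
  refine ⟨(-i - 1).toNat, e - 1 - j, ?_⟩
  zify
  rw [Int.toNat_of_nonneg (by omega), show ((e - 1 - j : ℕ) : ℤ) = e - 1 - j by omega]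
  linear_combination -h + hi

/-- Modulo `q` the coefficients of `e` agree, and below `eq` they are both less than `q`. This
identifies the chosen pair `nongapExp` with any exponents of the same degree. -/
theorem exp_unique {e q i j k l : ℕ} (hcop : Nat.Coprime e q)
    (h : i * e + j * q = k * e + l * q) (hlt : i * e + j * q < e * q) : i = k ∧ j = l := by
  have hiq : i < q := by nlinarith [Nat.zero_le (j * q)]
  have hkq : k < q := by nlinarith [Nat.zero_le (l * q)]
  have h1 : i * e ≡ k * e [MOD q] := by
    have h2 : i * e + j * q ≡ k * e + l * q [MOD q] := by rw [h]
    simpa [Nat.ModEq] using h2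
  have h3 : i ≡ k [MOD q] := Nat.ModEq.cancel_right_of_coprime hcop.symm h1
  have h4 : i = k := Nat.ModEq.eq_of_lt_of_lt h3 hiq hkq
  subst h4
  refine ⟨rfl, ?_⟩
  have h5 : j * q = l * q := by omega
  exact Nat.eq_of_mul_eq_mul_right (by omega) h5

/-! ### Gaps and non-gaps below `2g` -/

section Count

open Classical

variable {e q : ℕ}

theorem two_mul_genus (he : 0 < e) (hq : 0 < q) (hcop : Nat.Coprime e q) :
    2 * (genus e q : ℤ) = e * q - e - q + 1 := by
  have h2 : 2 ∣ (e - 1) * (q - 1) := by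
    rcases Nat.even_or_odd e with h | h
    · have : Odd q := by
        rw [← Nat.not_even_iff_odd]
        intro h'
        have := Nat.dvd_gcd h.two_dvd h'.two_dvd
        rw [hcop.gcd_eq_one] at this
        omega
      exact dvd_mul_of_dvd_right (by obtain ⟨k, hk⟩ := this; omega) _
    · exact dvd_mul_of_dvd_left (by obtain ⟨k, hk⟩ := h; omega) _
  have h3 := Nat.mul_div_cancel' h2
  rw [genus]
  zify [Nat.one_le_iff_ne_zero.mpr he.ne', Nat.one_le_iff_ne_zero.mpr hq.ne'] at h3 ⊢
  linear_combination h3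

/-- The reflection `s ↦ 2g - 1 - s` exchanges gaps and non-gaps, so the gaps below `k` correspond to
the non-gaps in the last `k` places below `2g`. -/
theorem count_reflect (he : 0 < e) (hq : 0 < q) (hcop : Nat.Coprime e q) (k : ℕ)
    (hk : k ≤ 2 * genus e q) :
    Nat.count (fun s => ¬ IsNongap e q s) k + Nat.count (IsNongap e q) (2 * genus e q - k) =
      Nat.count (IsNongap e q) (2 * genus e q) := by
  have hg := two_mul_genus he hq hcop
  induction k with
  | zero => simp
  | succ k ih =>
    rw [← ih (by omega), Nat.count_succ,
      show 2 * genus e q - k = (2 * genus e q - (k + 1)) + 1 by omega, Nat.count_succ]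
    have h1 := isNongap_iff he hq hcop (m := k) (n := 2 * genus e q - (k + 1)) (by omega)
    simp only [h1]
    omega

theorem count_isNongap (he : 0 < e) (hq : 0 < q) (hcop : Nat.Coprime e q) :
    Nat.count (IsNongap e q) (2 * genus e q) = genus e q := by
  have h1 := count_reflect he hq hcop _ le_rfl
  rw [Nat.sub_self, Nat.count_zero, add_zero] at h1
  have h2 : ∀ n, Nat.count (IsNongap e q) n + Nat.count (fun s => ¬ IsNongap e q s) n = n := by
    intro n
    induction n with
    | zero => simp
    | succ n ih =>
      rw [Nat.count_succ, Nat.count_succ]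
      by_cases h : IsNongap e q n
      · simp only [h, not_true_eq_false, if_true, if_false]; omega
      · simp only [h, not_false_eq_true, if_true, if_false]; omega
  have := h2 (2 * genus e q)
  omega

theorem nongap_spec (he : 0 < e) (hq : 0 < q) (hcop : Nat.Coprime e q) {j : ℕ}
    (hj : j < genus e q) : IsNongap e q (nongap e q j) ∧ nongap e q j < 2 * genus e q ∧
      Nat.count (IsNongap e q) (nongap e q j) = j := by
  have h1 : j < Nat.count (IsNongap e q) (2 * genus e q) := by
    rwa [count_isNongap he hq hcop]
  have hinf : (Set.ofPred (IsNongap e q)).Infinite :=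
    Set.infinite_of_injective_forall_mem (f := fun n : ℕ => n * e)
      (fun a b h => Nat.eq_of_mul_eq_mul_right he h) (fun n => ⟨n, 0, by simp⟩)
  exact ⟨Nat.nth_mem_of_infinite hinf j, Nat.nth_lt_of_lt_count h1,
    Nat.count_nth_of_infinite hinf j⟩

theorem nongapExp_spec (he : 0 < e) (hq : 0 < q) (hcop : Nat.Coprime e q) {j : ℕ}
    (hj : j < genus e q) :
    (nongapExp e q j).1 * e + (nongapExp e q j).2 * q = nongap e q j := by
  obtain ⟨⟨m, n, h⟩, -⟩ := nongap_spec he hq hcop hj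
  exact Classical.epsilon_spec (p := fun r : ℕ × ℕ => r.1 * e + r.2 * q = nongap e q j) ⟨(m, n), h⟩

theorem nongapExp_zero (he : 0 < e) (hq : 0 < q) : nongapExp e q 0 = (0, 0) := by
  have h0 : nongap e q 0 = 0 := by
    rw [nongap, Nat.nth_zero]
    exact Nat.sInf_eq_zero.mpr (Or.inl ⟨0, 0, by simp⟩)
  have h1 : (nongapExp e q 0).1 * e + (nongapExp e q 0).2 * q = 0 := by
    have := Classical.epsilon_spec (p := fun r : ℕ × ℕ => r.1 * e + r.2 * q = nongap e q 0)
      ⟨(0, 0), by simp [h0]⟩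
    exact this.trans h0
  have h2 : (nongapExp e q 0).1 = 0 := by
    rcases Nat.mul_eq_zero.mp (Nat.eq_zero_of_add_eq_zero_right h1) with h | h <;> omega
  have h3 : (nongapExp e q 0).2 = 0 := by
    rcases Nat.mul_eq_zero.mp (Nat.eq_zero_of_add_eq_zero_left h1) with h | h <;> omega
  exact Prod.ext h2 h3

/-- The monomials of weight less than `2g - 1` are the holomorphic ones. -/
theorem exists_nongapExp_eq (he : 0 < e) (hq : 0 < q) (hcop : Nat.Coprime e q) {i j : ℕ}
    (h : (i : ℤ) * e + j * q < e * q - e - q) :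
    ∃ r : Fin (genus e q), nongapExp e q (genus e q - 1 - r) = (i, j) := by
  have hg := two_mul_genus he hq hcop
  set s := i * e + j * q with hs
  have hp : IsNongap e q s := ⟨i, j, rfl⟩
  have hs2 : (s : ℤ) = i * e + j * q := by rw [hs]; push_cast; ring
  have h1 : Nat.count (IsNongap e q) s < genus e q := by
    rw [← count_isNongap he hq hcop]
    exact Nat.count_strict_mono hp (by omega)
  -- The position of `s` among the non-gaps, reversed because the `ω_{w_i}` are indexed by the gaps
  -- in increasing order. It is less than `g`: there are `g` non-gaps below `2g`, and `s` is one of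
  -- them.
  refine ⟨⟨genus e q - 1 - Nat.count (IsNongap e q) s, by omega⟩, ?_⟩
  have h2 : genus e q - 1 - (genus e q - 1 - Nat.count (IsNongap e q) s) =
    Nat.count (IsNongap e q) s := by omega
  simp only [h2]
  have h3 := nongapExp_spec he hq hcop h1
  rw [nongap, Nat.nth_count hp, hs] at h3
  have h4 : i * e + j * q < e * q := by
    zify
    have : (0 : ℤ) ≤ e := by positivity
    have : (0 : ℤ) ≤ q := by positivity
    linarith
  have := exp_unique hcop h3.symm h4
  exact Prod.ext this.1.symm this.2.symm

theorem gap_eq (he : 0 < e) (hq : 0 < q) (hcop : Nat.Coprime e q) (r : Fin (genus e q)) :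
    (gap e q r : ℤ) = e * q - e - q - nongap e q (genus e q - 1 - r) := by
  have hg := two_mul_genus he hq hcop
  have hr := r.2
  set t := genus e q - 1 - (r : ℕ) with ht
  obtain ⟨hp, hlt, hc⟩ := nongap_spec he hq hcop (j := t) (by omega)
  set s := nongap e q t with hs
  -- The reflected number `2g - 1 - s` is a gap, and this counts the gaps below it: `g - (t + 1) =
  -- r`.
  have h1 := count_reflect he hq hcop (2 * genus e q - (s + 1)) (by omega)
  rw [show 2 * genus e q - (2 * genus e q - (s + 1)) = s + 1 by omega, Nat.count_succ, hc,
    if_pos hp, count_isNongap he hq hcop] at h1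
  have h2 : ¬ IsNongap e q (2 * genus e q - (s + 1)) :=
    (isNongap_iff he hq hcop (n := s) (by omega)).mpr hp
  have h3 : gap e q r = 2 * genus e q - (s + 1) := by
    have h4 := Nat.nth_count (p := fun s => ¬ IsNongap e q s) h2
    rw [show Nat.count (fun s => ¬ IsNongap e q s) (2 * genus e q - (s + 1)) = r by omega] at h4
    exact h4
  omega

end Count

/-! ### Divided differences -/

section DividedDifference

variable {A : Type*} [CommRing A]

/-- The divided difference of `X ^ l` at `u, v`. -/
def divDiff (u v : A) (l : ℕ) : A := ∑ i ∈ Finset.range l, u ^ i * v ^ (l - 1 - i)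

/-- The divided difference of `X ^ l` at `u, v, v`. -/
def divDiff₂ (u v : A) (l : ℕ) : A := ∑ i ∈ Finset.range l, divDiff u v i * v ^ (l - 1 - i)

theorem sub_mul_divDiff (u v : A) (l : ℕ) : (u - v) * divDiff u v l = u ^ l - v ^ l := by
  rw [mul_comm]
  exact geom_sum₂_mul u v l

theorem divDiff_comm (u v : A) (l : ℕ) : divDiff u v l = divDiff v u l :=
  geom_sum₂_comm u v l

theorem sub_mul_divDiff₂ (u v : A) (l : ℕ) :
    (u - v) * divDiff₂ u v l = divDiff u v l - l * v ^ (l - 1) := by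
  have h1 : ∀ i ∈ Finset.range l, (u - v) * (divDiff u v i * v ^ (l - 1 - i)) =
      u ^ i * v ^ (l - 1 - i) - v ^ (l - 1) := by
    intro i hi
    rw [Finset.mem_range] at hi
    rw [← mul_assoc, sub_mul_divDiff, sub_mul, ← pow_add, show i + (l - 1 - i) = l - 1 by omega]
  rw [divDiff₂, Finset.mul_sum, Finset.sum_congr rfl h1, Finset.sum_sub_distrib, divDiff]
  simp

theorem map_divDiff {B : Type*} [CommRing B] (F : A →+* B) (u v : A) (l : ℕ) :
    F (divDiff u v l) = divDiff (F u) (F v) l := by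
  simp [divDiff]

end DividedDifference

/-! ### The derivative of the bracket -/

section Bracket

variable {K : Type*} [Field K] [Algebra (ZMu e q) K]

/-- The polynomial correction in the formula for the derivative of the bracket. -/
def correction (e q : ℕ) {K : Type*} [CommRing K] [Algebra (ZMu e q) K] (x y z w : K) : K :=
  curveSum e q (fun k => z ^ k) (divDiff₂ y w) * curveSum e q (divDiff₂ x z) (fun l => w ^ l) -
    curveSum e q (divDiff₂ x z) (divDiff y w) *
      curveSum e q (fun k => z ^ k) (fun l => l * w ^ (l - 1))

theorem leibniz_div {D : K →+ K} (hD : IsLeibniz D) (u v : K) (hv : v ≠ 0) :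
    D (u / v) = (D u * v - u * D v) / v ^ 2 := by
  have h := hD (u / v) v
  rw [div_mul_cancel₀ _ hv] at h
  rw [eq_div_iff (pow_ne_zero 2 hv), h]
  field_simp
  ring

/-- The result is arranged so that its first term is visibly invariant under the exchange of the
points, while everything else is a polynomial in the coordinates. It is a formal consequence of
divided-difference relations and of the two equations of the curve. -/
theorem deriv_bracket {D : K →+ K} (hD : IsLeibniz D)
    (hc : ∀ c, D (algebraMap (ZMu e q) K c) = 0) {x y z w φ₁ φ₂ : K} (hx : D x = 0)
    (hy : D y = 0) (hφ : D φ₁ = 0)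
    (hz : D z = curveSum e q (fun k => z ^ k) (fun l => l * w ^ (l - 1)) * φ₂)
    (hw : D w = -(curveSum e q (fun k => k * z ^ (k - 1)) (fun l => w ^ l) * φ₂))
    (h1 : curveSum e q (fun k => x ^ k) (fun l => y ^ l) = 0)
    (h2 : curveSum e q (fun k => z ^ k) (fun l => w ^ l) = 0) (hxz : x - z ≠ 0)
    (hyw : y - w ≠ 0) :
    D (φ₁ * (1 / (x - z)) * curveSum e q (fun k => z ^ k) (divDiff y w)) = φ₁ * φ₂ *
      (curveSum e q (fun k => z ^ k) (divDiff y w) *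
        curveSum e q (fun k => x ^ k) (divDiff y w) / (x - z) ^ 2 + correction e q x y z w) := by
  set G₀ := curveSum e q (fun k => z ^ k) (divDiff y w) with hG₀
  set G₁ := curveSum e q (fun k => x ^ k) (divDiff y w) with hG₁
  set Gw := curveSum e q (fun k => z ^ k) (divDiff₂ y w) with hGw
  set F := curveSum e q (fun k => z ^ k) (fun l => y ^ l) with hF
  set Fx := curveSum e q (fun k => k * z ^ (k - 1)) (fun l => y ^ l) with hFx
  set fw := curveSum e q (fun k => z ^ k) (fun l => l * w ^ (l - 1)) with hfw
  set fz := curveSum e q (fun k => k * z ^ (k - 1)) (fun l => w ^ l) with hfz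
  set dy := curveSum e q (divDiff x z) (fun l => y ^ l) with hdy
  set dw := curveSum e q (divDiff x z) (fun l => w ^ l) with hdw
  set Γ := curveSum e q (divDiff x z) (divDiff y w) with hΓ
  set δy := curveSum e q (divDiff₂ x z) (fun l => y ^ l) with hδy
  set δw := curveSum e q (divDiff₂ x z) (fun l => w ^ l) with hδw
  set δΓ := curveSum e q (divDiff₂ x z) (divDiff y w) with hδΓ
  have e1 : (y - w) * G₀ = F := by
    rw [hG₀, ← curveSum_mul_right]
    simp only [sub_mul_divDiff]
    rw [curveSum_sub_right, h2, sub_zero]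
  have e3 : (x - z) * dy = -F := by
    rw [hdy, ← curveSum_mul_left]
    simp only [sub_mul_divDiff]
    rw [curveSum_sub_left, h1, zero_sub]
  have e4 : (y - w) * Γ = dy - dw := by
    rw [hΓ, ← curveSum_mul_right]
    simp only [sub_mul_divDiff]
    rw [curveSum_sub_right]
  have e5 : (x - z) * δw = dw - fz := by
    rw [hδw, ← curveSum_mul_left]
    simp only [sub_mul_divDiff₂]
    rw [curveSum_sub_left]
  have e6 : (x - z) * δy = dy - Fx := by
    rw [hδy, ← curveSum_mul_left]
    simp only [sub_mul_divDiff₂]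
    rw [curveSum_sub_left]
  have e6' : (y - w) * δΓ = δy - δw := by
    rw [hδΓ, ← curveSum_mul_right]
    simp only [sub_mul_divDiff]
    rw [curveSum_sub_right]
  have e7 : (y - w) * Gw = G₀ - fw := by
    rw [hGw, ← curveSum_mul_right]
    simp only [sub_mul_divDiff₂]
    rw [curveSum_sub_right]
  have e8 : (x - z) * Γ = G₁ - G₀ := by
    rw [hΓ, ← curveSum_mul_left]
    simp only [sub_mul_divDiff]
    rw [curveSum_sub_left]
  have hDF : D F = Fx * D z := by
    have hpz : ∀ k : ℕ, D (z ^ k) = D z * (k * z ^ (k - 1)) := fun k => by rw [hD.map_pow]; ring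
    have hpy : ∀ k : ℕ, D (y ^ k) = 0 * y ^ k := fun k => by rw [hD.map_pow, hy]; ring
    rw [hF, hD.map_curveSum hc]
    simp only [hpz, hpy, curveSum_mul_left, curveSum_mul_right]
    ring
  -- Differentiating `(y - w) G₀ = f(z, y)` avoids differentiating a divided difference: on the
  -- right only `z` varies.
  have e9 : (y - w) * D G₀ = φ₂ * (Fx * fw - fz * G₀) := by
    have h := congrArg D e1
    rw [hD, hDF, map_sub, hy, hw, hz] at h
    linear_combination h
  have e10 : D (φ₁ * (1 / (x - z)) * G₀) = φ₁ * ((D G₀ * (x - z) + G₀ * (fw * φ₂)) / (x - z) ^ 2) := by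
    rw [mul_assoc, one_div_mul_eq_div, hD, hφ, mul_zero, add_zero, leibniz_div hD _ _ hxz, map_sub,
      hx, hz]
    ring
  rw [e10, mul_assoc φ₁]
  congr 1
  rw [correction, div_eq_iff (pow_ne_zero 2 hxz), mul_assoc, add_mul,
    div_mul_cancel₀ _ (pow_ne_zero 2 hxz)]
  -- With the factor `y - w` restored, second divided differences occur only in products that the
  -- relations above reduce to first ones.
  apply mul_left_cancel₀ hyw
  rw [← hGw, ← hδw, ← hδΓ, ← hfw]
  linear_combination (x - z) * e9 - φ₂ * (x - z) ^ 2 * δw * e7 + φ₂ * (x - z) ^ 2 * fw * e6' -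
    φ₂ * (x - z) * G₀ * e5 + φ₂ * (x - z) * fw * e6 + φ₂ * (y - w) * G₀ * e8 -
    φ₂ * (x - z) * G₀ * e4 + φ₂ * (fw - G₀) * (e1 + e3)

end Bracket

/-! ### Homogeneous polynomials in the coordinates of two points -/

section BiSpan

variable {A : Type*} [CommRing A] [Algebra (ZMu e q) A] {x y z w : A} {d d' : ℤ}

/-- The values at `(x, y)`, `(z, w)` of the homogeneous polynomials of degree `d`. -/
def biSpan (e q : ℕ) {A : Type*} [CommRing A] [Algebra (ZMu e q) A] (x y z w : A) (d : ℤ) :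
    AddSubgroup A :=
  AddSubgroup.closure {r | ∃ (c : ZMu e q) (i j k l : ℕ),
    HasWt e q (e * (i + k) + q * (j + l) - d) c ∧
      r = algebraMap (ZMu e q) A c * (x ^ i * y ^ j) * (z ^ k * w ^ l)}

theorem monomial_mem_biSpan {c : ZMu e q} (i j k l : ℕ)
    (hc : HasWt e q (e * (i + k) + q * (j + l) - d) c) :
    algebraMap (ZMu e q) A c * (x ^ i * y ^ j) * (z ^ k * w ^ l) ∈ biSpan e q x y z w d :=
  AddSubgroup.subset_closure ⟨c, i, j, k, l, hc, rfl⟩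

theorem mem_biSpan_congr {r : A} (hr : r ∈ biSpan e q x y z w d) (hd : d = d') :
    r ∈ biSpan e q x y z w d' := hd ▸ hr

theorem mul_mem_biSpan {r s : A} (hr : r ∈ biSpan e q x y z w d)
    (hs : s ∈ biSpan e q x y z w d') : r * s ∈ biSpan e q x y z w (d + d') := by
  unfold biSpan at hr
  induction hr using AddSubgroup.closure_induction with
  | zero => rw [zero_mul]; exact zero_mem _
  | add r r' _ _ h h' => rw [add_mul]; exact add_mem h h'
  | neg r _ h => rw [neg_mul]; exact neg_mem h
  | mem r hr =>
    unfold biSpan at hs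
    induction hs using AddSubgroup.closure_induction with
    | zero => rw [mul_zero]; exact zero_mem _
    | add s s' _ _ h h' => rw [mul_add]; exact add_mem h h'
    | neg s _ h => rw [mul_neg]; exact neg_mem h
    | mem s hs =>
      obtain ⟨c, i, j, k, l, hc, rfl⟩ := hr
      obtain ⟨c', i', j', k', l', hc', rfl⟩ := hs
      have := monomial_mem_biSpan (x := x) (y := y) (z := z) (w := w) (d := d + d') (i + i')
        (j + j') (k + k') (l + l') ((hc.mul hc').congr (by push_cast; ring))
      have h2 : algebraMap (ZMu e q) A c * (x ^ i * y ^ j) * (z ^ k * w ^ l) *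
          (algebraMap (ZMu e q) A c' * (x ^ i' * y ^ j') * (z ^ k' * w ^ l')) =
          algebraMap (ZMu e q) A (c * c') * (x ^ (i + i') * y ^ (j + j')) *
            (z ^ (k + k') * w ^ (l + l')) := by
        rw [map_mul]; ring
      rw [h2]
      exact this

theorem curveSum_mem_biSpan {P Q : ℕ → A} (u v : ℤ)
    (hP : ∀ k : ℕ, P k ∈ biSpan e q x y z w (e * k + u))
    (hQ : ∀ l : ℕ, Q l ∈ biSpan e q x y z w (q * l + v)) :
    curveSum e q P Q ∈ biSpan e q x y z w (e * q + u + v) := by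
  unfold curveSum
  refine add_mem (sub_mem ?_ ?_) (sum_mem fun j hj => sum_mem fun k _ => ?_)
  · exact mem_biSpan_congr (mul_mem_biSpan (hP 0) (hQ e)) (by push_cast; ring)
  · exact mem_biSpan_congr (mul_mem_biSpan (hP q) (hQ 0)) (by push_cast; ring)
  · rw [Finset.mem_Icc] at hj
    have h1 := monomial_mem_biSpan (x := x) (y := y) (z := z) (w := w) (d := j * q - e * k)
      0 0 0 0 ((hasWt_curveCoeff (e := e) (q := q) j k).congr (by push_cast; ring))
    simp only [pow_zero, mul_one] at h1
    exact mem_biSpan_congr (mul_mem_biSpan h1 (mul_mem_biSpan (hP k) (hQ (e - j))))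
      (by push_cast [Nat.cast_sub hj.2]; ring)

theorem pow_left_mem_biSpan (k : ℕ) : x ^ k ∈ biSpan e q x y z w (e * k) := by
  have := monomial_mem_biSpan (e := e) (q := q) (x := x) (y := y) (z := z) (w := w) (d := e * k)
      k 0 0 0 (HasWt.one.congr (by push_cast; ring))
  simpa only [map_one, pow_zero, one_mul, mul_one] using this

theorem pow_right_mem_biSpan (k : ℕ) : z ^ k ∈ biSpan e q x y z w (e * k) := by
  have := monomial_mem_biSpan (e := e) (q := q) (x := x) (y := y) (z := z) (w := w) (d := e * k)
      0 0 k 0 (HasWt.one.congr (by push_cast; ring))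
  simpa only [map_one, pow_zero, one_mul, mul_one] using this

theorem pow_left_mem_biSpan' (k : ℕ) : y ^ k ∈ biSpan e q x y z w (q * k) := by
  have := monomial_mem_biSpan (e := e) (q := q) (x := x) (y := y) (z := z) (w := w) (d := q * k)
      0 k 0 0 (HasWt.one.congr (by push_cast; ring))
  simpa only [map_one, pow_zero, one_mul, mul_one] using this

theorem pow_right_mem_biSpan' (k : ℕ) : w ^ k ∈ biSpan e q x y z w (q * k) := by
  have := monomial_mem_biSpan (e := e) (q := q) (x := x) (y := y) (z := z) (w := w) (d := q * k)
      0 0 0 k (HasWt.one.congr (by push_cast; ring))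
  simpa only [map_one, pow_zero, one_mul, mul_one] using this

theorem divDiff_mem_biSpan {u v : A} (n : ℤ) (hu : ∀ k : ℕ, u ^ k ∈ biSpan e q x y z w (n * k))
    (hv : ∀ k : ℕ, v ^ k ∈ biSpan e q x y z w (n * k)) (k : ℕ) :
    divDiff u v k ∈ biSpan e q x y z w (n * k - n) := by
  refine sum_mem fun i hi => ?_
  rw [Finset.mem_range] at hi
  refine mem_biSpan_congr (mul_mem_biSpan (hu i) (hv _)) ?_
  rw [show ((k - 1 - i : ℕ) : ℤ) = k - 1 - i by omega]
  ring

theorem divDiff₂_mem_biSpan {u v : A} (n : ℤ) (hu : ∀ k : ℕ, u ^ k ∈ biSpan e q x y z w (n * k))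
    (hv : ∀ k : ℕ, v ^ k ∈ biSpan e q x y z w (n * k)) (k : ℕ) :
    divDiff₂ u v k ∈ biSpan e q x y z w (n * k - 2 * n) := by
  refine sum_mem fun i hi => ?_
  rw [Finset.mem_range] at hi
  refine mem_biSpan_congr (mul_mem_biSpan (divDiff_mem_biSpan n hu hv i) (hv _)) ?_
  rw [show ((k - 1 - i : ℕ) : ℤ) = k - 1 - i by omega]
  ring

theorem kernel_mem_biSpan : curveSum e q (fun k => z ^ k) (divDiff y w) ∈
    biSpan e q x y z w (e * q - q) :=
  mem_biSpan_congr (curveSum_mem_biSpan 0 (-q)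
    (fun k => mem_biSpan_congr (pow_right_mem_biSpan k) (by ring))
    (fun k => mem_biSpan_congr (divDiff_mem_biSpan q pow_left_mem_biSpan' pow_right_mem_biSpan' k)
      (by ring))) (by ring)

/-- A divided difference in `y` lowers the degree of `f` by `q` and one in `x` by `e`. Each product
in `correction` involves two of each kind, with `f_w` counted as a confluent divided difference. -/
theorem correction_mem_biSpan :
    correction e q x y z w ∈ biSpan e q x y z w (2 * (e * q - e - q)) := by
  have hz : ∀ k : ℕ, z ^ k ∈ biSpan e q x y z w (e * k + 0) := fun k =>
    mem_biSpan_congr (pow_right_mem_biSpan k) (by ring)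
  have hw : ∀ k : ℕ, w ^ k ∈ biSpan e q x y z w (q * k + 0) := fun k =>
    mem_biSpan_congr (pow_right_mem_biSpan' k) (by ring)
  have hw' : ∀ k : ℕ, (k : A) * w ^ (k - 1) ∈ biSpan e q x y z w (q * k + -q) := fun k => by
    rcases k with _ | k
    · simp only [Nat.cast_zero, zero_mul]; exact zero_mem _
    · have := AddSubgroup.nsmul_mem _ (mem_biSpan_congr (d' := q * (k + 1 : ℕ) + -q) (hw k)
        (by push_cast; ring)) (k + 1)
      rwa [nsmul_eq_mul] at this
  have hyw : ∀ k : ℕ, divDiff y w k ∈ biSpan e q x y z w (q * k + -q) := fun k =>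
    mem_biSpan_congr (divDiff_mem_biSpan q pow_left_mem_biSpan' pow_right_mem_biSpan' k) (by ring)
  have hyw' : ∀ k : ℕ, divDiff₂ y w k ∈ biSpan e q x y z w (q * k + -2 * q) := fun k =>
    mem_biSpan_congr (divDiff₂_mem_biSpan q pow_left_mem_biSpan' pow_right_mem_biSpan' k) (by ring)
  have hxz' : ∀ k : ℕ, divDiff₂ x z k ∈ biSpan e q x y z w (e * k + -2 * e) := fun k =>
    mem_biSpan_congr (divDiff₂_mem_biSpan e pow_left_mem_biSpan pow_right_mem_biSpan k) (by ring)
  exact sub_mem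
    (mem_biSpan_congr (mul_mem_biSpan (curveSum_mem_biSpan _ _ hz hyw')
      (curveSum_mem_biSpan _ _ hxz' hw)) (by ring))
    (mem_biSpan_congr (mul_mem_biSpan (curveSum_mem_biSpan _ _ hxz' hyw)
      (curveSum_mem_biSpan _ _ hz hw')) (by ring))

/-- The exponents of the monomial in the numerator of `ω_{w_{i+1}}`. -/
def holExp (e q : ℕ) (i : Fin (genus e q)) : ℕ × ℕ := nongapExp e q (genus e q - 1 - i)

/-- A homogeneous polynomial of degree `4g - 2` in the coordinates of two points becomes symmetric
on adding products of holomorphic monomials at the first point with polynomials at the second. -/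
theorem exists_symmetric (he : 0 < e) (hq : 0 < q) (hcop : Nat.Coprime e q) (σ : A →+* A)
    (hσ : ∀ c, σ (algebraMap (ZMu e q) A c) = algebraMap (ZMu e q) A c) (hx : σ x = z)
    (hy : σ y = w) (hz : σ z = x) (hw : σ w = y) {r : A}
    (hr : r ∈ biSpan e q x y z w (2 * (e * q - e - q))) :
    -- The homogeneity of `h i` is stated through its values at homogeneous Laurent series, the only
    -- form in which it is used.
    ∃ h : Fin (genus e q) → MvPolynomial (Fin 2) (ZMu e q),
      (∀ (i : Fin (genus e q)) (X Y : LaurentSeries (ZMu e q)), LSHasWt (-e) X → LSHasWt (-q) Y →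
        LSHasWt ((holExp e q i).1 * e + (holExp e q i).2 * q - 2 * (e * q - e - q))
          (MvPolynomial.aeval ![X, Y] (h i))) ∧
      σ (r + ∑ i, x ^ (holExp e q i).1 * y ^ (holExp e q i).2 * MvPolynomial.aeval ![z, w] (h i)) =
        r + ∑ i, x ^ (holExp e q i).1 * y ^ (holExp e q i).2 *
          MvPolynomial.aeval ![z, w] (h i) := by
  classical
  unfold biSpan at hr
  induction hr using AddSubgroup.closure_induction with
  | zero => exact ⟨0, fun i X Y _ _ => by simpa using LSHasWt.zero _, by simp⟩
  | add r s _ _ hr hs =>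
    obtain ⟨h, h1, h2⟩ := hr
    obtain ⟨h', h1', h2'⟩ := hs
    refine ⟨h + h', fun i X Y hX hY => ?_, ?_⟩
    · rw [Pi.add_apply, map_add]
      exact (h1 i X Y hX hY).add (h1' i X Y hX hY)
    · simp only [Pi.add_apply, map_add, mul_add, Finset.sum_add_distrib] at h2 h2' ⊢
      linear_combination h2 + h2'
  | neg r _ hr =>
    obtain ⟨h, h1, h2⟩ := hr
    refine ⟨-h, fun i X Y hX hY => ?_, ?_⟩
    · rw [Pi.neg_apply, map_neg]
      exact (h1 i X Y hX hY).neg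
    · simp only [Pi.neg_apply, map_neg, map_add, mul_neg, Finset.sum_neg_distrib] at h2 ⊢
      linear_combination -h2
  | mem r hr =>
    obtain ⟨c, i, j, k, l, hc, rfl⟩ := hr
    have hsingle : ∀ (s : Fin (genus e q)) (p : MvPolynomial (Fin 2) (ZMu e q)),
        ∑ i, x ^ (holExp e q i).1 * y ^ (holExp e q i).2 * MvPolynomial.aeval ![z, w]
          ((Pi.single s p : Fin (genus e q) → MvPolynomial (Fin 2) (ZMu e q)) i) =
        x ^ (holExp e q s).1 * y ^ (holExp e q s).2 * MvPolynomial.aeval ![z, w] p := by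
      intro s p
      rw [Finset.sum_eq_single s]
      · rw [Pi.single_eq_same]
      · intro b _ hb
        rw [Pi.single_eq_of_ne hb, map_zero, mul_zero]
      · simp
    have hwt : ∀ (s : Fin (genus e q)) (p : MvPolynomial (Fin 2) (ZMu e q)),
        (∀ (X Y : LaurentSeries (ZMu e q)), LSHasWt (-e) X → LSHasWt (-q) Y →
        LSHasWt ((holExp e q s).1 * e + (holExp e q s).2 * q - 2 * (e * q - e - q))
          (MvPolynomial.aeval ![X, Y] p)) →
        (∀ (i : Fin (genus e q)) (X Y : LaurentSeries (ZMu e q)), LSHasWt (-e) X → LSHasWt (-q) Y →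
        LSHasWt ((holExp e q i).1 * e + (holExp e q i).2 * q - 2 * (e * q - e - q))
          (MvPolynomial.aeval ![X, Y]
            ((Pi.single s p : Fin (genus e q) → MvPolynomial (Fin 2) (ZMu e q)) i))) := by
      intro s p hp i X Y hX hY
      by_cases hi : i = s
      · subst hi
        rw [Pi.single_eq_same]
        exact hp X Y hX hY
      · rw [Pi.single_eq_of_ne hi, map_zero]
        exact LSHasWt.zero _
    -- The monomial is holomorphic at the first point: it is of the form that the sum can
    -- contribute, and is cancelled.
    by_cases h1 : (i : ℤ) * e + j * q < e * q - e - q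
    · obtain ⟨s, hs⟩ := exists_nongapExp_eq he hq hcop h1
      refine ⟨Pi.single s (-(MvPolynomial.C c * MvPolynomial.X 0 ^ k * MvPolynomial.X 1 ^ l)),
        hwt s _ fun X Y hX hY => ?_, ?_⟩
      · rw [holExp, hs]
        simp only [map_neg, map_mul, map_pow, MvPolynomial.aeval_C, MvPolynomial.aeval_X]
        exact (((LSHasWt.of_algebraMap hc).mul (hX.pow k)).mul (hY.pow l)).neg.congr (by ring)
      · rw [hsingle, holExp, hs]
        simp only [map_neg, map_mul, map_pow, MvPolynomial.aeval_C, MvPolynomial.aeval_X, map_add,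
          hσ, hx, hy, hz, hw, Matrix.cons_val_zero, Matrix.cons_val_one]
        ring
    -- The monomial is holomorphic at the second point: its mirror image is of the form that the sum
    -- can contribute, and is added.
    · by_cases h2 : (k : ℤ) * e + l * q < e * q - e - q
      · obtain ⟨s, hs⟩ := exists_nongapExp_eq he hq hcop h2
        refine ⟨Pi.single s (MvPolynomial.C c * MvPolynomial.X 0 ^ i * MvPolynomial.X 1 ^ j),
          hwt s _ fun X Y hX hY => ?_, ?_⟩
        · rw [holExp, hs]
          simp only [map_mul, map_pow, MvPolynomial.aeval_C, MvPolynomial.aeval_X]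
          exact (((LSHasWt.of_algebraMap hc).mul (hX.pow i)).mul (hY.pow j)).congr (by ring)
        · rw [hsingle, holExp, hs]
          simp only [map_mul, map_pow, MvPolynomial.aeval_C, MvPolynomial.aeval_X, map_add,
            hσ, hx, hy, hz, hw, Matrix.cons_val_zero, Matrix.cons_val_one]
          ring
      -- Now both degrees are at least `2g - 1`. If `c ≠ 0`, their sum is at most `4g - 2`, so both
      -- equal `2g - 1`, which is a gap as the reflection of `0`.
      · have hc0 : c = 0 := by
          by_contra hne
          have h3 : ¬ (0 < (e : ℤ) * (i + k) + q * (j + l) - 2 * (e * q - e - q)) :=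
            fun h => hne (hc.eq_zero_of_pos h)
          have h4 : (i : ℤ) * e + j * q = e * q - e - q := by linarith
          exact not_isNongap_both hq hcop (m := i * e + j * q) (n := 0)
            (by push_cast; linarith) ⟨i, j, rfl⟩ ⟨0, 0, by simp⟩
        exact ⟨0, fun i X Y _ _ => by simpa using LSHasWt.zero _, by simp [hc0]⟩

end BiSpan

/-! ### Weights in two variables -/

/-- The Laurent series `z` in two variables is homogeneous of weight `w`. -/
def L2HasWt (w : ℤ) (z : Laurent2 e q) : Prop := ∃ (N : ℕ) (F : PS2 e q),
  PSHasWt (w + 2 * N) F ∧ z * (tVar e q 0 * tVar e q 1) ^ N = algebraMap (PS2 e q) _ F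

theorem psHasWt_prod_X : PSHasWt 2 (MvPowerSeries.X 0 * MvPowerSeries.X 1 : PS2 e q) :=
  ((PSHasWt.X 0).mul (PSHasWt.X 1)).congr (by norm_num)

theorem prod_X_ne_zero : (MvPowerSeries.X 0 * MvPowerSeries.X 1 : PS2 e q) ≠ 0 :=
  mul_ne_zero (prime_X 0).ne_zero (prime_X 1).ne_zero

theorem algebraMap_prod_X (N : ℕ) : algebraMap (PS2 e q) (Laurent2 e q)
    ((MvPowerSeries.X 0 * MvPowerSeries.X 1) ^ N) = (tVar e q 0 * tVar e q 1) ^ N := by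
  rw [map_pow, map_mul]; rfl

theorem PSHasWt.psAt {w : ℤ} {p : PowerSeries (ZMu e q)} (hp : PSHasWt w p) (i : Fin 2) :
    PSHasWt w (psAt e q i p) := PSHasWt.rename hp

theorem PSHasWt.pderiv {w : ℤ} {F : PS2 e q} (hF : PSHasWt w F) (i : Fin 2) :
    PSHasWt (w - 1) (MvPowerSeries.pderiv (ZMu e q) i F) := fun n => by
  rw [MvPowerSeries.coeff_pderiv]
  have := (hF (n + Finsupp.single i 1)).mul (HasWt.intCast (n i + 1))
  push_cast at this
  refine this.congr ?_
  rw [map_add, Finsupp.degree_single]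
  push_cast
  ring

theorem psHasWt_of_lsHasWt {w : ℤ} {p : PowerSeries (ZMu e q)}
    (hp : LSHasWt w (HahnSeries.ofPowerSeries ℤ _ p)) : PSHasWt w p := fun n => by
  obtain ⟨m, rfl⟩ : ∃ m, n = Finsupp.single () m := ⟨n (), by ext; simp⟩
  have := hp m
  rw [HahnSeries.ofPowerSeries_apply_coeff] at this
  exact this.congr (by simp)

namespace L2HasWt

variable {w w' : ℤ} {z z' : Laurent2 e q}

theorem congr (h : L2HasWt w z) (hw : w = w') : L2HasWt w' z := hw ▸ h

theorem of_psHasWt {F : PS2 e q} (h : PSHasWt w F) : L2HasWt w (algebraMap (PS2 e q) (Laurent2 e q) F) :=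
  ⟨0, F, by simpa using h, by simp⟩

theorem zero (w : ℤ) : L2HasWt w (0 : Laurent2 e q) := by
  simpa using of_psHasWt (PSHasWt.zero w)

theorem add (h : L2HasWt w z) (h' : L2HasWt w z') : L2HasWt w (z + z') := by
  obtain ⟨N, F, hF, hz⟩ := h
  obtain ⟨N', F', hF', hz'⟩ := h'
  refine ⟨N + N', F * (MvPowerSeries.X 0 * MvPowerSeries.X 1) ^ N' +
    F' * (MvPowerSeries.X 0 * MvPowerSeries.X 1) ^ N, ?_, ?_⟩
  · exact ((hF.mul (psHasWt_prod_X.pow N')).congr (by push_cast; ring)).add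
      ((hF'.mul (psHasWt_prod_X.pow N)).congr (by push_cast; ring))
  · rw [map_add, map_mul, map_mul, algebraMap_prod_X, algebraMap_prod_X, ← hz, ← hz']
    ring

theorem neg (h : L2HasWt w z) : L2HasWt w (-z) := by
  obtain ⟨N, F, hF, hz⟩ := h
  exact ⟨N, -F, hF.neg, by rw [map_neg, ← hz, neg_mul]⟩

theorem sub (h : L2HasWt w z) (h' : L2HasWt w z') : L2HasWt w (z - z') := by
  rw [sub_eq_add_neg]; exact h.add h'.neg

theorem mul (h : L2HasWt w z) (h' : L2HasWt w' z') : L2HasWt (w + w') (z * z') := by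
  obtain ⟨N, F, hF, hz⟩ := h
  obtain ⟨N', F', hF', hz'⟩ := h'
  refine ⟨N + N', F * F', (hF.mul hF').congr (by push_cast; ring), ?_⟩
  rw [map_mul, ← hz, ← hz']
  ring

theorem tVar (i : Fin 2) : L2HasWt 1 (tVar e q i) := of_psHasWt (PSHasWt.X i)

theorem pow (h : L2HasWt w z) (n : ℕ) : L2HasWt (n * w) (z ^ n) := by
  induction n with
  | zero => simpa using of_psHasWt (PSHasWt.one (σ := Fin 2) (e := e) (q := q))
  | succ n ih =>
    rw [pow_succ]
    exact (ih.mul h).congr (by push_cast; ring)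

theorem lau {h : LaurentSeries (ZMu e q)} (hh : LSHasWt w h) (i : Fin 2) :
    L2HasWt w (lau e q i h) := by
  obtain ⟨N, p, hp⟩ := exists_powerSeries_mul h
  have hp' : PSHasWt (w + N) p :=
    psHasWt_of_lsHasWt (hp ▸ hh.mul (LSHasWt.single (N : ℤ)))
  have h1 := congrArg (PlaneMiura.lau e q i) hp
  rw [map_mul, lau_single, lau_ofPowerSeries] at h1
  have h2 : ∀ j, PSHasWt (w + 2 * N) (psAt e q i p * MvPowerSeries.X j ^ N) := fun j =>
    ((hp'.psAt i).mul ((PSHasWt.X j).pow N)).congr (by ring)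
  have h3 : ∀ j, algebraMap (PS2 e q) (Laurent2 e q) (psAt e q i p * MvPowerSeries.X j ^ N) =
      algebraMap _ _ (psAt e q i p) * PlaneMiura.tVar e q j ^ N := fun j => by
    rw [map_mul, map_pow]; rfl
  fin_cases i
  · refine ⟨N, _, h2 1, ?_⟩
    rw [h3, ← h1, mul_pow]
    simp only [Fin.zero_eta, Fin.isValue]
    ring
  · refine ⟨N, _, h2 0, ?_⟩
    rw [h3, ← h1, mul_pow]
    simp only [Fin.mk_one, Fin.isValue]
    ring

/-- The regular part of the bracket is known only through an equation. Its weight is obtained by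
division, after denominators have been cleared. -/
theorem psHasWt_of_mul {d : Laurent2 e q} {F : PS2 e q} (hd : L2HasWt w d) (h0 : d ≠ 0)
    (h : L2HasWt (w + w') (d * algebraMap (PS2 e q) _ F)) : PSHasWt w' F := by
  obtain ⟨N, D, hD, hz⟩ := hd
  obtain ⟨M, E, hE, hz'⟩ := h
  have h1 : D * (MvPowerSeries.X 0 * MvPowerSeries.X 1) ^ M * F =
      E * (MvPowerSeries.X 0 * MvPowerSeries.X 1) ^ N := by
    apply algebraMap_laurent2_injective
    rw [map_mul, map_mul, map_mul, algebraMap_prod_X, algebraMap_prod_X, ← hz, ← hz']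
    ring
  have hD0 : D ≠ 0 := by
    rintro rfl
    rw [map_zero] at hz
    exact h0 ((((isUnit_tVar 0).mul (isUnit_tVar 1)).pow N).mul_left_eq_zero.mp hz)
  refine (hD.mul (psHasWt_prod_X.pow M)).of_mul (mul_ne_zero hD0 (pow_ne_zero _ prod_X_ne_zero)) ?_
  rw [h1]
  exact (hE.mul (psHasWt_prod_X.pow N)).congr (by ring)

theorem of_mem_biSpan {x y z w r : Laurent2 e q} {d : ℤ} (hx : L2HasWt (-e) x)
    (hy : L2HasWt (-q) y) (hz : L2HasWt (-e) z) (hw : L2HasWt (-q) w)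
    (hr : r ∈ biSpan e q x y z w d) : L2HasWt (-d) r := by
  unfold biSpan at hr
  induction hr using AddSubgroup.closure_induction with
  | zero => exact zero _
  | add r s _ _ h h' => exact h.add h'
  | neg r _ h => exact h.neg
  | mem r hr =>
    obtain ⟨c, i, j, k, l, hc, rfl⟩ := hr
    have h1 := L2HasWt.lau (LSHasWt.of_algebraMap hc) 0
    rw [lau_algebraMap] at h1
    exact ((h1.mul ((hx.pow i).mul (hy.pow j))).mul ((hz.pow k).mul (hw.pow l))).congr (by ring)

end L2HasWt

/-! ### The polar part of the bracket -/

theorem divDiff_self {A : Type*} [CommRing A] (u : A) (l : ℕ) :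
    divDiff u u l = l * u ^ (l - 1) := by
  have h : ∀ i ∈ Finset.range l, u ^ i * u ^ (l - 1 - i) = u ^ (l - 1) := by
    intro i hi
    rw [Finset.mem_range] at hi
    rw [← pow_add, show i + (l - 1 - i) = l - 1 by omega]
  rw [divDiff, Finset.sum_congr rfl h]
  simp

/-- Modulo the ideal generated by `u - u'` and `v - v'` the two products coincide. Applied to `t = x
^ (-a) * y ^ b`, it puts `t₁ - t₂` into the ideal of `x - z` and `y - w`. -/
theorem exists_zpow_mul_zpow_sub {A : Type*} [CommRing A] (u v u' v' : Aˣ) (m n : ℤ) :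
    ∃ α β : A, α * (u - u') + β * (v - v') =
      ((u ^ m * v ^ n : Aˣ) : A) - ((u' ^ m * v' ^ n : Aˣ) : A) := by
  rw [← Ideal.mem_span_pair, ← Ideal.Quotient.eq]
  set I := Ideal.span {(u : A) - u', (v : A) - v'}
  have hu : Units.map (Ideal.Quotient.mk I).toMonoidHom u =
      Units.map (Ideal.Quotient.mk I).toMonoidHom u' :=
    Units.ext (Ideal.Quotient.eq.mpr (Ideal.subset_span (by simp)))
  have hv : Units.map (Ideal.Quotient.mk I).toMonoidHom v =
      Units.map (Ideal.Quotient.mk I).toMonoidHom v' :=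
    Units.ext (Ideal.Quotient.eq.mpr (Ideal.subset_span (by simp)))
  have h : Units.map (Ideal.Quotient.mk I).toMonoidHom (u ^ m * v ^ n) =
      Units.map (Ideal.Quotient.mk I).toMonoidHom (u' ^ m * v' ^ n) := by
    rw [map_mul, map_mul, map_zpow, map_zpow, map_zpow, map_zpow, hu, hv]
  exact congrArg Units.val h

namespace IsLocalData

variable {a b : ℤ} {X Y φ : LaurentSeries (ZMu e q)}

theorem deriv_x_ne_zero (he : 0 < e) (h : IsLocalData e q a b X Y φ) : laurentDeriv _ X ≠ 0 := by
  intro h0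
  have h1 := laurentDeriv_coeff X (-e - 1)
  rw [h0, sub_add_cancel, h.lead_x, mul_one, HahnSeries.coeff_zero] at h1
  have h2 : ((-(e : ℤ) : ℤ) : ZMu e q) ≠ 0 := by
    rw [Int.cast_ne_zero]; omega
  exact h2 h1.symm

theorem deriv_y_ne_zero (hq : 0 < q) (h : IsLocalData e q a b X Y φ) : laurentDeriv _ Y ≠ 0 := by
  intro h0
  have h1 := laurentDeriv_coeff Y (-q - 1)
  rw [h0, sub_add_cancel, h.lead_y, mul_one, HahnSeries.coeff_zero] at h1
  have h2 : ((-(q : ℤ) : ℤ) : ZMu e q) ≠ 0 := by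
    rw [Int.cast_ne_zero]; omega
  exact h2 h1.symm

theorem phi_ne_zero (h : IsLocalData e q a b X Y φ) : φ ≠ 0 := by
  rintro rfl
  have := h.lead_phi
  rw [HahnSeries.coeff_zero] at this
  exact one_ne_zero (neg_eq_zero.mp this.symm)

theorem lau_curve (h : IsLocalData e q a b X Y φ) (i : Fin 2) :
    curveSum e q (fun k => lau e q i X ^ k) (fun l => lau e q i Y ^ l) = 0 := by
  have := congrArg (lau e q i) h.curve
  rw [map_curveSum _ (lau_algebraMap i), map_zero] at this
  simpa only [map_pow] using this

/-- The bracket has a simple pole with residue `1` along the diagonal. -/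
theorem exists_regular_part (he : 0 < e) (h : IsLocalData e q a b X Y φ) : ∃ r : Laurent2 e q,
    (lau e q 0 X - lau e q 1 X) * ((tVar e q 0 - tVar e q 1) * r + 1) =
      (tVar e q 0 - tVar e q 1) * (lau e q 0 φ * curveSum e q (fun k => lau e q 1 X ^ k)
        (divDiff (lau e q 0 Y) (lau e q 1 Y))) := by
  obtain ⟨dX, hX, hX'⟩ := exists_differenceQuotient X
  obtain ⟨dY, hY, hY'⟩ := exists_differenceQuotient Y
  set x := lau e q 0 X
  set y := lau e q 0 Y
  set z := lau e q 1 X with hz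
  set w := lau e q 1 Y
  set τ := tVar e q 0 - tVar e q 1 with hτ
  set G := curveSum e q (fun k => z ^ k) (divDiff y w) with hG
  set G' := curveSum e q (divDiff x z) (fun l => y ^ l) with hG'
  have h1 : (y - w) * G = curveSum e q (fun k => z ^ k) (fun l => y ^ l) := by
    rw [hG, ← curveSum_mul_right]
    simp only [sub_mul_divDiff]
    rw [curveSum_sub_right, h.lau_curve 1, sub_zero]
  have h2 : (x - z) * G' = -curveSum e q (fun k => z ^ k) (fun l => y ^ l) := by
    rw [hG', ← curveSum_mul_left]
    simp only [sub_mul_divDiff]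
    rw [curveSum_sub_left, h.lau_curve 0, zero_sub]
  -- Both `(y - w) G` and `-(x - z) G'` equal `f(z, y)`, by the equations of the curve at the two
  -- points; the factor `t₁ - t₂` is cancelled.
  have h3 : dY * G + dX * G' = 0 := by
    apply mul_left_cancel₀ (diff_tVar_ne_zero (e := e) (q := q))
    linear_combination G * hY + G' * hX + h1 + h2
  obtain ⟨α, β, hαβ⟩ : ∃ α β : Laurent2 e q, α * (x - z) + β * (y - w) = τ := by
    obtain ⟨u, v, hu, hv, huv⟩ := h.param
    have ht : ∀ i, ((Units.map (lau e q i).toMonoidHom u ^ (-a) *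
        Units.map (lau e q i).toMonoidHom v ^ b : (Laurent2 e q)ˣ) : Laurent2 e q) =
        tVar e q i := by
      intro i
      rw [← map_zpow, ← map_zpow, ← map_mul, huv]
      have := lau_single (e := e) (q := q) i 1
      rw [pow_one] at this
      exact this
    obtain ⟨α, β, hαβ⟩ := exists_zpow_mul_zpow_sub (Units.map (lau e q 0).toMonoidHom u)
      (Units.map (lau e q 0).toMonoidHom v) (Units.map (lau e q 1).toMonoidHom u)
      (Units.map (lau e q 1).toMonoidHom v) (-a) b
    rw [ht, ht] at hαβ
    refine ⟨α, β, ?_⟩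
    rw [hτ, ← hαβ]
    subst hu hv
    rfl
  have h4 : α * dX + β * dY = 1 := by
    apply mul_left_cancel₀ (diff_tVar_ne_zero (e := e) (q := q))
    linear_combination α * hX + β * hY + hαβ
  -- This is `t₁ - t₂` times the bracket: by the two preceding relations `G = dX (α G - β G')`, so
  -- the zeros of `x - z` other than the diagonal drop out.
  set C := lau e q 0 φ * (α * G - β * G') with hC
  have h5 : C * dX = lau e q 0 φ * G := by
    rw [hC]
    linear_combination lau e q 0 φ * G * h4 - lau e q 0 φ * β * h3
  -- On the diagonal `G` becomes `f_y` and `dX` becomes `x'`, so `C x' = φ f_y = x'`.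
  have h6 : diag e q C = 1 := by
    have h8 : diag e q G = curveSum e q (fun k => X ^ k) (fun l => l * Y ^ (l - 1)) := by
      rw [hG, map_curveSum _ diag_algebraMap_zMu]
      simp only [map_pow, map_divDiff, diag_lau, divDiff_self, hz, y, w]
    have h9 : diag e q C * laurentDeriv _ X = φ * diag e q G := by
      rw [← hX', ← map_mul, h5, map_mul, diag_lau]
    rw [h8, mul_comm φ, ← h.deriv_x] at h9
    exact mul_right_cancel₀ (h.deriv_x_ne_zero he) (h9.trans (one_mul _).symm)
  obtain ⟨r, hr⟩ := dvd_of_diag_eq_zero (C - 1) (by rw [map_sub, h6, map_one, sub_self])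
  refine ⟨r, ?_⟩
  linear_combination (-(x - z)) * hr - C * hX + τ * h5

end IsLocalData

/-! ### Regularity of the bracket in the first variable -/

/-- The ring `ℤ[μ][[t₁, t₂]][1 / t₂]`. -/
def regularRing (e q : ℕ) : Subring (Laurent2 e q) where
  carrier := {z | ∃ (M : ℕ) (F : PS2 e q), z * tVar e q 1 ^ M = algebraMap (PS2 e q) _ F}
  mul_mem' := by
    rintro z z' ⟨M, F, h⟩ ⟨M', F', h'⟩
    exact ⟨M + M', F * F', by rw [map_mul, ← h, ← h']; ring⟩
  add_mem' := by
    rintro z z' ⟨M, F, h⟩ ⟨M', F', h'⟩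
    refine ⟨M + M', F * MvPowerSeries.X 1 ^ M' + F' * MvPowerSeries.X 1 ^ M, ?_⟩
    rw [map_add, map_mul, map_mul, ← h, ← h', map_pow, map_pow]
    change _ = _ * tVar e q 1 ^ M' + _ * tVar e q 1 ^ M
    ring
  one_mem' := ⟨0, 1, by simp⟩
  zero_mem' := ⟨0, 0, by simp⟩
  neg_mem' := by
    rintro z ⟨M, F, h⟩
    exact ⟨M, -F, by rw [map_neg, ← h, neg_mul]⟩

theorem algebraMap_mem_regularRing (F : PS2 e q) :
    algebraMap (PS2 e q) _ F ∈ regularRing e q := ⟨0, F, by simp⟩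

theorem algebraMap_zMu_mem_regularRing (c : ZMu e q) :
    algebraMap (ZMu e q) _ c ∈ regularRing e q := by
  rw [IsScalarTower.algebraMap_apply (ZMu e q) (PS2 e q)]
  exact algebraMap_mem_regularRing _

theorem lau_one_mem_regularRing (h : LaurentSeries (ZMu e q)) :
    lau e q 1 h ∈ regularRing e q := by
  obtain ⟨N, p, hp⟩ := exists_powerSeries_mul h
  have h1 := congrArg (lau e q 1) hp
  rw [map_mul, lau_single, lau_ofPowerSeries] at h1
  exact ⟨N, _, h1⟩

/-- The multiples of `t₁` in `ℤ[μ][[t₁, t₂]][1 / t₂]`. -/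
def vanishing (e q : ℕ) : AddSubgroup (Laurent2 e q) :=
  (regularRing e q).toAddSubgroup.map (AddMonoidHom.mulLeft (tVar e q 0))

theorem mul_mem_vanishing {z z' : Laurent2 e q} (h : z ∈ vanishing e q)
    (h' : z' ∈ regularRing e q) : z * z' ∈ vanishing e q := by
  obtain ⟨s, hs, rfl⟩ := h
  exact ⟨s * z', (regularRing e q).mul_mem hs h', (mul_assoc _ _ _).symm⟩

theorem lau_zero_mem_vanishing {h : LaurentSeries (ZMu e q)} (hh : ∀ n < 1, h.coeff n = 0) :
    lau e q 0 h ∈ vanishing e q := by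
  refine ⟨_, algebraMap_mem_regularRing (psAt e q 0 (PowerSeries.mk fun n => h.coeff (1 + n))), ?_⟩
  rw [← lau_ofPowerSeries]
  conv_rhs => rw [eq_single_mul_ofPowerSeries 1 hh, map_mul]
  have := lau_single (e := e) (q := q) 0 1
  rw [Nat.cast_one, pow_one] at this
  rw [this]
  rfl

namespace IsLocalData

variable {a b : ℤ} {X Y φ : LaurentSeries (ZMu e q)}

theorem wt_single_mul (h : IsLocalData e q a b X Y φ) (i : ℕ) :
    LSHasWt (q * (e - 1 - i)) (HahnSeries.single (e + 1 : ℤ) 1 * φ * Y ^ i) :=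
  (((LSHasWt.single _).mul h.wt_phi).mul (h.wt_y.pow i)).congr (by ring)

/-- The weight of `t ^ (e + 1) φ y ^ i` is `q (e - 1 - i)`, and only exponents `i < l ≤ e - 1`
occur. -/
theorem lau_mul_divDiff_mem_vanishing (hq : 0 < q) (h : IsLocalData e q a b X Y φ) {l : ℕ}
    (hl : l < e) : lau e q 0 (HahnSeries.single (e + 1 : ℤ) 1 * φ) *
      divDiff (lau e q 0 Y) (lau e q 1 Y) l ∈ vanishing e q := by
  rw [divDiff, Finset.mul_sum]
  refine sum_mem fun i hi => ?_
  rw [Finset.mem_range] at hi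
  rw [← mul_assoc, ← map_pow, ← map_pow, ← map_mul]
  refine mul_mem_vanishing (lau_zero_mem_vanishing fun n hn => ?_) (lau_one_mem_regularRing _)
  apply (h.wt_single_mul i).coeff_eq_zero
  have h1 : (1 : ℤ) ≤ e - 1 - i := by omega
  have h2 : (1 : ℤ) ≤ q := by omega
  nlinarith

/-- At `t₁ = 0` only the term `y ^ (e - 1)` from the divided difference of `y ^ e` survives. There
`t ^ (e + 1) φ y ^ (e - 1)` has the value `-1`, and `t ^ e x` has the value `1`. This is why the
bracket behaves as `-1 / t₁`. -/
theorem bracket_numerator_mem_vanishing (he : 0 < e) (hq : 0 < q)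
    (h : IsLocalData e q a b X Y φ) :
    lau e q 0 (HahnSeries.single (e + 1 : ℤ) 1 * φ) *
        curveSum e q (fun k => lau e q 1 X ^ k) (divDiff (lau e q 0 Y) (lau e q 1 Y)) +
      lau e q 0 (HahnSeries.single (e : ℤ) 1 * X) ∈ vanishing e q := by
  set c := lau e q 0 (HahnSeries.single (e + 1 : ℤ) 1 * φ) with hc
  have hlead : c * divDiff (lau e q 0 Y) (lau e q 1 Y) e +
      lau e q 0 (HahnSeries.single (e : ℤ) 1 * X) ∈ vanishing e q := by
    obtain ⟨e', rfl⟩ : ∃ e', e = e' + 1 := ⟨e - 1, by omega⟩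
    have h1 : divDiff (lau _ q 0 Y) (lau _ q 1 Y) (e' + 1) =
        divDiff (lau _ q 0 Y) (lau _ q 1 Y) e' * lau _ q 1 Y + lau _ q 0 Y ^ e' := by
      rw [divDiff, divDiff, Finset.sum_range_succ, Finset.sum_mul, Nat.add_sub_cancel, Nat.sub_self,
        pow_zero, mul_one]
      congr 1
      refine Finset.sum_congr rfl fun i hi => ?_
      rw [Finset.mem_range] at hi
      rw [mul_assoc, ← pow_succ, show e' - 1 - i + 1 = e' - i by omega]
    rw [h1, mul_add, ← mul_assoc, add_assoc]
    refine add_mem (mul_mem_vanishing (h.lau_mul_divDiff_mem_vanishing hq (Nat.lt_succ_self e'))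
      (lau_one_mem_regularRing _)) ?_
    rw [hc, ← map_pow, ← map_mul, ← map_add]
    have h2 : LSHasWt 0 (HahnSeries.single (((e' + 1 : ℕ) : ℤ) + 1) 1 * φ * Y ^ e') :=
      (h.wt_single_mul e').congr (by push_cast; ring)
    have h3 : LSHasWt 0 (HahnSeries.single ((e' + 1 : ℕ) : ℤ) 1 * X) :=
      ((LSHasWt.single _).mul h.wt_x).congr (by ring)
    refine lau_zero_mem_vanishing fun n hn => ?_
    rcases (show n < 0 ∨ n = 0 by omega) with hn | rfl
    · exact (h2.add h3).coeff_eq_zero hn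
    have h4 := ((LSHasWt.single (((e' + 1 : ℕ) : ℤ) + 1)).mul h.wt_phi).coeff_mul (h.wt_y.pow e')
    have h5 := (LSHasWt.single (((e' + 1 : ℕ) : ℤ) + 1)).coeff_mul h.wt_phi
    have h6 := (LSHasWt.single ((e' + 1 : ℕ) : ℤ)).coeff_mul h.wt_x
    rw [h5, h.wt_y.coeff_pow, h.lead_phi, h.lead_y, HahnSeries.coeff_single_same] at h4
    rw [h.lead_x, HahnSeries.coeff_single_same, add_neg_cancel] at h6
    rw [show ((e' + 1 : ℕ) : ℤ) + 1 + (((e' + 1 : ℕ) : ℤ) * q - ((e' + 1 : ℕ) : ℤ) - q - 1) +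
      e' * -(q : ℤ) = 0 by push_cast; ring] at h4
    rw [HahnSeries.coeff_add, h4, h6]
    simp
  have h0 : divDiff (lau e q 0 Y) (lau e q 1 Y) 0 = 0 := by simp [divDiff]
  rw [curveSum, h0, mul_zero, sub_zero, pow_zero, one_mul, mul_add, add_right_comm]
  refine add_mem hlead ?_
  rw [Finset.mul_sum]
  refine sum_mem fun j hj => ?_
  rw [Finset.mul_sum]
  refine sum_mem fun k _ => ?_
  rw [Finset.mem_Icc] at hj
  rw [← map_pow, show ∀ u v w z : Laurent2 e q, u * (v * (w * z)) = u * z * (v * w) by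
    intros; ring]
  exact mul_mem_vanishing (h.lau_mul_divDiff_mem_vanishing hq (by omega))
    (mul_mem (algebraMap_zMu_mem_regularRing _) (lau_one_mem_regularRing _))

end IsLocalData

theorem not_X_dvd_X {i j : Fin 2} (hij : i ≠ j) :
    ¬ (MvPowerSeries.X i : PS2 e q) ∣ MvPowerSeries.X j := by
  rintro ⟨F, hF⟩
  have := congrArg (MvPowerSeries.coeff (Finsupp.single j 1)) hF
  rw [coeff_X_mul_eq_zero _ _ (by simp [hij])] at this
  simp [MvPowerSeries.coeff_X] at this

theorem not_X_dvd_psAt (i j : Fin 2) {p : PowerSeries (ZMu e q)} (hp : PowerSeries.coeff 0 p ≠ 0) :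
    ¬ (MvPowerSeries.X i : PS2 e q) ∣ psAt e q j p := by
  rintro ⟨F, hF⟩
  have := congrArg (MvPowerSeries.coeff 0) hF
  rw [coeff_X_mul_eq_zero _ _ (by simp), coeff_psAt, if_pos (by simp)] at this
  exact hp this

namespace IsLocalData

variable {a b : ℤ} {X Y φ : LaurentSeries (ZMu e q)}

/-- The regular part of the bracket has no pole along `t₁ = 0`, except for `-1 / t₁`. -/
theorem exists_pow_mul_eq (he : 0 < e) (hq : 0 < q) (h : IsLocalData e q a b X Y φ)
    {r : Laurent2 e q}
    (hr : (lau e q 0 X - lau e q 1 X) * ((tVar e q 0 - tVar e q 1) * r + 1) =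
      (tVar e q 0 - tVar e q 1) * (lau e q 0 φ * curveSum e q (fun k => lau e q 1 X ^ k)
        (divDiff (lau e q 0 Y) (lau e q 1 Y)))) {s : Laurent2 e q} (hs : s * tVar e q 0 = 1) :
    ∃ (M : ℕ) (F : PS2 e q), (r + s) * tVar e q 1 ^ M = algebraMap (PS2 e q) _ F := by
  obtain ⟨β, ⟨M, B, hB⟩, hβ⟩ := h.bracket_numerator_mem_vanishing he hq
  obtain ⟨N, F, hF⟩ := exists_mul_eq (r + s)
  have hse : ∀ i, lau e q i (HahnSeries.single (e : ℤ) 1) = tVar e q i ^ e := fun i => lau_single i e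
  have hse1 : lau e q 0 (HahnSeries.single (e + 1 : ℤ) 1) = tVar e q 0 ^ (e + 1) := by
    rw [← lau_single]; simp
  obtain ⟨u, hu⟩ : ∃ u : PowerSeries (ZMu e q),
      HahnSeries.single (e : ℤ) 1 * X = HahnSeries.ofPowerSeries ℤ _ u := by
    obtain ⟨u, -, hu⟩ := h.wt_x.exists_powerSeries
    refine ⟨u, ?_⟩
    rw [hu, ← mul_assoc, HahnSeries.single_mul_single]
    simp
  have hu0 : PowerSeries.coeff 0 u ≠ 0 := by
    have := (LSHasWt.single (e : ℤ)).coeff_mul h.wt_x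
    rw [h.lead_x, HahnSeries.coeff_single_same, add_neg_cancel, hu] at this
    rw [← HahnSeries.ofPowerSeries_apply_coeff (Γ := ℤ), Nat.cast_zero, this, one_mul]
    exact one_ne_zero
  have hui : ∀ i, tVar e q i ^ e * lau e q i X = algebraMap (PS2 e q) _ (psAt e q i u) :=
    fun i => by rw [← hse, ← map_mul, hu, lau_ofPowerSeries]
  have hu0' := hui 0
  have hu1' := hui 1
  change tVar e q 0 * β = _ at hβ
  rw [map_mul, map_mul, hse, hse1] at hβ
  -- With `u = t ^ e x`, `D` is `(t₁ t₂) ^ e (x - z) (t₁ - t₂)`, while `Γ` is `t₁ ^ e t₂ ^ (e + M)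
  -- (x - z) (t₁ - t₂) (r + s)`. The latter is a power series because the term `s = 1 / t₁`
  -- compensates the polar term of the bracket.
  set D : PS2 e q := (psAt e q 0 u * MvPowerSeries.X 1 ^ e -
    MvPowerSeries.X 0 ^ e * psAt e q 1 u) * (MvPowerSeries.X 0 - MvPowerSeries.X 1) with hD
  set Γ : PS2 e q := MvPowerSeries.X 1 ^ e * ((MvPowerSeries.X 0 - MvPowerSeries.X 1) * B -
    psAt e q 0 u * MvPowerSeries.X 1 ^ M) +
    MvPowerSeries.X 0 ^ (e - 1) * MvPowerSeries.X 1 ^ (M + 1) * psAt e q 1 u with hΓ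
  have hX : ∀ i, algebraMap (PS2 e q) (Laurent2 e q) (MvPowerSeries.X i) = tVar e q i :=
    fun _ => rfl
  have h1 : D * F * MvPowerSeries.X 1 ^ M =
      MvPowerSeries.X 0 ^ N * (Γ * MvPowerSeries.X 1 ^ N) := by
    apply algebraMap_laurent2_injective
    rw [hD, hΓ]
    simp only [map_mul, map_add, map_sub, map_pow, hX, ← hu0', ← hu1', ← hF, ← hB]
    obtain ⟨e', rfl⟩ : ∃ e', e = e' + 1 := ⟨e - 1, by omega⟩
    rw [Nat.add_sub_cancel]
    apply mul_left_cancel₀ (isUnit_tVar 0).ne_zero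
    set τ := tVar (e' + 1) q 0
    set ρ := tVar (e' + 1) q 1
    set x := lau (e' + 1) q 0 X
    set z := lau (e' + 1) q 1 X
    linear_combination (τ ^ (e' + 2) * ρ ^ (e' + 1) * ρ ^ M * (τ * ρ) ^ N) * hr +
      (τ ^ (e' + 1) * ρ ^ (e' + 1) * (x - z) * (τ - ρ) * ρ ^ M * (τ * ρ) ^ N) * hs
      - ((τ - ρ) * ρ ^ (e' + 1) * ρ ^ M * (τ * ρ) ^ N) * hβ
  have hp := prime_X (e := e) (q := q) 0
  have h01 : ¬ (MvPowerSeries.X 0 : PS2 e q) ∣ MvPowerSeries.X 1 := not_X_dvd_X (by decide)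
  -- At `t₁ = 0` the series `D` becomes `-u(0) t₂ ^ (e + 1)`, which is not zero. Hence all of `t₁ ^
  -- N` must divide `F`.
  have hD0 : ¬ MvPowerSeries.X 0 ∣ D := by
    intro hd
    rcases hp.dvd_or_dvd hd with hd | hd
    · rw [dvd_sub_left (dvd_mul_of_dvd_left (dvd_pow_self _ he.ne') _)] at hd
      rcases hp.dvd_or_dvd hd with hd | hd
      · exact not_X_dvd_psAt 0 0 hu0 hd
      · exact h01 (hp.dvd_of_dvd_pow hd)
    · exact h01 ((dvd_sub_right dvd_rfl).mp hd)
  have h2 : MvPowerSeries.X 0 ^ N ∣ F := by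
    refine hp.pow_dvd_of_dvd_mul_left N hD0 (hp.pow_dvd_of_dvd_mul_right N
      (fun hd => h01 (hp.dvd_of_dvd_pow hd)) ⟨_, h1⟩)
  obtain ⟨F', rfl⟩ := h2
  refine ⟨N, F', ?_⟩
  apply mul_left_cancel₀ (pow_ne_zero N (isUnit_tVar (e := e) (q := q) 0).ne_zero)
  rw [map_mul, map_pow, hX] at hF
  rw [← hF]
  ring

end IsLocalData

/-! ### Symmetric differentials -/

theorem coeff_psAt_mul_psAt (o h : PowerSeries (ZMu e q)) (n k : ℕ) :
    MvPowerSeries.coeff (Finsupp.single 0 n + Finsupp.single 1 k)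
      (psAt e q 0 o * psAt e q 1 h) = PowerSeries.coeff n o * PowerSeries.coeff k h := by
  classical
  rw [MvPowerSeries.coeff_mul, Finset.sum_eq_single (Finsupp.single 0 n, Finsupp.single 1 k)]
  · simp [coeff_psAt]
  · rintro ⟨m, m'⟩ hm hne
    rw [Finset.HasAntidiagonal.mem_antidiagonal] at hm
    by_contra h0
    have h1 := left_ne_zero_of_mul h0
    have h2 := right_ne_zero_of_mul h0
    rw [coeff_psAt] at h1 h2
    have h3 : m = Finsupp.single 0 (m 0) := by
      by_contra h; rw [if_neg h] at h1; exact h1 rfl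
    have h4 : m' = Finsupp.single 1 (m' 1) := by
      by_contra h; rw [if_neg h] at h2; exact h2 rfl
    apply hne
    dsimp only at hm
    rw [h3, h4] at hm ⊢
    have h5 := DFunLike.congr_fun hm 0
    have h6 := DFunLike.congr_fun hm 1
    simp at h5 h6
    simp [h5, h6]
  · intro h
    simp at h

/-- Multiplied by a power of the variable, this says that a derivative has no residue. -/
theorem coeff_X_mul_pderiv_sub (i : Fin 2) (F : PS2 e q) (n : Fin 2 →₀ ℕ) :
    MvPowerSeries.coeff n
      (MvPowerSeries.X i * MvPowerSeries.pderiv (ZMu e q) i F - (n i : PS2 e q) * F) = 0 := by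
  have h1 : (n i : PS2 e q) = MvPowerSeries.C (n i : ZMu e q) := by simp
  rw [map_sub, h1, MvPowerSeries.coeff_C_mul]
  rcases hn : n i with _ | k
  · rw [coeff_X_mul_eq_zero i n hn]
    simp
  · obtain ⟨m, rfl⟩ : ∃ m, n = Finsupp.single i 1 + m := by
      refine ⟨n - Finsupp.single i 1, (add_tsub_cancel_of_le ?_).symm⟩
      rw [Finsupp.single_le_iff]
      omega
    rw [coeff_X_mul, MvPowerSeries.coeff_pderiv, add_comm m]
    rw [Finsupp.add_apply, Finsupp.single_eq_same] at hn
    rw [show k = m i by omega]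
    push_cast
    ring

/-- A symmetric 2-form whose poles lie along `t₂ = 0` and which is the sum of a derivative and of
products of forms in `t₁` and forms in `t₂` is regular, and the residues of the latter satisfy
linear relations. -/
theorem exists_powerSeries_of_symmetric {ι : Type*} [Fintype ι] {R : Laurent2 e q} {M : ℕ}
    {F : PS2 e q} (hF : R * tVar e q 1 ^ M = algebraMap (PS2 e q) _ F) (hFw : PSHasWt (M - 1) F)
    (o : ι → PowerSeries (ZMu e q)) (η : ι → LaurentSeries (ZMu e q)) (w : ι → ℤ)
    (ho : ∀ i, LSHasWt (w i - 1) (HahnSeries.ofPowerSeries ℤ _ (o i)))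
    (hη : ∀ i, LSHasWt (-w i - 1) (η i)) {ξ : Frac2 e q}
    (hξ : ξ = dt2Hom e q (toFrac e q R) +
      ∑ i, laurentAt e q 0 (HahnSeries.ofPowerSeries ℤ _ (o i)) * laurentAt e q 1 (η i))
    (hsym : swapFrac e q ξ = ξ) :
    ∃ H : PS2 e q, PSHasWt (-2) H ∧ ξ = algebraMap (PS2 e q) _ H ∧
      ∀ n : ℕ, ∑ i, PowerSeries.coeff n (o i) * (η i).coeff (-1) = 0 := by
  classical
  choose N p hp using fun i => exists_powerSeries_mul (η i)
  -- One exponent that serves for all the poles along `t₂ = 0`: then `G = R t₂ ^ K` and `h i = t ^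
  -- (K + 1) η i` are power series.
  set K := M + ∑ i, N i with hK
  set G : PS2 e q := F * MvPowerSeries.X 1 ^ (∑ i, N i) with hG
  have hGw : PSHasWt (K - 1) G :=
    (hFw.mul ((PSHasWt.X 1).pow _)).congr (by rw [hK]; push_cast; ring)
  have hX : ∀ i, algebraMap (PS2 e q) (Laurent2 e q) (MvPowerSeries.X i) = tVar e q i :=
    fun _ => rfl
  have hRG : R * tVar e q 1 ^ K = algebraMap (PS2 e q) _ G := by
    rw [hG, map_mul, ← hF, map_pow, hX, hK]
    ring
  have hh : ∀ i, ∃ h : PowerSeries (ZMu e q),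
      η i * HahnSeries.single ((K + 1 : ℕ) : ℤ) 1 = HahnSeries.ofPowerSeries ℤ _ h := by
    intro i
    have h1 : N i ≤ ∑ i, N i := Finset.single_le_sum (fun _ _ => Nat.zero_le _) (Finset.mem_univ i)
    obtain ⟨d, hd⟩ : ∃ d, K + 1 = N i + d := ⟨K + 1 - N i, by omega⟩
    refine ⟨p i * PowerSeries.X ^ d, ?_⟩
    rw [map_mul, ← hp, ← single_natCast_eq, mul_assoc, HahnSeries.single_mul_single, hd]
    push_cast
    simp
  choose h hh using hh
  clear_value G K
  have how : ∀ i, PSHasWt (w i - 1) (o i) := fun i => psHasWt_of_lsHasWt (ho i)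
  have hhw : ∀ i, PSHasWt (K - w i) (h i) := fun i =>
    psHasWt_of_lsHasWt (hh i ▸ ((hη i).mul (LSHasWt.single ((K + 1 : ℕ) : ℤ))).congr
      (by push_cast; ring))
  -- The numerator of `ξ` over `t₂ ^ (K + 1)`, by the quotient rule for `G / t₂ ^ K`.
  set B : PS2 e q := MvPowerSeries.X 1 * MvPowerSeries.pderiv (ZMu e q) 1 G - (K : PS2 e q) * G +
    ∑ i, psAt e q 0 (o i) * psAt e q 1 (h i) with hB
  have hBw : PSHasWt (K - 1) B := by
    refine (((PSHasWt.X 1).mul (hGw.pderiv 1)).congr (by ring)).sub ?_ |>.add ?_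
    · have h1 : (K : PS2 e q) = MvPowerSeries.C ((K : ℤ) : ZMu e q) := by simp
      rw [h1]
      exact ((PSHasWt.C (HasWt.intCast K)).mul hGw).congr (by ring)
    · exact Finset.sum_induction _ _ (fun _ _ => PSHasWt.add) (PSHasWt.zero _) fun i _ =>
        (((how i).psAt 0).mul ((hhw i).psAt 1)).congr (by ring)
  have hξB : ξ * algebraMap (PS2 e q) _ (MvPowerSeries.X 1) ^ (K + 1) =
      algebraMap (PS2 e q) _ B := by
    have h1 := congrArg (toFrac e q) hRG
    rw [map_mul, map_pow, ← hX, toFrac_algebraMap, toFrac_algebraMap] at h1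
    have h2 := congrArg (dt2Hom e q) h1
    rw [isLeibniz_dt2Hom, ← map_pow, dt2Hom_algebraMap, dt2Hom_algebraMap, Derivation.leibniz_pow,
      MvPowerSeries.pderiv_X_self] at h2
    have h3 : ∀ i, laurentAt e q 1 (η i) * algebraMap (PS2 e q) _ (MvPowerSeries.X 1) ^ (K + 1) =
        algebraMap (PS2 e q) _ (psAt e q 1 (h i)) := by
      intro i
      rw [← laurentAt_ofPowerSeries, ← hh, map_mul, single_natCast_eq, laurentAt_ofPowerSeries,
        map_pow, psAt_X, map_pow]
    rw [hξ, hB, add_mul, Finset.sum_mul, map_add, map_sum]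
    congr 1
    · rw [map_sub, map_mul, map_mul, ← h1, ← h2]
      rcases K with _ | K
      · simp; ring
      · simp only [nsmul_eq_mul, smul_eq_mul, map_mul, map_pow, map_natCast, mul_one]
        rw [Nat.add_sub_cancel]
        ring
    · refine Finset.sum_congr rfl fun i _ => ?_
      rw [map_mul, mul_assoc, h3, laurentAt_ofPowerSeries]
  -- Symmetry of `ξ` in terms of `B`. As `t₂` is a prime that does not divide `t₁`, it forces `t₂ ^
  -- (K + 1)` to divide `B`.
  have hswap : MvPowerSeries.X 1 ^ (K + 1) * swapPS e q B = MvPowerSeries.X 0 ^ (K + 1) * B := by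
    have h1 := congrArg (swapFrac e q) hξB
    have h2 : swapPS e q (MvPowerSeries.X 1) = MvPowerSeries.X 0 := by
      rw [← psAt_X, swapPS_psAt, Equiv.swap_apply_right, psAt_X]
    rw [map_mul, hsym, map_pow, swapFrac_algebraMap, swapFrac_algebraMap, h2] at h1
    apply IsFractionRing.injective (PS2 e q) (Frac2 e q)
    rw [map_mul, map_mul, ← h1, ← hξB, map_pow, map_pow]
    ring
  obtain ⟨H, hH⟩ : MvPowerSeries.X 1 ^ (K + 1) ∣ B :=
    (prime_X 1).pow_dvd_of_dvd_mul_left _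
      (fun hd => not_X_dvd_X (by decide) ((prime_X 1).dvd_of_dvd_pow hd)) ⟨_, hswap.symm⟩
  have hX1 : (MvPowerSeries.X 1 ^ (K + 1) : PS2 e q) ≠ 0 := pow_ne_zero _ (prime_X 1).ne_zero
  refine ⟨H, ((PSHasWt.X 1).pow (K + 1)).of_mul hX1 (hH ▸ hBw.congr (by push_cast; ring)), ?_,
    fun n => ?_⟩
  · have h1 : algebraMap (PS2 e q) (Frac2 e q) (MvPowerSeries.X 1) ^ (K + 1) ≠ 0 := by
      rw [← map_pow, Ne, FaithfulSMul.algebraMap_eq_zero_iff]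
      exact hX1
    apply mul_right_cancel₀ h1
    rw [hξB, hH, map_mul, map_pow]
    ring
  -- The coefficient of `t₁ ^ n t₂ ^ K` in `B` vanishes. The derivative contributes nothing to it,
  -- and `h i` contributes the residue of `η i`.
  · have h1 := MvPowerSeries.X_pow_dvd_iff.mp ⟨H, hH⟩
      (Finsupp.single 0 n + Finsupp.single 1 K) (by simp)
    have h2 := coeff_X_mul_pderiv_sub 1 G (Finsupp.single 0 n + Finsupp.single 1 K)
    rw [show (Finsupp.single 0 n + Finsupp.single 1 K : Fin 2 →₀ ℕ) 1 = K by simp] at h2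
    rw [hB, map_add, h2, zero_add, map_sum] at h1
    rw [← h1]
    refine Finset.sum_congr rfl fun i _ => ?_
    rw [coeff_psAt_mul_psAt]
    congr 1
    have h3 := HahnSeries.coeff_mul_single_add (r := (1 : ZMu e q)) (x := η i) (a := -1)
      (b := ((K + 1 : ℕ) : ℤ))
    rw [hh, mul_one] at h3
    rw [← h3, ← HahnSeries.ofPowerSeries_apply_coeff (Γ := ℤ)]
    congr 1
    push_cast
    ring

/-- Power series with pairwise different orders are linearly independent. -/
theorem eq_zero_of_sum_mul_eq_zero {ι R : Type*} [Fintype ι] [CommRing R] {o : ι → PowerSeries R}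
    {w : ι → ℕ} (hw : Function.Injective w) (h0 : ∀ i, ∀ n < w i, PowerSeries.coeff n (o i) = 0)
    (h1 : ∀ i, PowerSeries.coeff (w i) (o i) = 1) {c : ι → R}
    (hc : ∀ n, ∑ i, PowerSeries.coeff n (o i) * c i = 0) (i : ι) : c i = 0 := by
  induction hn : w i using Nat.strong_induction_on generalizing i with
  | _ n ih =>
    subst hn
    -- In the coefficient at `w i`, the terms of smaller order are gone by induction and those of
    -- larger order do not appear yet.
    have h2 := hc (w i)
    rw [Finset.sum_eq_single i, h1, one_mul] at h2
    · exact h2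
    · intro j _ hj
      rcases lt_trichotomy (w j) (w i) with h | h | h
      · rw [ih _ h j rfl, mul_zero]
      · exact absurd (hw h) hj
      · rw [h0 j _ h, zero_mul]
    · simp

/-! ### The fundamental 2-form -/

theorem laurentAt_aeval (i : Fin 2) (X Y : LaurentSeries (ZMu e q))
    (p : MvPolynomial (Fin 2) (ZMu e q)) : laurentAt e q i (MvPolynomial.aeval ![X, Y] p) =
      MvPolynomial.aeval ![laurentAt e q i X, laurentAt e q i Y] p := by
  induction p using MvPolynomial.induction_on with
  | C c => rw [MvPolynomial.aeval_C, MvPolynomial.aeval_C, laurentAt_algebraMap]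
  | add p p' h h' => rw [map_add, map_add, map_add, h, h']
  | mul_X p j h =>
    rw [map_mul, map_mul, map_mul, h]
    fin_cases j <;> simp

/-! ### Orders of the holomorphic forms -/

section HolForm

variable {a b : ℤ} {X Y φ : LaurentSeries (ZMu e q)}

/-- The coefficient of `dt` in the holomorphic form with index `i`. -/
def holForm (X Y φ : LaurentSeries (ZMu e q)) (i : Fin (genus e q)) : LaurentSeries (ZMu e q) :=
  -(X ^ (holExp e q i).1 * Y ^ (holExp e q i).2 * φ)

theorem holExp_spec (he : 0 < e) (hq : 0 < q) (hcop : Nat.Coprime e q) (i : Fin (genus e q)) :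
    ((holExp e q i).1 * e + (holExp e q i).2 * q : ℤ) = e * q - e - q - gap e q i := by
  have h1 := nongapExp_spec he hq hcop (j := genus e q - 1 - i) (by omega)
  rw [gap_eq he hq hcop, holExp, ← h1]
  push_cast
  ring

theorem gap_pos (he : 0 < e) (hq : 0 < q) (hcop : Nat.Coprime e q) (i : Fin (genus e q)) :
    0 < gap e q i := by
  have h1 := holExp_spec he hq hcop i
  rw [Nat.pos_iff_ne_zero]
  intro h0
  rw [h0, Nat.cast_zero, sub_zero] at h1
  exact not_isNongap_both hq hcop (n := 0) (by push_cast; rw [add_zero]; exact h1)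
    ⟨_, _, rfl⟩ ⟨0, 0, by simp⟩

theorem gap_injective (he : 0 < e) (hq : 0 < q) (hcop : Nat.Coprime e q) :
    Function.Injective fun i : Fin (genus e q) => gap e q i := by
  intro i j hij
  have h1 := gap_eq he hq hcop i
  have h2 := gap_eq he hq hcop j
  have h3 : gap e q i = gap e q j := hij
  have h4 : nongap e q (genus e q - 1 - i) = nongap e q (genus e q - 1 - j) := by omega
  have h5 := (nongap_spec he hq hcop (j := genus e q - 1 - i) (by omega)).2.2
  have h6 := (nongap_spec he hq hcop (j := genus e q - 1 - j) (by omega)).2.2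
  rw [h4, h6] at h5
  exact Fin.ext (by omega)

namespace IsLocalData

theorem wt_holForm (he : 0 < e) (hq : 0 < q) (hcop : Nat.Coprime e q)
    (h : IsLocalData e q a b X Y φ) (i : Fin (genus e q)) :
    LSHasWt ((gap e q i : ℤ) - 1) (holForm X Y φ i) :=
  (((h.wt_x.pow _).mul (h.wt_y.pow _)).mul h.wt_phi).neg.congr
    (by linarith [holExp_spec he hq hcop i])

theorem lead_holForm (he : 0 < e) (hq : 0 < q) (hcop : Nat.Coprime e q)
    (h : IsLocalData e q a b X Y φ) (i : Fin (genus e q)) :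
    (holForm X Y φ i).coeff ((gap e q i : ℤ) - 1) = 1 := by
  have h1 := ((h.wt_x.pow (holExp e q i).1).mul (h.wt_y.pow (holExp e q i).2)).coeff_mul h.wt_phi
  rw [(h.wt_x.pow _).coeff_mul (h.wt_y.pow _), h.wt_x.coeff_pow, h.wt_y.coeff_pow, h.lead_x,
    h.lead_y, h.lead_phi] at h1
  rw [holForm, HahnSeries.coeff_neg, show ((gap e q i : ℤ) - 1) = (holExp e q i).1 * -(e : ℤ) +
    (holExp e q i).2 * -(q : ℤ) + (e * q - e - q - 1) by linarith [holExp_spec he hq hcop i], h1]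
  simp

theorem kernel_wt (h : IsLocalData e q a b X Y φ) :
    L2HasWt (-(e * q - q)) (curveSum e q (fun k => lau e q 1 X ^ k)
      (divDiff (lau e q 0 Y) (lau e q 1 Y))) :=
  L2HasWt.of_mem_biSpan (x := lau e q 0 X) (L2HasWt.lau h.wt_x 0) (L2HasWt.lau h.wt_y 0)
    (L2HasWt.lau h.wt_x 1) (L2HasWt.lau h.wt_y 1) kernel_mem_biSpan

end IsLocalData

end HolForm

/-! ### Symmetry and regularity of the 2-form -/

section Klein

variable {a b : ℤ} {φ : LaurentSeries (ZMu e q)}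

namespace IsLocalData

/-- The quotient by `f_y` in the field of fractions is replaced by a product with `φ`, an honest
Laurent series over `ℤ[μ]`. -/
theorem formAt_eq (he : 0 < e)
    (h : IsLocalData e q a b (xt e q a b) (yt e q a b) φ) (i : Fin 2) (p : MvPolynomial (Fin 2) (ZMu e q)) :
    formAt e q a b i p =
      laurentAt e q i (MvPolynomial.aeval ![xt e q a b, yt e q a b] p * φ) := by
  have h1 := h.deriv_x
  have h2 := h.deriv_x_ne_zero he
  rw [← aeval_pderiv_curvePoly he] at h1
  have h3 : laurentAt e q i (MvPolynomial.aeval ![xt e q a b, yt e q a b]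
      (MvPolynomial.pderiv 1 (curvePoly e q))) ≠ 0 := by
    rw [map_ne_zero_iff _ (laurentAt_injective i)]
    intro h0
    rw [h0, zero_mul] at h1
    exact h2 h1
  unfold formAt evalAt
  rw [div_eq_iff h3, ← laurentDeriv_apply, h1, ← map_mul, ← map_mul]
  congr 1
  ring

theorem omega_eq (he : 0 < e) (h : IsLocalData e q a b (xt e q a b) (yt e q a b) φ)
    (i : Fin (genus e q)) (j : Fin 2) :
    omega e q a b (genus e q - 1 - (i : ℕ)) j =
      laurentAt e q j (holForm (xt e q a b) (yt e q a b) φ i) := by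
  rw [omega, h.formAt_eq he, holForm, map_neg]
  simp [holExp]

theorem laurentAt_x_sub_ne_zero (he : 0 < e)
    (h : IsLocalData e q a b (xt e q a b) (yt e q a b) φ) :
    laurentAt e q 0 (xt e q a b) - laurentAt e q 1 (xt e q a b) ≠ 0 := by
  rw [← toFrac_lau, ← toFrac_lau, ← map_sub, map_ne_zero_iff _ toFrac_injective]
  exact lau_zero_ne_lau_one (h.deriv_x_ne_zero he)

theorem laurentAt_y_sub_ne_zero (hq : 0 < q)
    (h : IsLocalData e q a b (xt e q a b) (yt e q a b) φ) :
    laurentAt e q 0 (yt e q a b) - laurentAt e q 1 (yt e q a b) ≠ 0 := by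
  rw [← toFrac_lau, ← toFrac_lau, ← map_sub, map_ne_zero_iff _ toFrac_injective]
  exact lau_zero_ne_lau_one (h.deriv_y_ne_zero hq)

theorem laurentAt_curve (h : IsLocalData e q a b (xt e q a b) (yt e q a b) φ)
    (i : Fin 2) :
    curveSum e q (fun k => laurentAt e q i (xt e q a b) ^ k)
      (fun l => laurentAt e q i (yt e q a b) ^ l) = 0 := by
  have := congrArg (laurentAt e q i) h.curve
  rw [map_curveSum _ (laurentAt_algebraMap i), map_zero] at this
  simpa only [map_pow] using this

theorem bracket_eq (he : 0 < e) (hq : 0 < q)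
    (h : IsLocalData e q a b (xt e q a b) (yt e q a b) φ) : bracket e q a b =
    laurentAt e q 0 φ *
      (1 / (laurentAt e q 0 (xt e q a b) - laurentAt e q 1 (xt e q a b))) *
      curveSum e q (fun k => laurentAt e q 1 (xt e q a b) ^ k)
        (divDiff (laurentAt e q 0 (yt e q a b)) (laurentAt e q 1 (yt e q a b))) := by
  have h1 : omega e q a b 0 0 = -laurentAt e q 0 φ := by
    rw [omega, h.formAt_eq he, nongapExp_zero he hq]
    simp
  rw [bracket, h1, neg_neg]
  congr 1
  change _ / (laurentAt e q 0 (yt e q a b) - laurentAt e q 1 (yt e q a b)) = _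
  rw [div_eq_iff (h.laurentAt_y_sub_ne_zero hq), aeval_curvePoly he, aeval_curvePoly he,
    ← curveSum_sub_right, mul_comm, ← curveSum_mul_right]
  simp only [sub_mul_divDiff]
  rfl

theorem dt2_bracket (he : 0 < e) (hq : 0 < q)
    (h : IsLocalData e q a b (xt e q a b) (yt e q a b) φ) :
    dt2Hom e q (bracket e q a b) = laurentAt e q 0 φ * laurentAt e q 1 φ *
      (curveSum e q (fun k => laurentAt e q 1 (xt e q a b) ^ k)
          (divDiff (laurentAt e q 0 (yt e q a b)) (laurentAt e q 1 (yt e q a b))) *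
        curveSum e q (fun k => laurentAt e q 0 (xt e q a b) ^ k)
          (divDiff (laurentAt e q 0 (yt e q a b)) (laurentAt e q 1 (yt e q a b))) /
        (laurentAt e q 0 (xt e q a b) - laurentAt e q 1 (xt e q a b)) ^ 2 +
        correction e q (laurentAt e q 0 (xt e q a b)) (laurentAt e q 0 (yt e q a b))
          (laurentAt e q 1 (xt e q a b)) (laurentAt e q 1 (yt e q a b))) := by
  rw [h.bracket_eq he hq]
  refine deriv_bracket isLeibniz_dt2Hom dt2Hom_algebraMap_zMu (dt2Hom_laurentAt_zero _)
    (dt2Hom_laurentAt_zero _) (dt2Hom_laurentAt_zero _) ?_ ?_ (h.laurentAt_curve 0)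
    (h.laurentAt_curve 1) (h.laurentAt_x_sub_ne_zero he) (h.laurentAt_y_sub_ne_zero hq)
  · rw [dt2Hom_laurentAt_one, h.deriv_x, map_mul, map_curveSum _ (laurentAt_algebraMap 1)]
    simp only [map_pow, map_mul, map_natCast]
  · rw [dt2Hom_laurentAt_one, h.deriv_y, map_neg, map_mul, map_curveSum _ (laurentAt_algebraMap 1)]
    simp only [map_pow, map_mul, map_natCast]

/-- The 2-form `ξ` is the sum of a symmetric function and of a polynomial in the coordinates of the
two points, times `dx / f_y` at both points. -/
theorem xi_eq (he : 0 < e) (hq : 0 < q)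
    (h : IsLocalData e q a b (xt e q a b) (yt e q a b) φ)
    (p : Fin (genus e q) → MvPolynomial (Fin 2) (ZMu e q)) :
    xi e q a b (fun i => -(MvPolynomial.aeval ![xt e q a b, yt e q a b] (p i) * φ)) =
      laurentAt e q 0 φ * laurentAt e q 1 φ *
      (curveSum e q (fun k => laurentAt e q 1 (xt e q a b) ^ k)
          (divDiff (laurentAt e q 0 (yt e q a b)) (laurentAt e q 1 (yt e q a b))) *
        curveSum e q (fun k => laurentAt e q 0 (xt e q a b) ^ k)
          (divDiff (laurentAt e q 0 (yt e q a b)) (laurentAt e q 1 (yt e q a b))) /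
        (laurentAt e q 0 (xt e q a b) - laurentAt e q 1 (xt e q a b)) ^ 2 +
        (correction e q (laurentAt e q 0 (xt e q a b)) (laurentAt e q 0 (yt e q a b))
          (laurentAt e q 1 (xt e q a b)) (laurentAt e q 1 (yt e q a b)) +
        ∑ i, laurentAt e q 0 (xt e q a b) ^ (holExp e q i).1 *
          laurentAt e q 0 (yt e q a b) ^ (holExp e q i).2 *
          MvPolynomial.aeval ![laurentAt e q 1 (xt e q a b), laurentAt e q 1 (yt e q a b)]
            (p i))) := by
  have h1 : ∑ i : Fin (genus e q), omega e q a b (genus e q - 1 - (i : ℕ)) 0 *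
      laurentAt e q 1 (-(MvPolynomial.aeval ![xt e q a b, yt e q a b] (p i) * φ)) =
      laurentAt e q 0 φ * laurentAt e q 1 φ *
        ∑ i, laurentAt e q 0 (xt e q a b) ^ (holExp e q i).1 *
          laurentAt e q 0 (yt e q a b) ^ (holExp e q i).2 *
          MvPolynomial.aeval ![laurentAt e q 1 (xt e q a b), laurentAt e q 1 (yt e q a b)]
            (p i) := by
    rw [Finset.mul_sum]
    refine Finset.sum_congr rfl fun i _ => ?_
    rw [h.omega_eq he, holForm]
    simp only [map_neg, map_mul, map_pow, laurentAt_aeval]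
    ring
  rw [xi, h1]
  change dt2Hom e q _ + _ = _
  rw [h.dt2_bracket he hq]
  ring

/-- The bracket is `1 / (t₁ - t₂) - 1 / t₁`, up to a homogeneous Laurent series in `t₂` whose
coefficients are power series in `t₁`. -/
theorem exists_bracket_eq (he : 0 < e) (hq : 0 < q)
    (h : IsLocalData e q a b (xt e q a b) (yt e q a b) φ) :
    ∃ (R : Laurent2 e q) (M : ℕ) (F : PS2 e q),
    R * tVar e q 1 ^ M = algebraMap (PS2 e q) _ F ∧ PSHasWt (M - 1) F ∧
    dt2Hom e q (bracket e q a b) = dt2Hom e q (toFrac e q R) +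
      1 / algebraMap (PS2 e q) (Frac2 e q) (MvPowerSeries.X 1 - MvPowerSeries.X 0) ^ 2 := by
  obtain ⟨r, hr⟩ := h.exists_regular_part he
  set s := lau e q 0 (HahnSeries.single (-1) 1) with hs
  have hs1 : s * tVar e q 0 = 1 := by
    have := lau_single (e := e) (q := q) 0 1
    rw [Nat.cast_one, pow_one] at this
    rw [hs, ← this, ← map_mul]
    simp
  obtain ⟨M, F, hF⟩ := h.exists_pow_mul_eq he hq hr hs1
  -- Here `s = 1 / t₁` removes the pole of `r` along `t₁ = 0`. The weight of `F` is found by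
  -- multiplication with `(x - z) t₁ (t₁ - t₂)`, since the equation for `r` evaluates that product.
  refine ⟨r + s, M, F, hF, ?_, ?_⟩
  · have hx : L2HasWt (-e) (lau e q 0 (xt e q a b) - lau e q 1 (xt e q a b)) :=
      (L2HasWt.lau h.wt_x 0).sub (L2HasWt.lau h.wt_x 1)
    have ht : L2HasWt 1 (tVar e q 0 - tVar e q 1) := (L2HasWt.tVar 0).sub (L2HasWt.tVar 1)
    have hd := (hx.mul (L2HasWt.tVar 0)).mul ht
    refine hd.psHasWt_of_mul (mul_ne_zero (mul_ne_zero
      (lau_zero_ne_lau_one (h.deriv_x_ne_zero he)) (isUnit_tVar 0).ne_zero) diff_tVar_ne_zero) ?_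
    have h1 := ((((ht.mul ((L2HasWt.lau h.wt_phi 0).mul h.kernel_wt)).mul
      (L2HasWt.tVar 0)).congr (w' := 1 - e) (by ring)).sub ((hx.mul (L2HasWt.tVar 1)).congr
        (by ring))).mul ((L2HasWt.tVar 1).pow M)
    rw [← hr] at h1
    have h2 : (lau e q 0 (xt e q a b) - lau e q 1 (xt e q a b)) * tVar e q 0 *
        (tVar e q 0 - tVar e q 1) * algebraMap (PS2 e q) _ F =
        ((lau e q 0 (xt e q a b) - lau e q 1 (xt e q a b)) *
          ((tVar e q 0 - tVar e q 1) * r + 1) * tVar e q 0 -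
          (lau e q 0 (xt e q a b) - lau e q 1 (xt e q a b)) * tVar e q 1) * tVar e q 1 ^ M := by
      rw [← hF]
      linear_combination (lau e q 0 (xt e q a b) - lau e q 1 (xt e q a b)) *
        (tVar e q 0 - tVar e q 1) * tVar e q 1 ^ M * hs1
    rw [h2]
    exact h1.congr (by ring)
  · have h1 := congrArg (toFrac e q) hr
    simp only [map_mul, map_sub, map_add, map_one, toFrac_lau,
      map_curveSum _ toFrac_algebraMap_zMu, map_pow, map_divDiff] at h1
    set τ : Frac2 e q := toFrac e q (tVar e q 0) - toFrac e q (tVar e q 1) with hτ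
    have hτ' : τ = algebraMap (PS2 e q) (Frac2 e q) (MvPowerSeries.X 0 - MvPowerSeries.X 1) := by
      rw [hτ, tVar, tVar, toFrac_algebraMap, toFrac_algebraMap, map_sub]
    have hτ0 : τ ≠ 0 := by
      rw [hτ, ← map_sub, map_ne_zero_iff _ toFrac_injective]
      exact diff_tVar_ne_zero
    have hx := h.laurentAt_x_sub_ne_zero he
    have h2 : bracket e q a b = toFrac e q r + 1 / τ := by
      rw [h.bracket_eq he hq]
      field_simp
      linear_combination -h1
    have h3 : dt2Hom e q τ = -1 := by
      rw [hτ', dt2Hom_algebraMap, map_sub, MvPowerSeries.pderiv_X_self,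
        MvPowerSeries.pderiv_X_of_ne (by decide), zero_sub, map_neg, map_one]
    -- The summand `1 / t₁` does not depend on `t₂`, so it may be added without changing the
    -- derivative.
    have h4 : dt2Hom e q (toFrac e q s) = 0 := by
      rw [hs, toFrac_lau, dt2Hom_laurentAt_zero]
    rw [h2, map_add, map_add, map_add, h4, add_zero, leibniz_div isLeibniz_dt2Hom _ _ hτ0, h3,
      isLeibniz_dt2Hom.map_one]
    congr 1
    rw [← neg_sub (MvPowerSeries.X 0), map_neg, ← hτ', neg_sq]
    simp

/-- Symmetry of the polynomial part is the only input beyond weights: pole orders follow from the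
weights, while regularity of the remainder and vanishing of the residues follow from symmetry. -/
theorem isKleinFamily_of_symmetric (he : 0 < e) (hq : 0 < q) (hcop : Nat.Coprime e q)
    (h : IsLocalData e q a b (xt e q a b) (yt e q a b) φ)
    {p : Fin (genus e q) → MvPolynomial (Fin 2) (ZMu e q)}
    (hp : ∀ i, LSHasWt ((holExp e q i).1 * e + (holExp e q i).2 * q - 2 * (e * q - e - q))
      (MvPolynomial.aeval ![xt e q a b, yt e q a b] (p i)))
    (hsym : swapFrac e q
        (correction e q (laurentAt e q 0 (xt e q a b)) (laurentAt e q 0 (yt e q a b))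
          (laurentAt e q 1 (xt e q a b)) (laurentAt e q 1 (yt e q a b)) +
        ∑ i, laurentAt e q 0 (xt e q a b) ^ (holExp e q i).1 *
          laurentAt e q 0 (yt e q a b) ^ (holExp e q i).2 *
          MvPolynomial.aeval ![laurentAt e q 1 (xt e q a b), laurentAt e q 1 (yt e q a b)]
            (p i)) =
        correction e q (laurentAt e q 0 (xt e q a b)) (laurentAt e q 0 (yt e q a b))
          (laurentAt e q 1 (xt e q a b)) (laurentAt e q 1 (yt e q a b)) +
        ∑ i, laurentAt e q 0 (xt e q a b) ^ (holExp e q i).1 *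
          laurentAt e q 0 (yt e q a b) ^ (holExp e q i).2 *
          MvPolynomial.aeval ![laurentAt e q 1 (xt e q a b), laurentAt e q 1 (yt e q a b)]
            (p i)) :
    IsKleinFamily e q a b
      (fun i => -(MvPolynomial.aeval ![xt e q a b, yt e q a b] (p i) * φ)) := by
  set η : Fin (genus e q) → LaurentSeries (ZMu e q) :=
    fun i => -(MvPolynomial.aeval ![xt e q a b, yt e q a b] (p i) * φ) with hη
  have hwt : ∀ i : Fin (genus e q), LSHasWt (-(gap e q i : ℤ) - 1) (η i) := fun i =>
    ((hp i).mul h.wt_phi).neg.congr (by linarith [holExp_spec he hq hcop i])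
  have hξsym : swapFrac e q (xi e q a b η) = xi e q a b η := by
    have hG : ∀ i j : Fin 2, i ≠ j → swapFrac e q
        (curveSum e q (fun k => laurentAt e q i (xt e q a b) ^ k)
          (divDiff (laurentAt e q 0 (yt e q a b)) (laurentAt e q 1 (yt e q a b)))) =
        curveSum e q (fun k => laurentAt e q j (xt e q a b) ^ k)
          (divDiff (laurentAt e q 0 (yt e q a b)) (laurentAt e q 1 (yt e q a b))) := by
      intro i j hij
      have := map_curveSum (e := e) (q := q) (swapFrac e q).toRingHom swapFrac_algebraMap_zMu
        (fun k => laurentAt e q i (xt e q a b) ^ k)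
          (divDiff (laurentAt e q 0 (yt e q a b)) (laurentAt e q 1 (yt e q a b)))
      refine this.trans ?_
      have h2 : ∀ k i, (swapFrac e q).toRingHom (laurentAt e q i k) =
        laurentAt e q (Equiv.swap 0 1 i) k := fun k i => swapFrac_laurentAt i k
      simp only [map_pow, map_divDiff, h2]
      congr 1
      · fin_cases i <;> fin_cases j <;> simp_all
      · funext l
        rw [Equiv.swap_apply_left, Equiv.swap_apply_right, divDiff_comm]
    rw [hη, h.xi_eq he hq, map_mul, map_mul, map_add, hsym, map_div₀, map_mul, hG 1 0 (by decide),
      hG 0 1 (by decide), map_pow, map_sub, swapFrac_laurentAt, swapFrac_laurentAt,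
      swapFrac_laurentAt, swapFrac_laurentAt, Equiv.swap_apply_left, Equiv.swap_apply_right]
    congr 1
    · exact mul_comm _ _
    · congr 2
      · exact mul_comm _ _
      · rw [← neg_sub, neg_sq]
  obtain ⟨R, M, F, hF, hFw, hR⟩ := h.exists_bracket_eq he hq
  have ho : ∀ i, ∃ o : PowerSeries (ZMu e q), holForm (xt e q a b) (yt e q a b) φ i =
      HahnSeries.ofPowerSeries ℤ _ o := by
    intro i
    obtain ⟨o, -, ho⟩ := (h.wt_holForm he hq hcop i).exists_powerSeries
    obtain ⟨k, hk⟩ := Nat.exists_eq_add_of_lt (gap_pos he hq hcop i)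
    refine ⟨PowerSeries.X ^ k * o, ?_⟩
    rw [ho, map_mul, ← single_natCast_eq, show (gap e q i : ℤ) - 1 = k by omega]
  choose o ho using ho
  have how : ∀ i : Fin (genus e q), LSHasWt ((gap e q i : ℤ) - 1) (HahnSeries.ofPowerSeries ℤ _ (o i)) :=
    fun i => ho i ▸ h.wt_holForm he hq hcop i
  set τ := algebraMap (PS2 e q) (Frac2 e q) (MvPowerSeries.X 1 - MvPowerSeries.X 0) with hτ
  have hτsym : swapFrac e q (1 / τ ^ 2) = 1 / τ ^ 2 := by
    have h1 : swapFrac e q τ = -τ := by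
      rw [hτ, swapFrac_algebraMap, map_sub, ← psAt_X, ← psAt_X, swapPS_psAt, swapPS_psAt,
        Equiv.swap_apply_left, Equiv.swap_apply_right, ← map_neg, neg_sub]
    rw [map_div₀, map_pow, map_one, h1, neg_sq]
  -- After the removal of the double pole, which is itself symmetric, the remaining form has poles
  -- only along `t₂ = 0`.
  obtain ⟨H, hH, hξH, hres⟩ := exists_powerSeries_of_symmetric hF hFw o η (fun i => gap e q i) how
    hwt (ξ := xi e q a b η - 1 / τ ^ 2) (by
      rw [xi]
      change dt2Hom e q _ + _ - _ = _
      simp only [hR, ← ho, h.omega_eq he]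
      ring) (by rw [map_sub, hξsym, hτsym])
  have hres0 : ∀ i, (η i).coeff (-1) = 0 := by
    refine eq_zero_of_sum_mul_eq_zero (w := fun i : Fin (genus e q) => gap e q i - 1) (fun i j hij => ?_)
      (fun i n hn => ?_) (fun i => ?_) hres
    · have h1 := gap_pos he hq hcop i
      have h2 := gap_pos he hq hcop j
      dsimp only at hij
      exact gap_injective he hq hcop (show gap e q i = gap e q j by omega)
    · rw [← HahnSeries.ofPowerSeries_apply_coeff (Γ := ℤ)]
      exact (how i).coeff_eq_zero (by omega)
    · have h1 := h.lead_holForm he hq hcop i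
      rw [← HahnSeries.ofPowerSeries_apply_coeff (Γ := ℤ), ← ho, ← h1, Nat.cast_sub
        (gap_pos he hq hcop i), Nat.cast_one]
  refine ⟨fun i => ⟨⟨-p i, fun j => ?_⟩, hres0 i⟩, fun i n hn => (hwt i).coeff_eq_zero hn,
    fun i n => (hwt i n).congr (by ring), ⟨H, ?_, fun n => (hH n).congr ?_⟩, hξsym⟩
  · rw [h.formAt_eq he, map_neg (MvPolynomial.aeval _), map_mul, map_neg, map_neg,
      map_mul, neg_mul]
  · rw [← hξH]
    ring
  · rw [Finsupp.degree_eq_sum, Fin.sum_univ_two]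
    push_cast
    ring

end IsLocalData

end Klein

/-- There are nonzero coefficients of every nonpositive weight. -/
theorem exists_hasWt_neg (he : 0 < e) (hq : 0 < q) (hcop : Nat.Coprime e q) (n : ℕ) :
    ∃ c : ZMu e q, c ≠ 0 ∧ HasWt e q (-n) c := by
  -- The indeterminate `μ_1` exists because `1 = j q - e k` is solvable in the required range; its
  -- powers then have all nonpositive weights. The remainder `j = 0` can occur only for `e = 1`,
  -- where `j = 1`, `k = q - 1` is used instead.
  have h1 : ∃ j k : ℕ, 1 ≤ j ∧ j ≤ e ∧ 1 + e * k = j * q := by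
    obtain ⟨j, i, hj, hi⟩ := exists_eq_add he hcop 1
    rcases Nat.eq_zero_or_pos j with rfl | hj0
    · have h2 : e = 1 := by
        have : (e : ℤ) ∣ 1 := ⟨i, by rw [hi]; push_cast; ring⟩
        exact Nat.dvd_one.mp (by exact_mod_cast this)
      exact ⟨1, q - 1, le_rfl, he, by rw [h2]; omega⟩
    · have hi0 : i ≤ 0 := by
        by_contra h
        have h3 : 1 ≤ i := by omega
        have h4 : (1 : ℤ) ≤ j * q := by exact_mod_cast Nat.mul_pos hj0 hq
        have h5 : (1 : ℤ) ≤ e := by omega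
        nlinarith
      refine ⟨j, i.natAbs, hj0, hj.le, ?_⟩
      zify
      rw [abs_of_nonpos hi0]
      linarith
  refine ⟨MvPolynomial.X ⟨1, one_pos, h1⟩ ^ n, pow_ne_zero _ (MvPolynomial.X_ne_zero _), ?_⟩
  have h2 := (MvPolynomial.isWeightedHomogeneous_X ℤ (muWeight e q)
    (⟨1, one_pos, h1⟩ : CoeffIndex e q)).pow n
  refine HasWt.congr h2 ?_
  simp [muWeight]

/-- Adding a multiple of `ω_{w_i}` to `η_{-w_i}` preserves the weight and symmetry conditions. -/
theorem symmetric_add_single {A : Type*} [CommRing A] [Algebra (ZMu e q) A] {σ : A →+* A}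
    (hσ : ∀ c, σ (algebraMap (ZMu e q) A c) = algebraMap (ZMu e q) A c) {x y z w r : A}
    (hx : σ x = z) (hy : σ y = w) (hz : σ z = x) (hw : σ w = y)
    {p : Fin (genus e q) → MvPolynomial (Fin 2) (ZMu e q)}
    (hp : σ (r + ∑ i, x ^ (holExp e q i).1 * y ^ (holExp e q i).2 *
      MvPolynomial.aeval ![z, w] (p i)) = r + ∑ i, x ^ (holExp e q i).1 * y ^ (holExp e q i).2 *
      MvPolynomial.aeval ![z, w] (p i)) (i : Fin (genus e q)) (c : ZMu e q) :
    σ (r + ∑ j, x ^ (holExp e q j).1 * y ^ (holExp e q j).2 *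
      MvPolynomial.aeval ![z, w] ((p + Pi.single i (MvPolynomial.C c *
        MvPolynomial.X 0 ^ (holExp e q i).1 * MvPolynomial.X 1 ^ (holExp e q i).2) :
          Fin (genus e q) → MvPolynomial (Fin 2) (ZMu e q)) j)) =
      r + ∑ j, x ^ (holExp e q j).1 * y ^ (holExp e q j).2 *
      MvPolynomial.aeval ![z, w] ((p + Pi.single i (MvPolynomial.C c *
        MvPolynomial.X 0 ^ (holExp e q i).1 * MvPolynomial.X 1 ^ (holExp e q i).2) :
          Fin (genus e q) → MvPolynomial (Fin 2) (ZMu e q)) j) := by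
  have h1 : ∑ j, x ^ (holExp e q j).1 * y ^ (holExp e q j).2 *
      MvPolynomial.aeval ![z, w] ((p + Pi.single i (MvPolynomial.C c *
        MvPolynomial.X 0 ^ (holExp e q i).1 * MvPolynomial.X 1 ^ (holExp e q i).2) :
          Fin (genus e q) → MvPolynomial (Fin 2) (ZMu e q)) j) =
      ∑ j, x ^ (holExp e q j).1 * y ^ (holExp e q j).2 * MvPolynomial.aeval ![z, w] (p j) +
        x ^ (holExp e q i).1 * y ^ (holExp e q i).2 * (algebraMap (ZMu e q) A c *
          z ^ (holExp e q i).1 * w ^ (holExp e q i).2) := by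
    simp only [Pi.add_apply, map_add, mul_add, Finset.sum_add_distrib]
    congr 1
    rw [Finset.sum_eq_single i]
    · rw [Pi.single_eq_same]
      simp
    · intro j _ hj
      rw [Pi.single_eq_of_ne hj, map_zero, mul_zero]
    · simp
  rw [h1, ← add_assoc, map_add, hp]
  simp only [map_mul, map_pow, hσ, hx, hy, hz, hw]
  ring

end PlaneMiura

end

/-! ### Existence and non-uniqueness of the forms -/

theorem proposition3p2 (e q : ℕ) (he : 0 < e) (heq : e < q) (hcop : Nat.Coprime e q)
    (a b : ℤ) (hab : PlaneMiura.IsArithmeticPair e q a b) :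
    (∃ η : Fin (PlaneMiura.genus e q) → LaurentSeries (PlaneMiura.ZMu e q),
      PlaneMiura.IsKleinFamily e q a b η) ∧
    ∀ i : Fin (PlaneMiura.genus e q),
      ∃ η η' : Fin (PlaneMiura.genus e q) → LaurentSeries (PlaneMiura.ZMu e q),
        PlaneMiura.IsKleinFamily e q a b η ∧ PlaneMiura.IsKleinFamily e q a b η' ∧
          η i ≠ η' i := by
  open PlaneMiura in
  classical
  have hq : 0 < q := he.trans heq
  obtain ⟨φ, hL⟩ : ∃ φ, IsLocalData e q a b (xt e q a b) (yt e q a b) φ :=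
    (isExpansion_expansion e q a b he heq hab.bezout).exists_isLocalData he heq hab.bezout
  have hswap : ∀ h i, (swapFrac e q).toRingHom (laurentAt e q i h) =
    laurentAt e q (Equiv.swap 0 1 i) h := fun h i => swapFrac_laurentAt i h
  obtain ⟨p, hp, hsym⟩ := exists_symmetric he hq hcop (swapFrac e q).toRingHom
    swapFrac_algebraMap_zMu (hswap (xt e q a b) 0) (hswap (yt e q a b) 0)
    (hswap (xt e q a b) 1) (hswap (yt e q a b) 1) correction_mem_biSpan
  have hwt := fun i => hp i (xt e q a b) (yt e q a b) hL.wt_x hL.wt_y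
  have hη := hL.isKleinFamily_of_symmetric he hq hcop hwt hsym
  refine ⟨⟨_, hη⟩, fun i => ?_⟩
  -- The weights of `ω_{w_i}` and `η_{-w_i}` are `w_i` and `-w_i`, so a multiplier of weight `-2
  -- w_i` is required.
  obtain ⟨c, hc0, hc⟩ := exists_hasWt_neg he hq hcop (2 * gap e q i)
  have hsym' := symmetric_add_single swapFrac_algebraMap_zMu (hswap (xt e q a b) 0)
    (hswap (yt e q a b) 0) (hswap (xt e q a b) 1) (hswap (yt e q a b) 1) hsym i c
  refine ⟨_, _, hη, hL.isKleinFamily_of_symmetric he hq hcop (fun j => ?_) hsym', ?_⟩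
  · rw [Pi.add_apply, map_add]
    refine (hwt j).add ?_
    by_cases hj : j = i
    · subst hj
      rw [Pi.single_eq_same]
      simp only [map_mul, map_pow, MvPolynomial.aeval_C, MvPolynomial.aeval_X]
      refine (((LSHasWt.of_algebraMap hc).mul (hL.wt_x.pow _)).mul (hL.wt_y.pow _)).congr ?_
      have := holExp_spec he hq hcop j
      push_cast
      linarith
    · rw [Pi.single_eq_of_ne hj, map_zero]
      exact LSHasWt.zero _
  -- The two systems differ at `i` by `c x ^ m y ^ n φ`, a product of nonzero factors in a domain.
  · intro h0
    have hX : ∀ {w : ℤ} {h : LaurentSeries (ZMu e q)}, h.coeff w = 1 → h ≠ 0 := by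
      rintro w _ h1 rfl
      exact zero_ne_one h1
    have h1 : MvPolynomial.aeval ![xt e q a b, yt e q a b] (MvPolynomial.C c *
        MvPolynomial.X 0 ^ (holExp e q i).1 * MvPolynomial.X 1 ^ (holExp e q i).2) * φ ≠ 0 := by
      refine mul_ne_zero ?_ hL.phi_ne_zero
      simp only [map_mul, map_pow, MvPolynomial.aeval_C, MvPolynomial.aeval_X]
      refine mul_ne_zero (mul_ne_zero ?_ (pow_ne_zero _ (hX hL.lead_x)))
        (pow_ne_zero _ (hX hL.lead_y))
      rw [laurent_algebraMap_eq_C]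
      simpa using hc0
    apply h1
    rw [Pi.add_apply, map_add, Pi.single_eq_same] at h0
    linear_combination h0
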